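/- Let $G$ be a finite group. Let $\mathbb{C}(G)$ be the Hopf algebra of functions on $G$ with basis $\delta_g$, and let $D^\vee(G)$ be the Hopf algebra with underlying algebra $\mathbb{C}(G)\otimes\mathbb{C}G$ and $$\Delta(\delta_g\otimes h)=\sum_{f\in G}\delta_f\otimes f^{-1}ghg^{-1}f\otimes\delta_{f^{-1}g}\otimes h,\quad \epsilon(\delta_g\otimes h)=\delta_{g,e},\quad S(\delta_g\otimes h)=\delta_{g^{-1}}\otimes gh^{-1}g^{-1}.$$ Let $\mathcal C\subseteq G$ be the conjugacy class of $r\in G$, let $q:\mathcal C\to G$ satisfy $q_c r q_c^{-1}=c$ for all $c\in\mathcal C$, and let $(\pi,V_\pi)$ be an irreducible complex representation of the centraliser $C_G$ of $r$, with $(\mathcal C,\pi)\neq(\{e\},1)$. On $V_{\mathcal C,\pi}=\mathbb{C}\mathcal C\otimes V_\pi$ let $G$ and $\mathbb{C}(G)$ act by $$h\triangleright(c\otimes w)=hch^{-1}\otimes\pi(q_{hch^{-1}}^{-1}hq_c)w,\qquad \delta_g\triangleright(c\otimes w)=\delta_{g,c}\,c\otimes w,$$ and let $\widetilde\pi$ be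 the resulting representation of $G$ (the one induced from $\pi$). For a Hopf algebra $H$ with $H^+=\ker\epsilon$ and $\pi_\epsilon h=h-\epsilon(h)1$, a right $H$-module $\Lambda$ and a right module map $\varpi:H^+\to\Lambda$ define on $H\otimes\Lambda$ the $H$-bimodule structure $a(h\otimes v)=ah\otimes v$, $(h\otimes v)a=ha_1\otimes v\triangleleft a_2$ and the derivation $\mathrm{d}h=h_1\otimes\varpi(\pi_\epsilon h_2)$. In this way one obtains: * $\Omega^1_{\mathcal C,\pi}$ on $D^\vee(G)$ from $\Lambda=\mathrm{End}(V_{\mathcal C,\pi})$, $T\triangleleft(\delta_g\otimes h)=\delta_g\circ T\circ h$, where $\varpi$ sends $\delta_g\otimes h$ (extended linearly and restricted to $D^\vee(G)^+$) to the operator $v\mapsto\delta_g\triangleright(h\triangleright v)$; * $\Omega^1_{\rho}$ on $\mathbb{C}G$, for a representation $\rho$ of $G$, from $\Lambda=\rho(\mathbb{C}G^+)$, $x\triangleleft g=x\rho(g)$, $\varpi=\rho|_{\mathbb{C}G^+}$; * $\Omega^1_{\mathcal C}$ on $\mathbb{C}(G)$, for $\mathcal C\ne\{e\}$, from $\Lambda=\Lambda^1_{\mathcal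 C}$ with basis $(e_c)_{c\in\mathcal C}$, $e_c\triangleleft\delta_g=\delta_{c,g}e_c$, $\varpi(f)=\sum_{c\in\mathcal C}f(c)e_c$. A (first order) differential calculus on an algebra $A$ is an $A$-bimodule with a derivation $\mathrm{d}$ of $A$ into it that is generated by $A$ and $\mathrm{d}A$. A calculus on a Hopf algebra $H$ is bicovariant if the coactions $h\,\mathrm{d}g\mapsto h_1g_1\otimes h_2\mathrm{d}g_2$ and $h\,\mathrm{d}g\mapsto h_1\mathrm{d}g_1\otimes h_2g_2$ are well defined; then $\varpi(h)=S(h_1)\mathrm{d}h_2$ is its Maurer–Cartan form and $\Lambda^1=\varpi(H)$ its space of left-invariant forms. Equip $D^\vee(G)$ with $\Omega^1_{\mathcal C,\pi}$. Let $p:P=D^\vee(G)\to H=\mathbb{C}(G)$, $\delta_g\otimes h\mapsto\delta_g$, let $\Delta_R=(\mathrm{id}\otimes p)\Delta$, written $\Delta_Rx=x^1\otimes x^2$, and let $A=\{a\in P:\Delta_Ra=a\otimes1\}$. Give $A$ the calculus $\Omega^1=A\,\mathrm{d}A\subseteq\Omega^1_{\mathcal C,\pi}$ obtained by restriction, and give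 $H$ the calculus with space of left-invariant forms $\Lambda^1=H^+/p(I)$, where $I\subseteq P^+$ is the kernel of the Maurer–Cartan form of $\Omega^1_{\mathcal C,\pi}$. Then: 1. These data form a quantum principal homogeneous bundle: $p$ is a surjective map of Hopf algebras; $P\otimes_AP\to P\otimes H$, $x\otimes y\mapsto x\,\Delta_Ry$, is bijective; the three bimodules with derivation are differential calculi, those on $P$ and $H$ are bicovariant, and $\Delta_R$ extends to $\Omega^1_P=\Omega^1_{\mathcal C,\pi}$ by $x\,\mathrm{d}y\mapsto x^1\mathrm{d}y^1\otimes x^2y^2$; the inclusion $A\hookrightarrow P$ is differentiable; the map $\mathrm{ver}(x\,\mathrm{d}y)=xy^1\otimes\varpi(y^2)$ is well defined and $$0\to P\,\Omega^1P\to\Omega^1_P\xrightarrow{\ \mathrm{ver}\ }P\otimes\Lambda^1\to0$$ is an exact sequence of left $P$-modules; and $\Delta$ restricts to a left coaction of $P$ on $A$, which is differentiable for the calculus $(\Omega^1_P\otimes A)\oplus(P\otimes\Omega^1)$ on $P\otimes A$. 2. $g\mapsto\sum_{f\in G}\delta_f\otimes f^{-1}gf$ defines an isomorphism of algebras $\mathbb{C}G\cong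 A$, and over it there is an isomorphism of differential calculi $\Omega^1_{\widetilde\pi}\cong\Omega^1$. 3. $\Lambda^1\cong\delta_{\pi,1}\Lambda^1_{\mathcal C}$: if $\pi$ is trivial, then the calculus on $\mathbb{C}(G)$ is isomorphic to $\Omega^1_{\mathcal C}$; if $\pi$ is non-trivial, then $\Lambda^1=0$. -/

import Mathlib

open scoped TensorProduct

noncomputable section

universe u v w

/-! ## First order differential calculi -/

/-- An `A`-bimodule `Form` (over `k`) with a derivation `d : A → Form`. It is a (first order)
differential calculus on `A` if it is moreover generated by `A` and `d A`, see
`PreCalculus.IsCalculus`. Right multiplication is written as an action of `Aᵐᵒᵖ`. -/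
structure PreCalculus (k : Type u) (A : Type v) [CommRing k] [Ring A] [Algebra k A] where
  Form : Type w
  [instAddCommGroup : AddCommGroup Form]
  [instModule : Module k Form]
  [instLeft : Module A Form]
  [instRight : Module Aᵐᵒᵖ Form]
  [instTowerLeft : IsScalarTower k A Form]
  [instTowerRight : IsScalarTower k Aᵐᵒᵖ Form]
  [instBimodule : SMulCommClass A Aᵐᵒᵖ Form]
  d : A →ₗ[k] Form
  leibniz : ∀ a b : A, d (a * b) = MulOpposite.op b • d a + a • d b

attribute [instance] PreCalculus.instAddCommGroup PreCalculus.instModule PreCalculus.instLeft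
  PreCalculus.instRight PreCalculus.instTowerLeft PreCalculus.instTowerRight
  PreCalculus.instBimodule

section Augmentation

variable (k : Type u) [CommRing k] (H : Type v) [Ring H] [Bialgebra k H]

/-- `H⁺ = ker ε`. -/
def augIdeal : Submodule k H := LinearMap.ker (Coalgebra.counit : H →ₗ[k] k)

/-- The projection `π_ε : H → H⁺`, `h ↦ h - ε(h) 1`. -/
def augProj : H →ₗ[k] augIdeal k H :=
  LinearMap.codRestrict _ (LinearMap.id - Algebra.linearMap k H ∘ₗ Coalgebra.counit)
    (fun x => by simp [augIdeal])

variable {k H}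

theorem augProj_coe (x : H) :
    (augProj k H x : H) = x - algebraMap k H (Coalgebra.counit x) := rfl

/-- Right multiplication by `y` on `H⁺`. -/
def augMul (y : H) : augIdeal k H →ₗ[k] augIdeal k H :=
  (LinearMap.mulRight k y).restrict (fun x hx => by
    simp only [augIdeal, LinearMap.mem_ker] at hx ⊢
    simp [hx])

end Augmentation

namespace PreCalculus

section Algebra

variable {k : Type u} [CommRing k] {A : Type v} [Ring A] [Algebra k A]

/-- The map `a ⊗ b ↦ a d b`. -/
def adb (Ω : PreCalculus k A) : A ⊗[k] A →ₗ[k] Ω.Form :=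
  TensorProduct.lift (LinearMap.mk₂ k (fun a b => a • Ω.d b)
    (fun a a' b => add_smul a a' _) (fun c a b => smul_assoc c a _)
    (fun a b b' => by rw [map_add, smul_add])
    (fun c a b => by
      rw [map_smul, ← algebraMap_smul A c (Ω.d b), ← mul_smul, ← Algebra.commutes, mul_smul,
        algebraMap_smul]))

/-- The bimodule is generated by `A` and `d A`; by the Leibniz rule this says that it is the span
of the elements `a d b`. -/
def IsCalculus (Ω : PreCalculus k A) : Prop :=
  Submodule.span k {ω : Ω.Form | ∃ a b : A, ω = a • Ω.d b} = ⊤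

/-- An isomorphism of calculi over an isomorphism `e : A ≃ B` of algebras: a linear bijection
respecting the bimodule structures and the derivations. -/
structure Iso {B : Type*} [Ring B] [Algebra k B] (e : A ≃ₐ[k] B)
    (Ω : PreCalculus k A) (Ω' : PreCalculus k B) extends Ω.Form ≃ₗ[k] Ω'.Form where
  map_left : ∀ (a : A) (ω : Ω.Form), toFun (a • ω) = e a • toFun ω
  map_right : ∀ (a : A) (ω : Ω.Form),
    toFun (MulOpposite.op a • ω) = MulOpposite.op (e a) • toFun ω
  map_d : ∀ a : A, toFun (Ω.d a) = Ω'.d (e a)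

/-- `B (d B) ⊆ Ω`, for a subalgebra `B` of `A`. -/
def restrictForms (Ω : PreCalculus k A) (B : Subalgebra k A) : Submodule B Ω.Form :=
  Submodule.span B (Set.range fun b : B => Ω.d (b : A))

theorem op_smul_mem_restrictForms (Ω : PreCalculus k A) (B : Subalgebra k A) (b : B)
    {ω : Ω.Form} (hω : ω ∈ Ω.restrictForms B) :
    MulOpposite.op (b : A) • ω ∈ Ω.restrictForms B := by
  unfold restrictForms at hω ⊢
  induction hω using Submodule.span_induction with
  | mem x hx =>
    obtain ⟨c, rfl⟩ := hx
    have h : MulOpposite.op (b : A) • Ω.d (c : A) = Ω.d ((c * b : B) : A) - c • Ω.d (b : A) := by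
      rw [Subalgebra.coe_mul, Ω.leibniz]
      simp [Subalgebra.smul_def]
    simp only [h]
    exact sub_mem (Submodule.subset_span ⟨c * b, rfl⟩)
      (Submodule.smul_mem _ _ (Submodule.subset_span ⟨b, rfl⟩))
  | zero => simp
  | add x y _ _ hx hy => rw [smul_add]; exact add_mem hx hy
  | smul a x _ hx =>
    rw [Subalgebra.smul_def, ← smul_comm (a : A) (MulOpposite.op (b : A)) x,
      ← Subalgebra.smul_def]
    exact Submodule.smul_mem _ _ hx

/-- The right action of `B` on `B (d B)`. -/
@[reducible] def restrictRight (Ω : PreCalculus k A) (B : Subalgebra k A) :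
    Module Bᵐᵒᵖ (Ω.restrictForms B) where
  smul := fun b ω => ⟨MulOpposite.op ((b.unop : B) : A) • (ω : Ω.Form),
    Ω.op_smul_mem_restrictForms B b.unop ω.2⟩
  one_smul := fun ω => Subtype.ext (one_smul Aᵐᵒᵖ (ω : Ω.Form))
  mul_smul := fun b c ω => Subtype.ext
    (mul_smul (MulOpposite.op ((b.unop : B) : A)) (MulOpposite.op ((c.unop : B) : A))
      (ω : Ω.Form))
  smul_zero := fun b => Subtype.ext (smul_zero (MulOpposite.op ((b.unop : B) : A)))
  smul_add := fun b ω η => Subtype.ext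
    (smul_add (MulOpposite.op ((b.unop : B) : A)) (ω : Ω.Form) (η : Ω.Form))
  add_smul := fun b c ω => Subtype.ext
    (add_smul (MulOpposite.op ((b.unop : B) : A)) (MulOpposite.op ((c.unop : B) : A))
      (ω : Ω.Form))
  zero_smul := fun ω => Subtype.ext (zero_smul Aᵐᵒᵖ (ω : Ω.Form))

/-- The calculus inherited by a subalgebra `B` of `A`: the sub-bimodule `B (d B)` of `Ω` with the
restriction of `d`. -/
def restrict (Ω : PreCalculus k A) (B : Subalgebra k A) : PreCalculus k B :=
  letI := Ω.restrictRight B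
  { Form := Ω.restrictForms B
    instTowerRight := ⟨fun c b ω => Subtype.ext
      (smul_assoc c (MulOpposite.op ((b.unop : B) : A)) (ω : Ω.Form))⟩
    instBimodule := ⟨fun b c ω => Subtype.ext
      (smul_comm (b : A) (MulOpposite.op ((c.unop : B) : A)) (ω : Ω.Form))⟩
    d :=
      { toFun := fun b => ⟨Ω.d (b : A), Submodule.subset_span ⟨b, rfl⟩⟩
        map_add' := fun b c => Subtype.ext (Ω.d.map_add (b : A) (c : A))
        map_smul' := fun c b => Subtype.ext (Ω.d.map_smul c (b : A)) }
    leibniz := fun b c => Subtype.ext (Ω.leibniz (b : A) (c : A)) }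

/-- For an algebra map `lam : A → B ⊗ C`, `a ↦ a¹ ⊗ a²`, and a calculus on `B`, the map
`a ⊗ b ↦ a¹ d b¹ ⊗ a² b²`. -/
def coactFst {B C : Type*} [Ring B] [Algebra k B] [Ring C] [Algebra k C]
    (Ω : PreCalculus k B) (lam : A →ₐ[k] B ⊗[k] C) : A ⊗[k] A →ₗ[k] Ω.Form ⊗[k] C :=
  TensorProduct.map Ω.adb (LinearMap.mul' k C) ∘ₗ
    (TensorProduct.tensorTensorTensorComm k B C B C).toLinearMap ∘ₗ
      TensorProduct.map lam.toLinearMap lam.toLinearMap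

/-- For an algebra map `lam : A → B ⊗ C`, `a ↦ a¹ ⊗ a²`, and a calculus on `C`, the map
`a ⊗ b ↦ a¹ b¹ ⊗ a² d b²`. -/
def coactSnd {B C : Type*} [Ring B] [Algebra k B] [Ring C] [Algebra k C]
    (Ω : PreCalculus k C) (lam : A →ₐ[k] B ⊗[k] C) : A ⊗[k] A →ₗ[k] B ⊗[k] Ω.Form :=
  TensorProduct.map (LinearMap.mul' k B) Ω.adb ∘ₗ
    (TensorProduct.tensorTensorTensorComm k B C B C).toLinearMap ∘ₗ
      TensorProduct.map lam.toLinearMap lam.toLinearMap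

/-- The assignment `a d b ↦ F (a ⊗ b)` is well defined on `Ω`. -/
def Extends {M : Type*} [AddCommGroup M] [Module k M] (Ω : PreCalculus k A)
    (F : A ⊗[k] A →ₗ[k] M) : Prop :=
  ∃ L : Ω.Form →ₗ[k] M, ∀ a b : A, L (a • Ω.d b) = F (a ⊗ₜ b)

end Algebra

section Hopf

variable {k : Type u} [CommRing k] {H : Type v} [Ring H] [HopfAlgebra k H]

/-- The left and right coactions `h d g ↦ h₁ g₁ ⊗ h₂ d g₂` and `h d g ↦ h₁ d g₁ ⊗ h₂ g₂` are well
defined. -/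
def IsBicovariant (Ω : PreCalculus k H) : Prop :=
  Ω.Extends (Ω.coactSnd (Bialgebra.comulAlgHom k H)) ∧
    Ω.Extends (Ω.coactFst (Bialgebra.comulAlgHom k H))

/-- The Maurer-Cartan form `ϖ(h) = S(h₁) d h₂`. As it vanishes at `1`, `ϖ(h) = ϖ(π_ε h)`. -/
def maurerCartan (Ω : PreCalculus k H) : H →ₗ[k] Ω.Form :=
  Ω.adb ∘ₗ (HopfAlgebra.antipode k).rTensor H ∘ₗ Coalgebra.comul

/-- The space `Λ¹` of left-invariant forms, the image of `ϖ`. -/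
def invariantForms (Ω : PreCalculus k H) : Submodule k Ω.Form := LinearMap.range Ω.maurerCartan

/-- The kernel `I` of `ϖ : H⁺ → Λ¹`. -/
def ideal (Ω : PreCalculus k H) : Submodule k H :=
  augIdeal k H ⊓ LinearMap.ker Ω.maurerCartan

theorem mul_mem_ideal (Ω : PreCalculus k H) {x : H} (hx : x ∈ Ω.ideal) (y : H) :
    x * y ∈ Ω.ideal := by
  obtain ⟨h1, h2⟩ := hx
  replace h1 : Coalgebra.counit (R := k) x = 0 := h1
  replace h2 : Ω.maurerCartan x = 0 := h2
  refine ⟨?_, ?_⟩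
  · change Coalgebra.counit (R := k) (x * y) = 0
    rw [Bialgebra.counit_mul, h1, zero_mul]
  change Ω.maurerCartan (x * y) = 0
  have key : ∀ (X : H ⊗[k] H) (a b : H),
      Ω.adb ((HopfAlgebra.antipode k).rTensor H (X * a ⊗ₜ b)) =
      HopfAlgebra.antipode k a • MulOpposite.op b • Ω.adb ((HopfAlgebra.antipode k).rTensor H X) +
      HopfAlgebra.antipode k a •
        (LinearMap.mul' k H ((HopfAlgebra.antipode k).rTensor H X)) • Ω.d b := by
    intro X a b
    induction X with
    | zero => simp
    | add X Y hX hY => simp only [add_mul, map_add, hX, hY, smul_add, add_smul]; abel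
    | tmul s t =>
      simp only [Algebra.TensorProduct.tmul_mul_tmul, LinearMap.rTensor_tmul, adb,
        TensorProduct.lift.tmul, LinearMap.mk₂_apply, HopfAlgebra.antipode_mul_antidistrib,
        Ω.leibniz, LinearMap.mul'_apply, smul_add, mul_smul]
      rw [smul_comm (HopfAlgebra.antipode k s) (MulOpposite.op b)]
  have key2 : ∀ Y : H ⊗[k] H,
      Ω.adb ((HopfAlgebra.antipode k).rTensor H (Coalgebra.comul x * Y)) = 0 := by
    intro Y
    induction Y with
    | zero => simp
    | add X Y hX hY => simp only [mul_add, map_add, hX, hY, add_zero]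
    | tmul s t =>
      rw [key, HopfAlgebra.mul_antipode_rTensor_comul_apply, h1]
      have : Ω.adb ((HopfAlgebra.antipode k).rTensor H (Coalgebra.comul x)) = 0 := h2
      rw [this]
      simp
  have := key2 (Coalgebra.comul y)
  rw [← Bialgebra.comul_mul] at this
  exact this

end Hopf

end PreCalculus

/-! ## The calculus `H ⊗ Λ` of a Maurer-Cartan form -/

/-- A right `H`-module `Lam` with a linear map `varpi : H → Lam`, standing for `ϖ ∘ π_ε` where
`ϖ : H⁺ → Lam` is a map of right `H`-modules; in terms of `varpi` the latter reads
`varpi (a b) = ε(a) varpi b + varpi a ◁ b`. -/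
structure MaurerCartanDatum (k : Type u) (H : Type v) [CommRing k] [Ring H] [Bialgebra k H] where
  Lam : Type w
  [instAddCommGroup : AddCommGroup Lam]
  [instModule : Module k Lam]
  act : Hᵐᵒᵖ →ₐ[k] Module.End k Lam
  varpi : H →ₗ[k] Lam
  varpi_mul : ∀ a b : H, varpi (a * b) =
    Coalgebra.counit (R := k) a • varpi b + act (MulOpposite.op b) (varpi a)

attribute [instance] MaurerCartanDatum.instAddCommGroup MaurerCartanDatum.instModule

namespace MaurerCartanDatum

variable {k : Type u} [CommRing k] {H : Type v} [Ring H] [Bialgebra k H]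

/-- `(h ⊗ v) · (a ⊗ b) = h a ⊗ v ◁ b` -/
def rightMul (D : MaurerCartanDatum k H) : H ⊗[k] H →ₗ[k] Module.End k (H ⊗[k] D.Lam) :=
  TensorProduct.lift ((TensorProduct.mapBilinear (RingHom.id k) H D.Lam H D.Lam).compl₁₂
    (LinearMap.mul k H).flip (D.act.toLinearMap ∘ₗ (MulOpposite.opLinearEquiv k).toLinearMap))

@[simp] theorem rightMul_tmul (D : MaurerCartanDatum k H) (a b h : H) (x : D.Lam) :
    D.rightMul (a ⊗ₜ b) (h ⊗ₜ x) = (h * a) ⊗ₜ D.act (MulOpposite.op b) x := rfl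

theorem rightMul_one (D : MaurerCartanDatum k H) : D.rightMul 1 = 1 := by
  ext h x
  rw [Algebra.TensorProduct.one_def]
  simp

theorem rightMul_mul (D : MaurerCartanDatum k H) (X Y : H ⊗[k] H) :
    D.rightMul (X * Y) = D.rightMul Y * D.rightMul X := by
  induction X with
  | zero => simp
  | add X X' hX hX' => simp only [add_mul, map_add, hX, hX', mul_add]
  | tmul a b =>
    induction Y with
    | zero => simp
    | add X X' hX hX' => simp only [add_mul, map_add, hX, hX', mul_add]
    | tmul a' b' => ext h x; simp [mul_assoc]

/-- Right multiplication on `H ⊗ Lam`, `(h ⊗ v) · a = h a₁ ⊗ v ◁ a₂`. -/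
def rightAct (D : MaurerCartanDatum k H) : Hᵐᵒᵖ →ₐ[k] Module.End k (H ⊗[k] D.Lam) :=
  AlgHom.ofLinearMap
    (D.rightMul ∘ₗ Coalgebra.comul ∘ₗ (MulOpposite.opLinearEquiv k).symm.toLinearMap)
    (by simp [rightMul_one]) (by intro a b; simp [rightMul_mul])

theorem rightMul_smul (D : MaurerCartanDatum k H) (X : H ⊗[k] H) (h : H) (ω : H ⊗[k] D.Lam) :
    D.rightMul X (h • ω) = h • D.rightMul X ω := by
  induction X with
  | zero => simp
  | add X Y hX hY => simp only [map_add, LinearMap.add_apply, hX, hY, smul_add]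
  | tmul a b =>
    induction ω with
    | zero => simp
    | add x y hx hy => simp only [smul_add, map_add, hx, hy]
    | tmul g x => simp [TensorProduct.smul_tmul', mul_assoc]

theorem lTensor_varpi_mul (D : MaurerCartanDatum k H) (X Y : H ⊗[k] H) :
    D.varpi.lTensor H (X * Y) = D.rightMul Y (D.varpi.lTensor H X) +
      TensorProduct.rid k H (Coalgebra.counit.lTensor H X) • D.varpi.lTensor H Y := by
  induction X with
  | zero => simp
  | add X X' hX hX' => simp only [add_mul, map_add, hX, hX', add_smul]; abel
  | tmul a b =>
    induction Y with
    | zero => simp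
    | add X X' hX hX' => simp only [map_add, hX, hX', mul_add, smul_add, LinearMap.add_apply]; abel
    | tmul a' b' =>
      simp [D.varpi_mul, TensorProduct.tmul_add, TensorProduct.smul_tmul', add_comm]

/-- `H ⊗ Lam`, with left multiplication on the first factor. -/
def Forms (D : MaurerCartanDatum k H) : Type (max v w) := H ⊗[k] D.Lam

instance (D : MaurerCartanDatum.{u, v, w} k H) : AddCommGroup D.Forms :=
  inferInstanceAs (AddCommGroup (H ⊗[k] D.Lam))

instance (D : MaurerCartanDatum.{u, v, w} k H) : Module k D.Forms :=
  inferInstanceAs (Module k (H ⊗[k] D.Lam))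

instance (D : MaurerCartanDatum.{u, v, w} k H) : Module H D.Forms :=
  inferInstanceAs (Module H (H ⊗[k] D.Lam))

instance (D : MaurerCartanDatum.{u, v, w} k H) : IsScalarTower k H D.Forms :=
  inferInstanceAs (IsScalarTower k H (H ⊗[k] D.Lam))

instance (D : MaurerCartanDatum.{u, v, w} k H) : Module Hᵐᵒᵖ D.Forms :=
  Module.compHom (H ⊗[k] D.Lam) D.rightAct.toRingHom

instance (D : MaurerCartanDatum.{u, v, w} k H) : IsScalarTower k Hᵐᵒᵖ D.Forms :=
  ⟨fun c h ω => by
    change D.rightAct (c • h) ω = c • D.rightAct h ω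
    rw [map_smul]; rfl⟩

instance (D : MaurerCartanDatum.{u, v, w} k H) : SMulCommClass H Hᵐᵒᵖ D.Forms :=
  ⟨fun a b ω => (D.rightMul_smul (Coalgebra.comul b.unop) a ω).symm⟩

/-- `d h = h₁ ⊗ ϖ(π_ε h₂)`. -/
def deriv (D : MaurerCartanDatum.{u, v, w} k H) : H →ₗ[k] D.Forms :=
  (D.varpi.lTensor H ∘ₗ Coalgebra.comul : H →ₗ[k] H ⊗[k] D.Lam)

/-- `H ⊗ Lam` with `(h ⊗ v) · a = h a₁ ⊗ v ◁ a₂` and `d h = h₁ ⊗ ϖ(π_ε h₂)`. -/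
def calculus (D : MaurerCartanDatum.{u, v, w} k H) : PreCalculus k H where
  Form := D.Forms
  d := D.deriv
  leibniz := fun a b => by
    change D.varpi.lTensor H (Coalgebra.comul (a * b)) =
      D.rightMul (Coalgebra.comul b) (D.varpi.lTensor H (Coalgebra.comul a)) +
      a • D.varpi.lTensor H (Coalgebra.comul b)
    rw [Bialgebra.comul_mul, lTensor_varpi_mul, Coalgebra.lTensor_counit_comul]
    simp

section Quotient

variable (J : Submodule k H) (hJ : ∀ x ∈ J, ∀ y : H, x * y ∈ J)

/-- The right action of `H` on `H⁺ / J`. -/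
def quotAct (y : Hᵐᵒᵖ) :
    Module.End k (augIdeal k H ⧸ J.comap (augIdeal k H).subtype) :=
  Submodule.mapQ _ _ (augMul y.unop) (fun _ hx => hJ _ hx _)

/-- `H⁺ → H⁺ / J` for a subspace `J` that is stable under right multiplication. -/
def ofRightIdeal : MaurerCartanDatum k H where
  Lam := augIdeal k H ⧸ J.comap (augIdeal k H).subtype
  act :=
    { toFun := quotAct J hJ
      map_one' := by
        ext x
        exact congrArg (Submodule.Quotient.mk) (Subtype.ext (mul_one (x : H)))
      map_mul' := fun y z => by
        ext x
        exact congrArg (Submodule.Quotient.mk) (Subtype.ext (mul_assoc (x : H) z.unop y.unop).symm)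
      map_zero' := by
        ext x
        exact congrArg (Submodule.Quotient.mk) (Subtype.ext (mul_zero (x : H)))
      map_add' := fun y z => by
        ext x
        exact congrArg (Submodule.Quotient.mk) (Subtype.ext (mul_add (x : H) y.unop z.unop))
      commutes' := fun c => by
        ext x
        exact congrArg (Submodule.Quotient.mk) (Subtype.ext (by
          simp [augMul, Algebra.algebraMap_eq_smul_one])) }
  varpi := Submodule.mkQ _ ∘ₗ augProj k H
  varpi_mul := fun a b => by
    refine congrArg (Submodule.Quotient.mk) (Subtype.ext (?_ :
      ((augProj k H (a * b) : augIdeal k H) : H) =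
      (Coalgebra.counit (R := k) a • augProj k H b + augMul b (augProj k H a) : augIdeal k H)))
    rw [Submodule.coe_add, Submodule.coe_smul, augProj_coe, augProj_coe]
    change _ = _ + ((augProj k H a : augIdeal k H) : H) * b
    rw [augProj_coe, Bialgebra.counit_mul, map_mul, Algebra.smul_def]
    noncomm_ring

end Quotient

end MaurerCartanDatum

/-! ## Quantum principal homogeneous bundles -/

section Bundle

variable {k : Type u} [CommRing k] {P : Type v} [Ring P] [HopfAlgebra k P]
  {H : Type w} [Ring H] [HopfAlgebra k H]

/-- The right coaction `(id ⊗ p) Δ` of `H` on `P`. -/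
def bundleCoaction (p : P →ₐc[k] H) : P →ₐ[k] P ⊗[k] H :=
  (Algebra.TensorProduct.map (AlgHom.id k P) (p : P →ₐ[k] H)).comp (Bialgebra.comulAlgHom k P)

/-- The base `A = P^H`, the subalgebra of all `a` with `Δ_R a = a ⊗ 1`. -/
def bundleBase (p : P →ₐc[k] H) : Subalgebra k P :=
  AlgHom.equalizer (bundleCoaction p) Algebra.TensorProduct.includeLeft

/-- The relations `p a ⊗ q = p ⊗ a q`, for `a ∈ A`. -/
def balancedRelations (A : Subalgebra k P) : Submodule k (P ⊗[k] P) :=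
  Submodule.span k {t | ∃ (x : P) (a : A) (y : P), t = (x * a) ⊗ₜ y - x ⊗ₜ (a * y)}

/-- `p ⊗ q ↦ p Δ_R q` on `P ⊗ P`. -/
def preGaloisMap (p : P →ₐc[k] H) : P ⊗[k] P →ₗ[k] P ⊗[k] H :=
  LinearMap.mul' k (P ⊗[k] H) ∘ₗ
    TensorProduct.map (Algebra.TensorProduct.includeLeft : P →ₐ[k] P ⊗[k] H).toLinearMap
      (bundleCoaction p).toLinearMap

/-- The map `P ⊗_A P → P ⊗ H`, `p ⊗ q ↦ p Δ_R q`. -/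
def galoisMap (p : P →ₐc[k] H) :
    ((P ⊗[k] P) ⧸ balancedRelations (bundleBase p)) →ₗ[k] P ⊗[k] H :=
  Submodule.liftQ _ (preGaloisMap p) (by
    rw [balancedRelations, Submodule.span_le]
    rintro _ ⟨x, a, y, rfl⟩
    have ha : bundleCoaction p (a : P) = (a : P) ⊗ₜ[k] (1 : H) := a.2
    simp only [SetLike.mem_coe, LinearMap.mem_ker, map_sub, preGaloisMap, LinearMap.comp_apply,
      TensorProduct.map_tmul, LinearMap.mul'_apply, AlgHom.toLinearMap_apply, map_mul, ha,
      Algebra.TensorProduct.includeLeft_apply, mul_assoc, sub_self])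

/-- `p ⊗ q ↦ p q¹ ⊗ ϖ(q²)`. -/
def preVer (p : P →ₐc[k] H) (ΩH : PreCalculus k H) : P ⊗[k] P →ₗ[k] P ⊗[k] ΩH.invariantForms :=
  ΩH.maurerCartan.rangeRestrict.lTensor P ∘ₗ preGaloisMap p

/-- `A ↪ P ↠ H` with the given calculi is a quantum principal homogeneous bundle: a Hopf-Galois
extension given by a surjection `p` of Hopf algebras, with a bicovariant calculus on `P` to which
the right coaction of `H` extends, a bicovariant calculus on `H`, and a calculus on the base `A`
such that `A ↪ P` is differentiable and
`0 → P Ω¹ P → Ω¹_P → P ⊗ Λ¹ → 0`, with the second map `ver (p d q) = p q¹ ⊗ ϖ(q²)`,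
is an exact sequence of left `P`-modules; further, `Δ` restricts to a left coaction of `P` on `A`,
which is differentiable for the calculus on `A` and the tensor product calculus
`(Ω¹_P ⊗ A) ⊕ (P ⊗ Ω¹)` on `P ⊗ A`. -/
structure IsPrincipalHomogeneousBundle (p : P →ₐc[k] H) (ΩP : PreCalculus k P)
    (ΩA : PreCalculus k (bundleBase p)) (ΩH : PreCalculus k H) : Prop where
  surjective : Function.Surjective p
  galois : Function.Bijective (galoisMap p)
  isCalculus_total : ΩP.IsCalculus
  isCalculus_base : ΩA.IsCalculus
  isCalculus_fibre : ΩH.IsCalculus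
  bicovariant_total : ΩP.IsBicovariant
  bicovariant_fibre : ΩH.IsBicovariant
  covariant_total : ΩP.Extends (ΩP.coactFst (bundleCoaction p))
  homogeneous : ∃ lam : bundleBase p →ₐ[k] P ⊗[k] bundleBase p,
    (∀ a : bundleBase p, Algebra.TensorProduct.map (AlgHom.id k P) (bundleBase p).val (lam a) =
      Bialgebra.comulAlgHom k P (a : P)) ∧
    ΩA.Extends (ΩP.coactFst lam) ∧ ΩA.Extends (ΩA.coactSnd lam)
  exact : ∃ (incl : ΩA.Form →ₗ[k] ΩP.Form) (ver : ΩP.Form →ₗ[P] P ⊗[k] ΩH.invariantForms),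
    (∀ a b : bundleBase p, incl (a • ΩA.d b) = (a : P) • ΩP.d (b : P)) ∧
    (∀ x y : P, ver (x • ΩP.d y) = preVer p ΩH (x ⊗ₜ y)) ∧
    Function.Surjective ver ∧
    ∀ ω : ΩP.Form, ver ω = 0 ↔
      ω ∈ Submodule.span k {η | ∃ (x y : P) (α : ΩA.Form), η = x • MulOpposite.op y • incl α}

theorem mul_mem_map_ideal (p : P →ₐc[k] H) (hp : Function.Surjective p) (ΩP : PreCalculus k P) :
    ∀ x ∈ ΩP.ideal.map (p : P →ₐ[k] H).toLinearMap, ∀ y : H,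
      x * y ∈ ΩP.ideal.map (p : P →ₐ[k] H).toLinearMap := by
  rintro _ ⟨x, hx, rfl⟩ y
  obtain ⟨z, rfl⟩ := hp y
  exact ⟨x * z, ΩP.mul_mem_ideal hx z, map_mul p x z⟩

/-- The calculus on `H` induced by the calculus on `P` along a surjection `p : P → H`, with
`Λ¹ = H⁺ / p(I)` where `I` is the kernel of the Maurer-Cartan form of `P`. -/
def fibreCalculus (p : P →ₐc[k] H) (hp : Function.Surjective p) (ΩP : PreCalculus k P) :
    PreCalculus k H :=
  (MaurerCartanDatum.ofRightIdeal (ΩP.ideal.map (p : P →ₐ[k] H).toLinearMap)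
    (mul_mem_map_ideal p hp ΩP)).calculus

end Bundle

/-! ## The Hopf algebras `ℂ(G)` and `D^∨(G)` -/

/-- `ℂ(G)`, the algebra of functions on `G`. -/
def FunAlg (G : Type u) : Type u := G → ℂ

namespace FunAlg

instance {G : Type u} : CommRing (FunAlg G) := inferInstanceAs (CommRing (G → ℂ))
instance {G : Type u} : Algebra ℂ (FunAlg G) := inferInstanceAs (Algebra ℂ (G → ℂ))

/-- The basis `δ_g`. -/
def basis (G : Type u) [Fintype G] [DecidableEq G] : Module.Basis G ℂ (FunAlg G) :=
  Pi.basisFun ℂ G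

/-- `δ_g`. -/
def delta {G : Type u} [DecidableEq G] (g : G) : FunAlg G := Pi.single g (1 : ℂ)

theorem delta_mul_delta {G : Type u} [DecidableEq G] (g h : G) :
    FunAlg.delta g * FunAlg.delta h = if g = h then FunAlg.delta g else 0 := by
  funext x
  change (Pi.single g (1 : ℂ) : G → ℂ) x * (Pi.single h (1 : ℂ) : G → ℂ) x = _
  split_ifs with h1
  · subst h1
    by_cases hx : x = g
    · subst hx; simp [FunAlg.delta]
    · simp [FunAlg.delta, hx]
  · by_cases hx : x = g
    · subst hx; simp [h1]; rfl
    · simp [hx]; rfl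

section

variable {G : Type u} [Fintype G] [DecidableEq G]

theorem basis_apply (g : G) : FunAlg.basis G g = FunAlg.delta g := Pi.basisFun_apply ℂ G g

theorem one_eq_sum : (1 : FunAlg G) = ∑ g : G, FunAlg.delta g := by
  change (fun _ => (1 : ℂ)) = ∑ g : G, (Pi.single g (1 : ℂ) : G → ℂ)
  exact (Finset.univ_sum_single (fun _ : G => (1 : ℂ))).symm

variable [Group G]

/-- `Δ δ_g = ∑_{ab = g} δ_a ⊗ δ_b`, `ε δ_g = δ_{g,e}`. -/
instance : CoalgebraStruct ℂ (FunAlg G) where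
  comul := (basis G).constr ℂ fun g => ∑ a : G, delta a ⊗ₜ[ℂ] delta (a⁻¹ * g)
  counit := (basis G).constr ℂ fun g => if g = 1 then 1 else 0

theorem comul_delta (g : G) : Coalgebra.comul (R := ℂ) (delta g) = ∑ a : G, delta a ⊗ₜ[ℂ] delta (a⁻¹ * g) := by
  rw [← basis_apply]; exact (basis G).constr_basis ℂ _ g

theorem counit_delta (g : G) : Coalgebra.counit (R := ℂ) (delta g) = if g = 1 then 1 else 0 := by
  rw [← basis_apply]; exact (basis G).constr_basis ℂ _ g

instance : Coalgebra ℂ (FunAlg G) where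
  coassoc := by
    refine (basis G).ext fun g => ?_
    simp only [basis_apply, LinearMap.comp_apply, comul_delta, map_sum, LinearMap.rTensor_tmul, LinearMap.lTensor_tmul, TensorProduct.sum_tmul, TensorProduct.tmul_sum, LinearEquiv.coe_coe, TensorProduct.assoc_tmul]
    rw [Finset.sum_comm]
    refine Finset.sum_congr rfl fun a _ => ?_
    refine Fintype.sum_equiv (Equiv.mulLeft a⁻¹) _ _ fun b => ?_
    simp [mul_assoc]
  rTensor_counit_comp_comul := by
    refine (basis G).ext fun g => ?_
    simp [basis_apply, comul_delta, counit_delta, TensorProduct.ite_tmul]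
  lTensor_counit_comp_comul := by
    refine (basis G).ext fun g => ?_
    simp [basis_apply, comul_delta, counit_delta, TensorProduct.tmul_ite, inv_mul_eq_one]

instance : Bialgebra ℂ (FunAlg G) :=
  Bialgebra.mk' ℂ (FunAlg G)
    (by simp [one_eq_sum, counit_delta])
    (by
      have : (LinearMap.mul ℂ (FunAlg G)).compr₂ Coalgebra.counit = (LinearMap.mul ℂ ℂ).compl₁₂ Coalgebra.counit Coalgebra.counit := by
        refine (basis G).ext fun g => (basis G).ext fun h => ?_
        simp only [basis_apply, LinearMap.compr₂_apply, LinearMap.compl₁₂_apply, LinearMap.mul_apply', delta_mul_delta, counit_delta, apply_ite, map_zero]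
        split_ifs <;> simp_all
      intro a b
      exact LinearMap.congr_fun₂ this a b)
    (by
      simp only [one_eq_sum, map_sum, comul_delta, Algebra.TensorProduct.one_def, TensorProduct.sum_tmul, TensorProduct.tmul_sum]
      rw [Finset.sum_comm]
      conv_rhs => rw [Finset.sum_comm]
      refine Finset.sum_congr rfl fun a _ => ?_
      exact Fintype.sum_equiv (Equiv.mulLeft a⁻¹) _ _ fun b => rfl)
    (by
      have : (LinearMap.mul ℂ (FunAlg G)).compr₂ Coalgebra.comul = (LinearMap.mul ℂ (FunAlg G ⊗[ℂ] FunAlg G)).compl₁₂ Coalgebra.comul Coalgebra.comul := by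
        refine (basis G).ext fun g => (basis G).ext fun h => ?_
        simp only [basis_apply, LinearMap.compr₂_apply, LinearMap.compl₁₂_apply,
          LinearMap.mul_apply', delta_mul_delta, comul_delta, Finset.sum_mul_sum,
          Algebra.TensorProduct.tmul_mul_tmul]
        have key : ∀ a : G, ∑ b : G, (if a = b then delta a else 0 : FunAlg G) ⊗ₜ[ℂ]
            (if a⁻¹ * g = b⁻¹ * h then delta (a⁻¹ * g) else 0 : FunAlg G) =
            if g = h then delta a ⊗ₜ[ℂ] delta (a⁻¹ * g) else 0 := fun a => by
          rw [Finset.sum_eq_single a (fun b _ hb => by simp [hb.symm]) (by simp)]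
          by_cases hgh : g = h <;> simp [hgh]
        simp only [key]
        by_cases hgh : g = h
        · simp [hgh, comul_delta]
        · simp [hgh]
      intro a b
      exact LinearMap.congr_fun₂ this a b)

/-- `S δ_g = δ_{g⁻¹}`. -/
instance : HopfAlgebra ℂ (FunAlg G) where
  antipode := (basis G).constr ℂ fun g => delta g⁻¹
  mul_antipode_rTensor_comul := by
    refine (basis G).ext fun g => ?_
    have hS : ∀ x : G, (basis G).constr ℂ (fun g => delta g⁻¹) (delta x) = delta x⁻¹ := fun x => by
      rw [← basis_apply]; exact (basis G).constr_basis ℂ _ x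
    simp only [basis_apply, LinearMap.comp_apply, comul_delta, map_sum, LinearMap.rTensor_tmul, hS, LinearMap.mul'_apply, delta_mul_delta, counit_delta, left_eq_mul]
    split_ifs <;> simp [one_eq_sum]
    exact Fintype.sum_equiv (Equiv.inv G) _ _ fun b => rfl
  mul_antipode_lTensor_comul := by
    refine (basis G).ext fun g => ?_
    have hS : ∀ x : G, (basis G).constr ℂ (fun g => delta g⁻¹) (delta x) = delta x⁻¹ := fun x => by
      rw [← basis_apply]; exact (basis G).constr_basis ℂ _ x
    simp only [basis_apply, LinearMap.comp_apply, comul_delta, map_sum, LinearMap.lTensor_tmul, hS, LinearMap.mul'_apply, delta_mul_delta, counit_delta, mul_inv_rev, inv_inv, right_eq_mul, inv_eq_one]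
    split_ifs <;> simp [one_eq_sum]

end

end FunAlg

/-- `D^∨(G)`, with underlying algebra `ℂ(G) ⊗ ℂG`. -/
def Dvee (G : Type u) [Group G] : Type u := FunAlg G ⊗[ℂ] MonoidAlgebra ℂ G

namespace Dvee
instance {G : Type u} [Group G] : Ring (Dvee G) := inferInstanceAs (Ring (FunAlg G ⊗[ℂ] MonoidAlgebra ℂ G))
instance {G : Type u} [Group G] : Algebra ℂ (Dvee G) := inferInstanceAs (Algebra ℂ (FunAlg G ⊗[ℂ] MonoidAlgebra ℂ G))

/-- `f ⊗ a`. -/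
def mk {G : Type u} [Group G] (f : FunAlg G) (a : MonoidAlgebra ℂ G) : Dvee G := f ⊗ₜ[ℂ] a

theorem mk_mul_mk {G : Type u} [Group G] (f g : FunAlg G) (a b : MonoidAlgebra ℂ G) :
    mk f a * mk g b = mk (f * g) (a * b) :=
  Algebra.TensorProduct.tmul_mul_tmul f g a b

theorem induction {G : Type u} [Group G] {motive : Dvee G → Prop}
    (tmul : ∀ f a, motive (mk f a)) (add : ∀ x y, motive x → motive y → motive (x + y))
    (x : Dvee G) : motive x :=
  TensorProduct.induction_on (motive := motive) x
    (by simpa only [mk, TensorProduct.zero_tmul] using tmul 0 0) tmul add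

/-- `δ_g ⊗ h`. -/
def el {G : Type u} [Group G] [DecidableEq G] (g h : G) : Dvee G := FunAlg.delta g ⊗ₜ[ℂ] MonoidAlgebra.single h (1 : ℂ)

theorem el_mul_el {G : Type u} [Group G] [DecidableEq G] (g h g' h' : G) : el g h * el g' h' = if g = g' then el g (h * h') else 0 := by
  have : el g h * el g' h' = (FunAlg.delta g * FunAlg.delta g') ⊗ₜ[ℂ] (MonoidAlgebra.single h (1 : ℂ) * MonoidAlgebra.single h' 1) := Algebra.TensorProduct.tmul_mul_tmul _ _ _ _
  rw [this, FunAlg.delta_mul_delta, MonoidAlgebra.single_mul_single, TensorProduct.ite_tmul, mul_one]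
  rfl

section

variable {G : Type u} [Group G] [Fintype G] [DecidableEq G]

/-- The basis `δ_g ⊗ h`. -/
def basis (G : Type u) [Group G] [Fintype G] [DecidableEq G] : Module.Basis (G × G) ℂ (Dvee G) :=
  (FunAlg.basis G).tensorProduct (MonoidAlgebra.basis G ℂ)

theorem basis_apply (x : G × G) : basis G x = el x.1 x.2 := by
  change (FunAlg.basis G).tensorProduct (MonoidAlgebra.basis G ℂ) x = _
  rw [Module.Basis.tensorProduct_apply', FunAlg.basis_apply, MonoidAlgebra.basis_apply]
  rfl

theorem one_eq_sum : (1 : Dvee G) = ∑ g : G, el g 1 := by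
  have : (1 : Dvee G) = (1 : FunAlg G) ⊗ₜ[ℂ] (1 : MonoidAlgebra ℂ G) := rfl
  rw [this, FunAlg.one_eq_sum, TensorProduct.sum_tmul]
  rfl

/-- `Δ (δ_g ⊗ h) = ∑_f δ_f ⊗ f⁻¹ghg⁻¹f ⊗ δ_{f⁻¹g} ⊗ h`, `ε (δ_g ⊗ h) = δ_{g,e}`. -/
instance : CoalgebraStruct ℂ (Dvee G) where
  comul := (basis G).constr ℂ fun x =>
    ∑ f : G, el f (f⁻¹ * x.1 * x.2 * x.1⁻¹ * f) ⊗ₜ[ℂ] el (f⁻¹ * x.1) x.2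
  counit := (basis G).constr ℂ fun x => if x.1 = 1 then 1 else 0

theorem comul_el (g h : G) : Coalgebra.comul (R := ℂ) (el g h) =
    ∑ f : G, el f (f⁻¹ * g * h * g⁻¹ * f) ⊗ₜ[ℂ] el (f⁻¹ * g) h := by
  rw [← basis_apply (g, h)]; exact (basis G).constr_basis ℂ _ (g, h)

theorem counit_el (g h : G) : Coalgebra.counit (R := ℂ) (el g h) = if g = 1 then 1 else 0 := by
  rw [← basis_apply (g, h)]; exact (basis G).constr_basis ℂ _ (g, h)

instance : Coalgebra ℂ (Dvee G) where
  coassoc := by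
    refine (basis G).ext fun ⟨g, h⟩ => ?_
    simp only [basis_apply, LinearMap.comp_apply, comul_el, map_sum, LinearMap.rTensor_tmul, LinearMap.lTensor_tmul, TensorProduct.sum_tmul, TensorProduct.tmul_sum, LinearEquiv.coe_coe, TensorProduct.assoc_tmul]
    rw [Finset.sum_comm]
    refine Finset.sum_congr rfl fun a _ => ?_
    refine Fintype.sum_equiv (Equiv.mulLeft a⁻¹) _ _ fun b => ?_
    simp [mul_assoc]
  rTensor_counit_comp_comul := by
    refine (basis G).ext fun ⟨g, h⟩ => ?_
    simp [basis_apply, comul_el, counit_el, TensorProduct.ite_tmul]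
  lTensor_counit_comp_comul := by
    refine (basis G).ext fun ⟨g, h⟩ => ?_
    simp [basis_apply, comul_el, counit_el, TensorProduct.tmul_ite, inv_mul_eq_one]

instance : Bialgebra ℂ (Dvee G) :=
  Bialgebra.mk' ℂ (Dvee G)
    (by simp [one_eq_sum, counit_el])
    (by
      have : (LinearMap.mul ℂ (Dvee G)).compr₂ Coalgebra.counit = (LinearMap.mul ℂ ℂ).compl₁₂ Coalgebra.counit Coalgebra.counit := by
        refine (basis G).ext fun g => (basis G).ext fun h => ?_
        simp only [basis_apply, LinearMap.compr₂_apply, LinearMap.compl₁₂_apply, LinearMap.mul_apply', el_mul_el, counit_el, apply_ite, map_zero]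
        split_ifs <;> simp_all
      intro a b
      exact LinearMap.congr_fun₂ this a b)
    (by
      simp only [one_eq_sum, map_sum, comul_el, Algebra.TensorProduct.one_def, TensorProduct.sum_tmul, TensorProduct.tmul_sum]
      rw [Finset.sum_comm]
      conv_rhs => rw [Finset.sum_comm]
      refine Finset.sum_congr rfl fun a _ => ?_
      exact Fintype.sum_equiv (Equiv.mulLeft a⁻¹) _ _ fun b => by simp)
    (by
      have : (LinearMap.mul ℂ (Dvee G)).compr₂ Coalgebra.comul = (LinearMap.mul ℂ (Dvee G ⊗[ℂ] Dvee G)).compl₁₂ Coalgebra.comul Coalgebra.comul := by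
        refine (basis G).ext fun ⟨g, x⟩ => (basis G).ext fun ⟨h, y⟩ => ?_
        simp only [basis_apply, LinearMap.compr₂_apply, LinearMap.compl₁₂_apply,
          LinearMap.mul_apply', el_mul_el, comul_el, Finset.sum_mul_sum,
          Algebra.TensorProduct.tmul_mul_tmul]
        have key : ∀ a : G, ∑ b : G,
            (if a = b then el a ((a⁻¹ * g * x * g⁻¹ * a) * (b⁻¹ * h * y * h⁻¹ * b)) else 0 :
              Dvee G) ⊗ₜ[ℂ]
            (if a⁻¹ * g = b⁻¹ * h then el (a⁻¹ * g) (x * y) else 0 : Dvee G) =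
            if g = h then el a (a⁻¹ * g * (x * y) * g⁻¹ * a) ⊗ₜ[ℂ] el (a⁻¹ * g) (x * y)
              else 0 := fun a => by
          rw [Finset.sum_eq_single a (fun b _ hb => by simp [hb.symm]) (by simp)]
          by_cases hgh : g = h <;> simp [hgh, mul_assoc]
        simp only [key]
        by_cases hgh : g = h
        · simp [hgh, comul_el]
        · simp [hgh]
      intro a b
      exact LinearMap.congr_fun₂ this a b)

/-- `S (δ_g ⊗ h) = δ_{g⁻¹} ⊗ gh⁻¹g⁻¹`. -/
instance : HopfAlgebra ℂ (Dvee G) where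
  antipode := (basis G).constr ℂ fun x => el x.1⁻¹ (x.1 * x.2⁻¹ * x.1⁻¹)
  mul_antipode_rTensor_comul := by
    refine (basis G).ext fun ⟨g, h⟩ => ?_
    have hS : ∀ x y : G, (basis G).constr ℂ (fun x => el x.1⁻¹ (x.1 * x.2⁻¹ * x.1⁻¹)) (el x y) = el x⁻¹ (x * y⁻¹ * x⁻¹) := fun x y => by
      rw [← basis_apply (x, y)]; exact (basis G).constr_basis ℂ _ (x, y)
    simp only [basis_apply, LinearMap.comp_apply, comul_el, map_sum, LinearMap.rTensor_tmul, hS, LinearMap.mul'_apply, el_mul_el, counit_el, left_eq_mul]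
    split_ifs with hg <;> simp [one_eq_sum]
    subst hg
    exact Fintype.sum_equiv (Equiv.inv G) _ _ fun b => by simp [mul_assoc]
  mul_antipode_lTensor_comul := by
    refine (basis G).ext fun ⟨g, h⟩ => ?_
    have hS : ∀ x y : G, (basis G).constr ℂ (fun x => el x.1⁻¹ (x.1 * x.2⁻¹ * x.1⁻¹)) (el x y) = el x⁻¹ (x * y⁻¹ * x⁻¹) := fun x y => by
      rw [← basis_apply (x, y)]; exact (basis G).constr_basis ℂ _ (x, y)
    simp only [basis_apply, LinearMap.comp_apply, comul_el, map_sum, LinearMap.lTensor_tmul, hS, LinearMap.mul'_apply, el_mul_el, counit_el, mul_inv_rev, inv_inv, right_eq_mul, inv_eq_one]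
    split_ifs with hg <;> simp [one_eq_sum]
    subst hg
    simp [mul_assoc]


/-- `δ_g ⊗ h ↦ δ_g`, as a map of algebras. -/
def projAlgHom (G : Type u) [Group G] : Dvee G →ₐ[ℂ] FunAlg G :=
  (Algebra.TensorProduct.rid ℂ ℂ (FunAlg G)).toAlgHom.comp
    (Algebra.TensorProduct.map (AlgHom.id ℂ (FunAlg G))
      (Bialgebra.counitAlgHom ℂ (MonoidAlgebra ℂ G)))

theorem projAlgHom_el {G : Type u} [Group G] [DecidableEq G] (g h : G) : projAlgHom G (el g h) = FunAlg.delta g := by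
  change Algebra.TensorProduct.rid ℂ ℂ (FunAlg G) (FunAlg.delta g ⊗ₜ[ℂ]
    Coalgebra.counit (R := ℂ) (MonoidAlgebra.single h (1 : ℂ))) = _
  simp

/-- The map of Hopf algebras `D^∨(G) → ℂ(G)`, `δ_g ⊗ h ↦ δ_g`. -/
def projFun (G : Type u) [Group G] [Fintype G] [DecidableEq G] : Dvee G →ₐc[ℂ] FunAlg G :=
  BialgHom.ofAlgHom (projAlgHom G)
    (by
      apply AlgHom.toLinearMap_injective
      refine (basis G).ext fun x => ?_
      simp [basis_apply, projAlgHom_el, FunAlg.counit_delta, counit_el])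
    (by
      apply AlgHom.toLinearMap_injective
      refine (basis G).ext fun x => ?_
      simp [basis_apply, projAlgHom_el, FunAlg.comul_delta, comul_el])
theorem projFun_surjective (G : Type u) [Group G] [Fintype G] [DecidableEq G] :
    Function.Surjective (projFun G) := by
  intro f
  refine ⟨(f ⊗ₜ[ℂ] (1 : MonoidAlgebra ℂ G) : FunAlg G ⊗[ℂ] MonoidAlgebra ℂ G), ?_⟩
  change Algebra.TensorProduct.rid ℂ ℂ (FunAlg G) (f ⊗ₜ[ℂ]
    Coalgebra.counit (R := ℂ) (1 : MonoidAlgebra ℂ G)) = _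
  simp

end

end Dvee

/-! ## The calculi `Ω¹_S` on `ℂ(G)` and `Ω¹_ρ` on `ℂG` -/

section GroupCalculi

variable {G : Type u} [Group G]

/-- The right module `Λ¹_S` with basis `(e_s)_{s ∈ S}`, realised as the functions on `S`, with
`e_s ◁ f = f(s) e_s` and `ϖ(π_ε f) = ∑_s (f(s) - f(e)) e_s`. For `e ∉ S` the latter says that
`ϖ(π_ε δ_g)` is `e_g` for `g ∈ S` and `0` for `g ∉ S ∪ {e}`. -/
def setDatum [Fintype G] [DecidableEq G] (S : Set G) : MaurerCartanDatum ℂ (FunAlg G) where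
  Lam := S → ℂ
  act := AlgHom.ofLinearMap
    (LinearMap.mk₂ ℂ (fun (f : (FunAlg G)ᵐᵒᵖ) (x : S → ℂ) (s : S) => (f.unop : G → ℂ) s * x s)
      (fun f g x => funext fun s => add_mul _ _ _)
      (fun c f x => funext fun s => mul_assoc c _ _)
      (fun f x y => funext fun s => mul_add _ _ _)
      (fun c f x => funext fun s => mul_left_comm _ c _))
    (LinearMap.ext fun x => funext fun s => one_mul _)
    (fun f g => LinearMap.ext fun x => funext fun s => by
      change ((g.unop : G → ℂ) s * (f.unop : G → ℂ) s) * x s =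
        (f.unop : G → ℂ) s * ((g.unop : G → ℂ) s * x s)
      ring)
  varpi :=
    { toFun := fun (f : G → ℂ) (s : S) => f s - Coalgebra.counit (R := ℂ) (A := FunAlg G) f
      map_add' := fun f g => funext fun s => by
        change (f s + g s : ℂ) - Coalgebra.counit (R := ℂ) (A := FunAlg G) (f + g) =
          (f s - _) + (g s - _)
        rw [map_add]; ring
      map_smul' := fun c f => funext fun s => by
        change (c * f s : ℂ) - Coalgebra.counit (R := ℂ) (A := FunAlg G) (c • f) =
          c * (f s - _)
        rw [map_smul, smul_eq_mul]; ring }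
  varpi_mul := fun f g => funext fun s => by
    change ((f : G → ℂ) s * (g : G → ℂ) s : ℂ) - Coalgebra.counit (R := ℂ) (f * g) =
      Coalgebra.counit (R := ℂ) f * ((g : G → ℂ) s - Coalgebra.counit (R := ℂ) g) +
        (g : G → ℂ) s * ((f : G → ℂ) s - Coalgebra.counit (R := ℂ) f)
    rw [Bialgebra.counit_mul]; ring

/-- The calculus `Ω¹_S = ℂ(G) ⊗ Λ¹_S` of a conjugation-stable set `S` with `e ∉ S`, with `d f = ∑_s (R_s f - f) e_s` and `e_s f = R_s(f) e_s`,
where `(R_s f)(x) = f(xs)`. -/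
def setCalculus [Fintype G] [DecidableEq G] (S : Set G) : PreCalculus ℂ (FunAlg G) :=
  (setDatum S).calculus

variable {W : Type v} [AddCommGroup W] [Module ℂ W]

/-- `ρ(ℂG⁺) ⊆ End W`. -/
def repImage (ρ : Representation ℂ G W) : Submodule ℂ (Module.End ℂ W) :=
  (augIdeal ℂ (MonoidAlgebra ℂ G)).map ρ.asAlgebraHom.toLinearMap

theorem mul_mem_repImage (ρ : Representation ℂ G W) (a : MonoidAlgebra ℂ G)
    {x : Module.End ℂ W} (hx : x ∈ repImage ρ) :
    LinearMap.mulRight ℂ (ρ.asAlgebraHom a) x ∈ repImage ρ := by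
  obtain ⟨y, hy, rfl⟩ := hx
  exact ⟨y * a, (augMul a ⟨y, hy⟩).2, map_mul ρ.asAlgebraHom y a⟩

/-- The right module `ρ(ℂG⁺)` with `x ◁ g = x ρ(g)` and `ϖ = ρ|_{ℂG⁺}`. -/
def repDatum (ρ : Representation ℂ G W) : MaurerCartanDatum ℂ (MonoidAlgebra ℂ G) where
  Lam := repImage ρ
  act :=
    { toFun := fun a => (LinearMap.mulRight ℂ (ρ.asAlgebraHom a.unop)).restrict
        (fun _ hx => mul_mem_repImage ρ a.unop hx)
      map_one' := LinearMap.ext fun x => Subtype.ext (by simp)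
      map_mul' := fun a b => LinearMap.ext fun x => Subtype.ext (by simp [mul_assoc])
      map_zero' := LinearMap.ext fun x => Subtype.ext (by simp)
      map_add' := fun a b => LinearMap.ext fun x => Subtype.ext (by simp [mul_add])
      commutes' := fun c => LinearMap.ext fun x => Subtype.ext (by
        simp [Algebra.algebraMap_eq_smul_one]) }
  varpi := LinearMap.codRestrict _
    (ρ.asAlgebraHom.toLinearMap ∘ₗ (augIdeal ℂ _).subtype ∘ₗ augProj ℂ _)
    (fun a => ⟨_, (augProj ℂ _ a).2, rfl⟩)
  varpi_mul := fun a b => Subtype.ext (by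
    change ρ.asAlgebraHom (augProj ℂ (MonoidAlgebra ℂ G) (a * b)) =
      Coalgebra.counit (R := ℂ) a • ρ.asAlgebraHom (augProj ℂ (MonoidAlgebra ℂ G) b) +
        ρ.asAlgebraHom (augProj ℂ (MonoidAlgebra ℂ G) a) * ρ.asAlgebraHom b
    rw [← map_mul, ← map_smul, ← map_add, augProj_coe, augProj_coe, augProj_coe,
      Bialgebra.counit_mul, map_mul, Algebra.smul_def]
    congr 1
    noncomm_ring)

/-- The calculus `Ω¹_ρ = ℂG ⊗ ρ(ℂG⁺)`, with `x g = g ⊗ x ρ(g)` and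
`d g = g ⊗ (ρ(g) - 1)`. -/
def repCalculus (ρ : Representation ℂ G W) : PreCalculus ℂ (MonoidAlgebra ℂ G) :=
  (repDatum ρ).calculus

end GroupCalculi

/-! ## The representation `V_{C,π}` of `D(G)` and the calculus `Ω¹_{C,π}` on `D^∨(G)` -/

section DoubleCalculi

variable {G : Type u} [Group G] {r : G}

/-- `c ↦ h c h⁻¹` on the conjugacy class of `r`. -/
def conjClassAct (h : G) (c : conjugatesOf r) : conjugatesOf r :=
  ⟨h * c * h⁻¹, c.2.trans (isConj_iff.2 ⟨h, rfl⟩)⟩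

/-- `ζ_c(h) = q_{hch⁻¹}⁻¹ h q_c`, an element of the centraliser of `r`. -/
def centCocycle (q : conjugatesOf r → G) (hq : ∀ c, q c * r * (q c)⁻¹ = c) (h : G)
    (c : conjugatesOf r) : Subgroup.centralizer ({r} : Set G) :=
  ⟨(q (conjClassAct h c))⁻¹ * h * q c, by
    rw [Subgroup.mem_centralizer_singleton_iff]
    have h1 := hq c
    have h2 := hq (conjClassAct h c)
    change _ = h * (c : G) * h⁻¹ at h2
    rw [← h1] at h2
    set x := q (conjClassAct h c)
    have h3 : x * r = h * (q c * r * (q c)⁻¹) * h⁻¹ * x := by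
      rw [← h2]; group
    calc x⁻¹ * h * q c * r = x⁻¹ * (h * (q c * r * (q c)⁻¹) * h⁻¹ * x) * x⁻¹ * h * q c := by group
      _ = r * (x⁻¹ * h * q c) := by rw [← h3]; group⟩

variable {V : Type v} [AddCommGroup V] [Module ℂ V]

/-- The action `h ▷ (c ⊗ w) = hch⁻¹ ⊗ π(ζ_c(h)) w` of `G` on `V_{C,π} = ℂC ⊗ V`; this is the
representation of `G` induced by `π`. The space `ℂC ⊗ V` is realised as `C →₀ V`. -/
def inducedRep (q : conjugatesOf r → G) (hq : ∀ c, q c * r * (q c)⁻¹ = c)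
    (π : Representation ℂ (Subgroup.centralizer ({r} : Set G)) V) :
    Representation ℂ G (conjugatesOf r →₀ V) where
  toFun h := Finsupp.lsum ℂ fun c =>
    Finsupp.lsingle (conjClassAct h c) ∘ₗ π (centCocycle q hq h c)
  map_one' := by
    ext c w : 2
    have h1 : conjClassAct 1 c = c := Subtype.ext (by simp [conjClassAct])
    have h2 : centCocycle q hq 1 c = 1 := Subtype.ext (by simp [centCocycle, h1])
    simp [h1, h2]
  map_mul' g h := by
    ext c w : 2
    have h1 : conjClassAct (g * h) c = conjClassAct g (conjClassAct h c) :=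
      Subtype.ext (by simp [conjClassAct, mul_assoc])
    have h2 : centCocycle q hq (g * h) c =
        centCocycle q hq g (conjClassAct h c) * centCocycle q hq h c :=
      Subtype.ext (by simp [centCocycle, h1, mul_assoc])
    simp [h1, h2]

/-- The action `δ_g ▷ (c ⊗ w) = δ_{g,c} c ⊗ w` of `ℂ(G)` on `V_{C,π}`. -/
def gradeAct (r : G) (V : Type v) [AddCommGroup V] [Module ℂ V] :
    FunAlg G →ₐ[ℂ] Module.End ℂ (conjugatesOf r →₀ V) where
  toFun f := Finsupp.lsum ℂ fun c => (f : G → ℂ) (c : G) • Finsupp.lsingle c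
  map_one' := by
    ext c w : 2
    have : (1 : FunAlg G) (c : G) = (1 : ℂ) := rfl
    simp [this]
  map_mul' f g := by
    ext c w : 2
    have : (f * g : FunAlg G) (c : G) = ((f : G → ℂ) c * (g : G → ℂ) c : ℂ) := rfl
    simp [this, mul_smul, smul_comm ((f : G → ℂ) c)]
  map_zero' := by
    ext c w : 2
    have : (0 : FunAlg G) (c : G) = (0 : ℂ) := rfl
    simp [this]
  map_add' f g := by
    ext c w : 2
    have : (f + g : FunAlg G) (c : G) = ((f : G → ℂ) c + (g : G → ℂ) c : ℂ) := rfl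
    simp [this, add_smul]
  commutes' a := by
    ext c w : 2
    have : (algebraMap ℂ (FunAlg G) a) (c : G) = (a : ℂ) := rfl
    simp only [LinearMap.comp_apply, Finsupp.lsum_comp_lsingle, this, LinearMap.smul_apply,
      Module.algebraMap_end_apply]

variable {W : Type v} [AddCommGroup W] [Module ℂ W] (M : FunAlg G →ₐ[ℂ] Module.End ℂ W)
  (ρ : Representation ℂ G W)

/-- The map `D^∨(G) → End W`, `δ_g ⊗ h ↦ (w ↦ δ_g ▷ (h ▷ w))`. -/
def doubleRep : Dvee G →ₗ[ℂ] Module.End ℂ W :=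
  (TensorProduct.lift ((LinearMap.mul ℂ (Module.End ℂ W)).compl₁₂ M.toLinearMap
    ρ.asAlgebraHom.toLinearMap) : FunAlg G ⊗[ℂ] MonoidAlgebra ℂ G →ₗ[ℂ] Module.End ℂ W)

/-- The right action `T ◁ (δ_g ⊗ h) = δ_g ∘ T ∘ h` of `D^∨(G)` on `End W`. -/
def endAct : Dvee G →ₗ[ℂ] Module.End ℂ (Module.End ℂ W) :=
  (TensorProduct.lift ((LinearMap.mul ℂ (Module.End ℂ (Module.End ℂ W))).compl₁₂
    (LinearMap.mul ℂ (Module.End ℂ W) ∘ₗ M.toLinearMap)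
    ((LinearMap.mul ℂ (Module.End ℂ W)).flip ∘ₗ ρ.asAlgebraHom.toLinearMap)) :
      FunAlg G ⊗[ℂ] MonoidAlgebra ℂ G →ₗ[ℂ] Module.End ℂ (Module.End ℂ W))

theorem endAct_mk (f : FunAlg G) (a : MonoidAlgebra ℂ G) (T : Module.End ℂ W) :
    endAct M ρ (Dvee.mk f a) T = M f * (T * ρ.asAlgebraHom a) := rfl

theorem doubleRep_mk (f : FunAlg G) (a : MonoidAlgebra ℂ G) :
    doubleRep M ρ (Dvee.mk f a) = M f * ρ.asAlgebraHom a := rfl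

theorem endAct_mul (x y : Dvee G) (T : Module.End ℂ W) :
    endAct M ρ (x * y) T = endAct M ρ y (endAct M ρ x T) := by
  induction x using Dvee.induction with
  | add x x' hx hx' => simp only [add_mul, map_add, LinearMap.add_apply, hx, hx']
  | tmul f a =>
    induction y using Dvee.induction with
    | add y y' hy hy' => simp only [mul_add, map_add, LinearMap.add_apply, hy, hy']
    | tmul g b =>
      rw [Dvee.mk_mul_mk, endAct_mk, endAct_mk, endAct_mk, mul_comm f g, map_mul, map_mul]
      simp only [mul_assoc]

theorem endAct_one (T : Module.End ℂ W) : endAct M ρ 1 T = T := by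
  have : endAct M ρ 1 T = M 1 * (T * ρ.asAlgebraHom 1) := rfl
  rw [this, map_one, map_one, one_mul, mul_one]

theorem endAct_apply_one (x : Dvee G) : endAct M ρ x 1 = doubleRep M ρ x := by
  induction x using Dvee.induction with
  | add x y hx hy => simp only [map_add, LinearMap.add_apply, hx, hy]
  | tmul f a => rw [endAct_mk, doubleRep_mk, one_mul]

/-- `End W` with the right action `T ◁ (δ_g ⊗ h) = δ_g ∘ T ∘ h` and the map sending an element of
`D^∨(G)⁺` to its action on `W`. -/
def doubleDatum [Fintype G] [DecidableEq G] : MaurerCartanDatum ℂ (Dvee G) where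
  Lam := Module.End ℂ W
  act := AlgHom.ofLinearMap (endAct M ρ ∘ₗ (MulOpposite.opLinearEquiv ℂ).symm.toLinearMap)
    (LinearMap.ext fun T => endAct_one M ρ T)
    (fun x y => LinearMap.ext fun T => endAct_mul M ρ y.unop x.unop T)
  varpi := doubleRep M ρ - (LinearMap.toSpanSingleton ℂ _ 1) ∘ₗ Coalgebra.counit
  varpi_mul := fun x y => by
    have h : doubleRep M ρ (x * y) = endAct M ρ y (doubleRep M ρ x) := by
      rw [← endAct_apply_one, endAct_mul, endAct_apply_one]
    change doubleRep M ρ (x * y) - Coalgebra.counit (R := ℂ) (x * y) • (1 : Module.End ℂ W) =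
      Coalgebra.counit (R := ℂ) x •
          (doubleRep M ρ y - Coalgebra.counit (R := ℂ) y • (1 : Module.End ℂ W)) +
        endAct M ρ y (doubleRep M ρ x - Coalgebra.counit (R := ℂ) x • (1 : Module.End ℂ W))
    rw [h, map_sub, map_smul, endAct_apply_one, Bialgebra.counit_mul, smul_sub, mul_smul]
    abel

/-- The calculus `Ω¹_{C,π} = D^∨(G) ⊗ End(V_{C,π})` on `D^∨(G)`, where `C` is the conjugacy class
of `r` and `π` a representation of the centraliser of `r`. With `p_c` the projection of `V_{C,π}`
to `c ⊗ V`, it has `T δ_g = ∑_c δ_{gc⁻¹} ⊗ p_c T`, `T h = ∑_c chc⁻¹ ⊗ p_c T h` for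
`T ∈ End(V_{C,π})`, and `d δ_g = ∑_c (δ_{gc⁻¹} - δ_g) ⊗ p_c`, `d h = ∑_c chc⁻¹ ⊗ p_c h - h ⊗ 1`. -/
def doubleCalculus [Fintype G] [DecidableEq G] (q : conjugatesOf r → G)
    (hq : ∀ c, q c * r * (q c)⁻¹ = c)
    (π : Representation ℂ (Subgroup.centralizer ({r} : Set G)) V) : PreCalculus ℂ (Dvee G) :=
  (doubleDatum (gradeAct r V) (inducedRep q hq π)).calculus

end DoubleCalculi

end

/-! For a calculus of the form `H ⊗ Λ`, each claim reduces to a claim about the linear map `varpi`.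
The Maurer–Cartan form is `1 ⊗ varpi`, so surjectivity of `varpi` gives a calculus. Left covariance
is automatic from coassociativity. Right covariance follows from a map `R : Λ → Λ ⊗ H` with `b₁ ·
R(ϖ b₂) = ϖ b₁ ⊗ b₂` (`extends_coactFst`).

On `D^∨(G)` the map `varpi` is the action on `V_{C,π}` minus the counit times the identity. The
action maps onto all endomorphisms: Burnside's theorem gives `End V_π`, and the elements `q_{c'} z
q_c⁻¹` move it between the blocks of the grading. Subtracting the counit does not spoil
surjectivity, because some element of counit `1` acts by zero: `δ_e ⊗ 1` if `e ∉ C`, and `δ_e` times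
the average of `G` if `π` is non-trivial. This is where `(C, π) ≠ ({e}, 1)` enters. The map `R` is
`endCoact`; the computation uses only that `V_{C,π}` is a crossed module (`IsCrossed`).

The bundle rests on the elements `iota g = ∑_f δ_f ⊗ f⁻¹gf`. They multiply like `G`, span the base,
and satisfy `δ_f ⊗ k = iota (fkf⁻¹) · (δ_f ⊗ 1)`, which yields the inverse of the Galois map. The
map `ver` is `id ⊗ θ`, where `θ` is induced by `p` and has kernel `ϖ(ker p)`. As `ker p` is spanned
by the `δ_g ⊗ h - δ_g ⊗ 1`, exactness comes down to writing the corresponding forms as `x (d iota k)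
y`, which `doubleForm_ker_eq` does.

For the base, `twist T = ∑_f δ_f f⁻¹ T f` carries `ρ(g) - 1` to `ϖ(iota g)` and is injective on a
crossed module. It therefore embeds `Ω¹_ρ` in the calculus on `D^∨(G)`, with image `A dA`.

For the fibre, `p(I)` consists of those `p x` in `H⁺` for which `x` acts by zero. If `π` is trivial,
an invariant vector supported on all of `C` forces `p x` to vanish on `C`, and every such function
occurs. If `π` is non-trivial there are no invariant vectors, so `f ⊗ average` acts by zero for
every `f` and `p(I) = H⁺`. The fibre calculus is thus that of `C` or of `∅`, and inherits
bicovariance from it. -/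

namespace PreCalculus

/-! ### Generation by the forms `a d b`, and extension of maps prescribed on them. -/

section Algebra

variable {k A : Type*} [CommRing k] [Ring A] [Algebra k A]

@[simp] theorem adb_tmul (Ω : PreCalculus k A) (a b : A) : Ω.adb (a ⊗ₜ b) = a • Ω.d b := rfl

theorem smul_smul_form (Ω : PreCalculus k A) (c : k) (a : A) (ω : Ω.Form) :
    a • c • ω = c • a • ω := by
  rw [← algebraMap_smul A c ω, ← mul_smul, ← Algebra.commutes, mul_smul, algebraMap_smul]

/-- Left multiplication on forms as a linear map into the endomorphisms. -/
noncomputable def leftMul (Ω : PreCalculus k A) : A →ₗ[k] Module.End k Ω.Form :=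
  LinearMap.mk₂ k (fun a ω => a • ω) (fun _ _ _ => add_smul _ _ _) (fun _ _ _ => smul_assoc _ _ _)
    (fun _ _ _ => smul_add _ _ _) (fun c a ω => Ω.smul_smul_form c a ω)

@[simp] theorem leftMul_apply (Ω : PreCalculus k A) (a : A) (ω : Ω.Form) :
    Ω.leftMul a ω = a • ω := rfl

theorem isCalculus_iff (Ω : PreCalculus k A) : Ω.IsCalculus ↔ Function.Surjective Ω.adb := by
  have : Submodule.span k {ω : Ω.Form | ∃ a b : A, ω = a • Ω.d b} = LinearMap.range Ω.adb := by
    apply le_antisymm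
    · rw [Submodule.span_le]
      rintro _ ⟨a, b, rfl⟩
      exact ⟨a ⊗ₜ b, rfl⟩
    · rintro _ ⟨X, rfl⟩
      induction X with
      | zero => simp
      | add X Y hX hY => rw [map_add]; exact add_mem hX hY
      | tmul a b => exact Submodule.subset_span ⟨a, b, rfl⟩
  rw [IsCalculus, this, LinearMap.range_eq_top]

theorem smul_adb (Ω : PreCalculus k A) (a : A) (X : A ⊗[k] A) :
    a • Ω.adb X = Ω.adb ((LinearMap.mulLeft k a).rTensor A X) := by
  induction X with
  | zero => simp
  | add X Y hX hY => simp only [map_add, smul_add, hX, hY]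
  | tmul x y => simp [mul_smul]

theorem Extends.comp {M N : Type*} [AddCommGroup M] [Module k M] [AddCommGroup N] [Module k N]
    {Ω : PreCalculus k A} {F : A ⊗[k] A →ₗ[k] M} (h : Ω.Extends F) (f : M →ₗ[k] N) :
    Ω.Extends (f ∘ₗ F) := by
  obtain ⟨L, hL⟩ := h
  exact ⟨f ∘ₗ L, fun a b => by simp [hL]⟩

section Coaction

variable {B C : Type*} [Ring B] [Algebra k B] [Ring C] [Algebra k C]

/-- `(b ⊗ c) · (x ⊗ ω) = b x ⊗ c ω`. -/
noncomputable def sndAct (Ω : PreCalculus k C) : B ⊗[k] C →ₗ[k] Module.End k (B ⊗[k] Ω.Form) :=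
  TensorProduct.homTensorHomMap (RingHom.id k) B Ω.Form B Ω.Form ∘ₗ
    TensorProduct.map (LinearMap.mul k B) Ω.leftMul

@[simp] theorem sndAct_tmul (Ω : PreCalculus k C) (b x : B) (c : C) (ω : Ω.Form) :
    Ω.sndAct (b ⊗ₜ c) (x ⊗ₜ ω) = (b * x) ⊗ₜ (c • ω) := rfl

/-- `(b ⊗ c) · (ω ⊗ x) = b ω ⊗ c x`. -/
noncomputable def fstAct (Ω : PreCalculus k B) : B ⊗[k] C →ₗ[k] Module.End k (Ω.Form ⊗[k] C) :=
  TensorProduct.homTensorHomMap (RingHom.id k) Ω.Form C Ω.Form C ∘ₗ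
    TensorProduct.map Ω.leftMul (LinearMap.mul k C)

@[simp] theorem fstAct_tmul (Ω : PreCalculus k B) (b : B) (c x : C) (ω : Ω.Form) :
    Ω.fstAct (b ⊗ₜ c) (ω ⊗ₜ x) = (b • ω) ⊗ₜ (c * x) := rfl

theorem coactSnd_tmul (Ω : PreCalculus k C) (lam : A →ₐ[k] B ⊗[k] C) (a b : A) :
    Ω.coactSnd lam (a ⊗ₜ b) = Ω.sndAct (lam a) (Ω.d.lTensor B (lam b)) := by
  simp only [coactSnd, LinearMap.comp_apply, TensorProduct.map_tmul, AlgHom.toLinearMap_apply,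
    LinearEquiv.coe_coe]
  generalize lam a = X
  generalize lam b = Y
  induction X with
  | zero => simp
  | add X X' hX hX' => simp only [TensorProduct.add_tmul, map_add, hX, hX', LinearMap.add_apply]
  | tmul x y =>
    induction Y with
    | zero => simp
    | add X X' hX hX' => simp only [TensorProduct.tmul_add, map_add, hX, hX']
    | tmul x' y' => simp

theorem coactFst_tmul (Ω : PreCalculus k B) (lam : A →ₐ[k] B ⊗[k] C) (a b : A) :
    Ω.coactFst lam (a ⊗ₜ b) = Ω.fstAct (lam a) (Ω.d.rTensor C (lam b)) := by
  simp only [coactFst, LinearMap.comp_apply, TensorProduct.map_tmul, AlgHom.toLinearMap_apply,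
    LinearEquiv.coe_coe]
  generalize lam a = X
  generalize lam b = Y
  induction X with
  | zero => simp
  | add X X' hX hX' => simp only [TensorProduct.add_tmul, map_add, hX, hX', LinearMap.add_apply]
  | tmul x y =>
    induction Y with
    | zero => simp
    | add X X' hX hX' => simp only [TensorProduct.tmul_add, map_add, hX, hX']
    | tmul x' y' => simp

theorem coactFst_map (Ω : PreCalculus k B) (lam : A →ₐ[k] B ⊗[k] C) {C' : Type*} [Ring C']
    [Algebra k C'] (f : C →ₐ[k] C') :
    Ω.coactFst ((Algebra.TensorProduct.map (AlgHom.id k B) f).comp lam) =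
      f.toLinearMap.lTensor Ω.Form ∘ₗ Ω.coactFst lam := by
  ext a b
  simp only [TensorProduct.AlgebraTensorModule.curry_apply, LinearMap.restrictScalars_self,
    TensorProduct.curry_apply, LinearMap.comp_apply, coactFst_tmul, AlgHom.comp_apply]
  generalize lam a = X
  generalize lam b = Y
  induction X with
  | zero => simp
  | add X X' hX hX' => simp only [map_add, hX, hX', LinearMap.add_apply]
  | tmul x y =>
    induction Y with
    | zero => simp
    | add X X' hX hX' => simp only [map_add, hX, hX']
    | tmul x' y' => simp

end Coaction

end Algebra

section Field

variable {k A : Type*} [Field k] [Ring A] [Algebra k A]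

/-- Over a field `j` has a linear left inverse. This lets a coaction be constructed in a larger
space and then brought back. -/
theorem Extends.of_comp_injective {M N : Type*} [AddCommGroup M] [Module k M] [AddCommGroup N]
    [Module k N] {Ω : PreCalculus k A} {F : A ⊗[k] A →ₗ[k] M} {j : M →ₗ[k] N}
    (hj : Function.Injective j) (h : Ω.Extends (j ∘ₗ F)) : Ω.Extends F := by
  obtain ⟨g, hg⟩ := LinearMap.exists_leftInverse_of_injective j (LinearMap.ker_eq_bot.2 hj)
  have := h.comp g
  rwa [← LinearMap.comp_assoc, hg, LinearMap.id_comp] at this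

end Field

/-! ### Restriction of a calculus to a subalgebra, and its coactions. -/

section Restrict

variable {k A : Type*} [CommRing k] [Ring A] [Algebra k A]

/-- The inclusion of the restricted calculus. -/
noncomputable def restrictIncl (Ω : PreCalculus k A) (B : Subalgebra k A) :
    (Ω.restrict B).Form →ₗ[k] Ω.Form :=
  ((Ω.restrictForms B).subtype.restrictScalars k : Ω.restrictForms B →ₗ[k] Ω.Form)

theorem restrictIncl_injective (Ω : PreCalculus k A) (B : Subalgebra k A) :
    Function.Injective (Ω.restrictIncl B) := Subtype.val_injective

@[simp] theorem restrictIncl_smul (Ω : PreCalculus k A) (B : Subalgebra k A) (b : B)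
    (ω : (Ω.restrict B).Form) : Ω.restrictIncl B (b • ω) = (b : A) • Ω.restrictIncl B ω := rfl

@[simp] theorem restrictIncl_d (Ω : PreCalculus k A) (B : Subalgebra k A) (b : B) :
    Ω.restrictIncl B ((Ω.restrict B).d b) = Ω.d (b : A) := rfl

/-- `restrictForms` is a span over `B`, whereas generation concerns the span over `k` of the `a d
b`; `smul_adb` absorbs the coefficients from `B`. -/
theorem restrict_isCalculus (Ω : PreCalculus k A) (B : Subalgebra k A) :
    (Ω.restrict B).IsCalculus := by
  rw [isCalculus_iff]
  have key : ∀ ω ∈ Ω.restrictForms B, ∃ X, Ω.restrictIncl B ((Ω.restrict B).adb X) = ω := by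
    intro ω hω
    unfold restrictForms at hω
    induction hω using Submodule.span_induction with
    | mem x hx => obtain ⟨b, rfl⟩ := hx; exact ⟨1 ⊗ₜ b, by simp⟩
    | zero => exact ⟨0, by simp⟩
    | add x y _ _ hx hy =>
      obtain ⟨X, rfl⟩ := hx
      obtain ⟨Y, rfl⟩ := hy
      exact ⟨X + Y, by simp only [map_add]⟩
    | smul a x _ hx =>
      obtain ⟨X, rfl⟩ := hx
      exact ⟨(LinearMap.mulLeft k a).rTensor B X, by rw [← smul_adb]; rfl⟩
  intro ω
  obtain ⟨X, hX⟩ := key (Ω.restrictIncl B ω) (show (_ : Ω.restrictForms B).1 ∈ _ from Subtype.prop _)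
  exact ⟨X, Ω.restrictIncl_injective B hX⟩

theorem Extends.restrict {M : Type*} [AddCommGroup M] [Module k M] {Ω : PreCalculus k A}
    {F : A ⊗[k] A →ₗ[k] M} (h : Ω.Extends F) (B : Subalgebra k A) :
    (Ω.restrict B).Extends (F ∘ₗ TensorProduct.map B.val.toLinearMap B.val.toLinearMap) := by
  obtain ⟨L, hL⟩ := h
  exact ⟨L ∘ₗ Ω.restrictIncl B, fun a b => by simp [hL]⟩

end Restrict

section Coideal

variable {k P : Type*} [Field k] [Ring P] [HopfAlgebra k P]

/-- After the embedding `Ω ⊗ B → Ω ⊗ P`, injective by flatness, this is the right coaction of `Ω`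
restricted to `B (d B)`. -/
theorem restrict_extends_coactFst (Ω : PreCalculus k P) (B : Subalgebra k P)
    (lam : B →ₐ[k] P ⊗[k] B)
    (hlam : ∀ b : B, Algebra.TensorProduct.map (AlgHom.id k P) B.val (lam b) =
      Bialgebra.comulAlgHom k P (b : P)) (h : Ω.IsBicovariant) :
    (Ω.restrict B).Extends (Ω.coactFst lam) := by
  refine Extends.of_comp_injective (j := B.val.toLinearMap.lTensor Ω.Form)
    (Module.Flat.lTensor_preserves_injective_linearMap _ Subtype.val_injective) ?_
  rw [← coactFst_map]
  convert h.2.restrict B using 1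
  ext a b
  simp only [TensorProduct.AlgebraTensorModule.curry_apply, LinearMap.restrictScalars_self,
    TensorProduct.curry_apply, LinearMap.comp_apply, coactFst_tmul, TensorProduct.map_tmul,
    AlgHom.comp_apply, hlam]
  rfl

/-- Here the embedding acts on the forms, `P ⊗ B (d B) → P ⊗ Ω`, and the left coaction of `Ω` is the
one restricted. -/
theorem restrict_extends_coactSnd (Ω : PreCalculus k P) (B : Subalgebra k P)
    (lam : B →ₐ[k] P ⊗[k] B)
    (hlam : ∀ b : B, Algebra.TensorProduct.map (AlgHom.id k P) B.val (lam b) =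
      Bialgebra.comulAlgHom k P (b : P)) (h : Ω.IsBicovariant) :
    (Ω.restrict B).Extends ((Ω.restrict B).coactSnd lam) := by
  refine Extends.of_comp_injective (j := (Ω.restrictIncl B).lTensor P)
    (Module.Flat.lTensor_preserves_injective_linearMap _ (Ω.restrictIncl_injective B)) ?_
  convert h.1.restrict B using 1
  ext a b
  simp only [TensorProduct.AlgebraTensorModule.curry_apply, LinearMap.restrictScalars_self,
    TensorProduct.curry_apply, LinearMap.comp_apply, coactSnd_tmul, TensorProduct.map_tmul,
    AlgHom.toLinearMap_apply, Subalgebra.coe_val]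
  rw [← hlam, ← hlam]
  generalize lam a = X
  generalize lam b = Y
  induction X with
  | zero => simp
  | add X X' hX hX' => simp only [map_add, hX, hX', LinearMap.add_apply]
  | tmul x y =>
    induction Y with
    | zero => simp
    | add X X' hX hX' => simp only [map_add, hX, hX']
    | tmul x' y' => simp

end Coideal

end PreCalculus

/-! ### The calculus `H ⊗ Λ`: coactions and Maurer–Cartan form. -/

namespace MaurerCartanDatum

section Bialgebra

variable {k H : Type*} [CommRing k] [Ring H] [Bialgebra k H]

/-- The forms of `D.calculus` are `H ⊗ Lam`. -/
noncomputable def formEquiv (D : MaurerCartanDatum k H) : D.calculus.Form ≃ₗ[k] H ⊗[k] D.Lam :=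
  LinearEquiv.refl k (H ⊗[k] D.Lam)

theorem formEquiv_smul (D : MaurerCartanDatum k H) (a : H) (ω : D.calculus.Form) :
    D.formEquiv (a • ω) = a • D.formEquiv ω := rfl

theorem formEquiv_d (D : MaurerCartanDatum k H) (a : H) :
    D.formEquiv (D.calculus.d a) = D.varpi.lTensor H (Coalgebra.comul a) := rfl

/-- `h ⊗ v` as a form. -/
noncomputable def form (D : MaurerCartanDatum k H) : H ⊗[k] D.Lam →ₗ[k] D.calculus.Form :=
  D.formEquiv.symm.toLinearMap

@[simp] theorem formEquiv_form (D : MaurerCartanDatum k H) (ω : H ⊗[k] D.Lam) :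
    D.formEquiv (D.form ω) = ω := rfl

@[simp] theorem form_formEquiv (D : MaurerCartanDatum k H) (ω : D.calculus.Form) :
    D.form (D.formEquiv ω) = ω := rfl

theorem smul_form (D : MaurerCartanDatum k H) (a : H) (ω : H ⊗[k] D.Lam) :
    a • D.form ω = D.form (a • ω) := rfl

theorem calculus_d (D : MaurerCartanDatum k H) (a : H) :
    D.calculus.d a = D.form (D.varpi.lTensor H (Coalgebra.comul a)) := rfl

theorem form_induction (D : MaurerCartanDatum k H) {motive : D.calculus.Form → Prop}
    (tmul : ∀ h v, motive (D.form (h ⊗ₜ v)))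
    (add : ∀ x y, motive x → motive y → motive (x + y)) (ω : D.calculus.Form) : motive ω :=
  TensorProduct.induction_on (motive := motive) (D.formEquiv ω)
    (by have := tmul 0 0; rw [TensorProduct.zero_tmul, map_zero] at this; exact this) tmul add

/-- The coaction is `L = Δ ⊗ id`, for which `Λ` is coinvariant. It respects left multiplication
because `Δ` is multiplicative, and `L (d b) = b₁ ⊗ d b₂` is coassociativity. -/
theorem extends_coactSnd (D : MaurerCartanDatum k H) :
    D.calculus.Extends (D.calculus.coactSnd (Bialgebra.comulAlgHom k H)) := by
  let L : H ⊗[k] D.Lam →ₗ[k] H ⊗[k] D.calculus.Form :=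
    D.form.lTensor H ∘ₗ (TensorProduct.assoc k H H D.Lam).toLinearMap ∘ₗ
      (Coalgebra.comul : H →ₗ[k] H ⊗[k] H).rTensor D.Lam
  have h1 : ∀ (a : H) (ω : H ⊗[k] D.Lam),
      L (a • ω) = D.calculus.sndAct (Coalgebra.comul a : H ⊗[k] H) (L ω) := by
    intro a ω
    induction ω with
    | zero => simp
    | add x y hx hy => simp only [smul_add, map_add, hx, hy]
    | tmul h v =>
      simp only [L, TensorProduct.smul_tmul', LinearMap.comp_apply, LinearMap.rTensor_tmul,
        smul_eq_mul, Bialgebra.comul_mul, LinearEquiv.coe_coe]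
      generalize (Coalgebra.comul a : H ⊗[k] H) = X
      generalize (Coalgebra.comul h : H ⊗[k] H) = Y
      induction X with
      | zero => simp
      | add X X' hX hX' =>
        simp only [add_mul, TensorProduct.add_tmul, map_add, hX, hX', LinearMap.add_apply]
      | tmul x y =>
        induction Y with
        | zero => simp
        | add X X' hX hX' => simp only [mul_add, TensorProduct.add_tmul, map_add, hX, hX']
        | tmul x' y' => simp [smul_form, TensorProduct.smul_tmul']
  have h2 : ∀ b : H, L (D.varpi.lTensor H (Coalgebra.comul b)) =
      D.calculus.d.lTensor H (Coalgebra.comul b) := by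
    intro b
    have e1 : D.calculus.d = D.form ∘ₗ D.varpi.lTensor H ∘ₗ Coalgebra.comul := rfl
    simp only [e1, L, LinearMap.lTensor_comp, LinearMap.comp_apply]
    rw [← Coalgebra.coassoc_apply]
    congr 1
    generalize (Coalgebra.comul b : H ⊗[k] H) = X
    induction X with
    | zero => simp
    | add X X' hX hX' => simp only [map_add, hX, hX']
    | tmul x y =>
      simp only [LinearMap.lTensor_tmul, LinearMap.rTensor_tmul, LinearEquiv.coe_coe]
      generalize (Coalgebra.comul x : H ⊗[k] H) = Y
      induction Y with
      | zero => simp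
      | add X X' hX hX' => simp only [TensorProduct.add_tmul, map_add, hX, hX']
      | tmul x' y' => simp
  refine ⟨L ∘ₗ D.formEquiv.toLinearMap, fun a b => ?_⟩
  rw [PreCalculus.coactSnd_tmul]
  simp only [LinearMap.comp_apply, LinearEquiv.coe_coe, formEquiv_smul, formEquiv_d, h1, h2,
    Bialgebra.comulAlgHom_apply]

/-- `b · (v ⊗ h) = v ⊗ b h` on `Lam ⊗ H`. -/
noncomputable def coactMul (D : MaurerCartanDatum k H) :
    H ⊗[k] (D.Lam ⊗[k] H) →ₗ[k] D.Lam ⊗[k] H :=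
  (LinearMap.mul' k H).lTensor D.Lam ∘ₗ (TensorProduct.leftComm k H D.Lam H).toLinearMap

@[simp] theorem coactMul_tmul (D : MaurerCartanDatum k H) (a h : H) (v : D.Lam) :
    D.coactMul (a ⊗ₜ (v ⊗ₜ h)) = v ⊗ₜ (a * h) := by simp [coactMul]

/-- The right coaction extends to `H ⊗ Lam` as soon as `Lam` has a map `R` to `Lam ⊗ H` with
`b₁ · R (ϖ b₂) = ϖ b₁ ⊗ b₂`, as for the coaction `ϖ b ↦ ϖ b₂ ⊗ S(b₁) b₃`. -/
theorem extends_coactFst (D : MaurerCartanDatum k H) (R : D.Lam →ₗ[k] D.Lam ⊗[k] H)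
    (hR : ∀ b : H, D.coactMul ((R ∘ₗ D.varpi).lTensor H (Coalgebra.comul b)) =
      D.varpi.rTensor H (Coalgebra.comul b)) :
    D.calculus.Extends (D.calculus.coactFst (Bialgebra.comulAlgHom k H)) := by
  -- The coaction is `L (h ⊗ v) = h₁ ⊗ (h₂ · R v)`, rebracketed so that the first two legs form a
  -- form.
  let N : H ⊗[k] (H ⊗[k] (D.Lam ⊗[k] H)) →ₗ[k] D.calculus.Form ⊗[k] H :=
    D.form.rTensor H ∘ₗ (TensorProduct.assoc k H D.Lam H).symm.toLinearMap ∘ₗ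
      D.coactMul.lTensor H
  let L : H ⊗[k] D.Lam →ₗ[k] D.calculus.Form ⊗[k] H :=
    N ∘ₗ (TensorProduct.assoc k H H (D.Lam ⊗[k] H)).toLinearMap ∘ₗ
      TensorProduct.map Coalgebra.comul R
  have h1 : ∀ (a : H) (ω : H ⊗[k] D.Lam),
      L (a • ω) = D.calculus.fstAct (Coalgebra.comul a : H ⊗[k] H) (L ω) := by
    intro a ω
    induction ω with
    | zero => simp
    | add x y hx hy => simp only [smul_add, map_add, hx, hy]
    | tmul h v =>
      simp only [L, TensorProduct.smul_tmul', LinearMap.comp_apply, TensorProduct.map_tmul,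
        smul_eq_mul, Bialgebra.comul_mul, LinearEquiv.coe_coe]
      generalize (Coalgebra.comul a : H ⊗[k] H) = X
      generalize (Coalgebra.comul h : H ⊗[k] H) = Y
      generalize R v = Z
      induction X with
      | zero => simp
      | add X X' hX hX' =>
        simp only [add_mul, TensorProduct.add_tmul, map_add, hX, hX', LinearMap.add_apply]
      | tmul x y =>
        induction Y with
        | zero => simp
        | add X X' hX hX' => simp only [mul_add, TensorProduct.add_tmul, map_add, hX, hX']
        | tmul x' y' =>
          induction Z with
          | zero => simp
          | add X X' hX hX' => simp only [TensorProduct.tmul_add, map_add, hX, hX']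
          | tmul v z => simp [N, smul_form, TensorProduct.smul_tmul', mul_assoc]
  have h2 : ∀ b : H, L (D.varpi.lTensor H (Coalgebra.comul b)) =
      D.calculus.d.rTensor H (Coalgebra.comul b) := by
    intro b
    have e1 : D.calculus.d = D.form ∘ₗ D.varpi.lTensor H ∘ₗ Coalgebra.comul := rfl
    -- This exposes a `Δ ⊗ id`. Coassociativity turns it into `id ⊗ Δ`, so that the hypothesis on
    -- `R` applies to the last two legs; a second use of coassociativity recovers `d`.
    have e2 : ∀ X : H ⊗[k] H, L (D.varpi.lTensor H X) =
        N (((R ∘ₗ D.varpi).lTensor H).lTensor H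
          (TensorProduct.assoc k H H H ((Coalgebra.comul : H →ₗ[k] H ⊗[k] H).rTensor H X))) := by
      intro X
      induction X with
      | zero => simp
      | add X X' hX hX' => simp only [map_add, hX, hX']
      | tmul x y =>
        simp only [L, LinearMap.lTensor_tmul, LinearMap.rTensor_tmul, LinearMap.comp_apply,
          TensorProduct.map_tmul, LinearEquiv.coe_coe]
        generalize (Coalgebra.comul x : H ⊗[k] H) = Y
        induction Y with
        | zero => simp
        | add X X' hX hX' => simp only [TensorProduct.add_tmul, map_add, hX, hX']
        | tmul x' y' => simp
    have e3 : D.coactMul ∘ₗ (R ∘ₗ D.varpi).lTensor H ∘ₗ Coalgebra.comul =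
        D.varpi.rTensor H ∘ₗ Coalgebra.comul := LinearMap.ext hR
    rw [e2, Coalgebra.coassoc_apply]
    simp only [N, LinearMap.comp_apply]
    rw [← LinearMap.comp_apply (LinearMap.lTensor H _) (LinearMap.lTensor H _),
      ← LinearMap.comp_apply (_ ∘ₗ _) (LinearMap.lTensor H _), ← LinearMap.lTensor_comp,
      ← LinearMap.lTensor_comp, LinearMap.comp_assoc, e3, LinearMap.lTensor_comp,
      LinearMap.comp_apply, ← Coalgebra.coassoc_apply, e1]
    generalize (Coalgebra.comul b : H ⊗[k] H) = X
    induction X with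
    | zero => simp
    | add X X' hX hX' => simp only [map_add, hX, hX']
    | tmul x y =>
      simp only [LinearMap.rTensor_tmul, LinearMap.comp_apply]
      generalize (Coalgebra.comul x : H ⊗[k] H) = Y
      induction Y with
      | zero => simp
      | add X X' hX hX' => simp only [TensorProduct.add_tmul, map_add, hX, hX']
      | tmul x' y' => simp
  refine ⟨L ∘ₗ D.formEquiv.toLinearMap, fun a b => ?_⟩
  rw [PreCalculus.coactFst_tmul]
  simp only [LinearMap.comp_apply, LinearEquiv.coe_coe, formEquiv_smul, formEquiv_d, h1, h2,
    Bialgebra.comulAlgHom_apply]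

end Bialgebra

section Hopf

variable {k H : Type*} [CommRing k] [Ring H] [HopfAlgebra k H]

/-- By coassociativity `S(h₁) d h₂ = S(h₁) h₂ ⊗ ϖ h₃`, and the antipode axiom collapses the first
leg. -/
theorem maurerCartan_calculus (D : MaurerCartanDatum k H) (h : H) :
    D.calculus.maurerCartan h = D.form (1 ⊗ₜ D.varpi h) := by
  have e1 : ∀ X : H ⊗[k] H, D.calculus.adb ((HopfAlgebra.antipode k).rTensor H X) =
      D.form (D.varpi.lTensor H ((LinearMap.mul' k H ∘ₗ (HopfAlgebra.antipode k).rTensor H).rTensor H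
        ((TensorProduct.assoc k H H H).symm
          ((Coalgebra.comul : H →ₗ[k] H ⊗[k] H).lTensor H X)))) := by
    intro X
    induction X with
    | zero => simp
    | add X X' hX hX' => simp only [map_add, hX, hX']
    | tmul x y =>
      simp only [LinearMap.rTensor_tmul, LinearMap.lTensor_tmul, PreCalculus.adb_tmul, calculus_d,
        smul_form]
      congr 1
      generalize (Coalgebra.comul y : H ⊗[k] H) = Y
      induction Y with
      | zero => simp
      | add X X' hX hX' => simp only [TensorProduct.tmul_add, map_add, smul_add, hX, hX']
      | tmul x' y' => simp [TensorProduct.smul_tmul']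
  rw [PreCalculus.maurerCartan, LinearMap.comp_apply, LinearMap.comp_apply, e1,
    Coalgebra.coassoc_symm_apply, ← LinearMap.comp_apply (LinearMap.rTensor H _),
    ← LinearMap.rTensor_comp, LinearMap.comp_assoc, HopfAlgebra.mul_antipode_rTensor_comul,
    LinearMap.rTensor_comp, LinearMap.comp_apply, Coalgebra.rTensor_counit_comul]
  simp

/-- The form `h ⊗ ϖ y` equals `h S(y₁) d y₂`, so surjectivity of `varpi` reaches every elementary
tensor. -/
theorem isCalculus (D : MaurerCartanDatum k H) (hD : Function.Surjective D.varpi) :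
    D.calculus.IsCalculus := by
  rw [PreCalculus.isCalculus_iff]
  intro ω
  induction ω using D.form_induction with
  | tmul h v =>
    obtain ⟨y, rfl⟩ := hD v
    have : D.form (h ⊗ₜ D.varpi y) = h • D.calculus.maurerCartan y := by
      rw [maurerCartan_calculus, smul_form, TensorProduct.smul_tmul', smul_eq_mul, mul_one]
    rw [this, PreCalculus.maurerCartan, LinearMap.comp_apply, PreCalculus.smul_adb]
    exact ⟨_, rfl⟩
  | add x y hx hy =>
    obtain ⟨X, rfl⟩ := hx
    obtain ⟨Y, rfl⟩ := hy
    exact ⟨X + Y, map_add _ _ _⟩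

theorem isBicovariant (D : MaurerCartanDatum k H) (R : D.Lam →ₗ[k] D.Lam ⊗[k] H)
    (hR : ∀ b : H, D.coactMul ((R ∘ₗ D.varpi).lTensor H (Coalgebra.comul b)) =
      D.varpi.rTensor H (Coalgebra.comul b)) : D.calculus.IsBicovariant :=
  ⟨D.extends_coactSnd, D.extends_coactFst R hR⟩

end Hopf

end MaurerCartanDatum

/-! ### Isomorphisms of calculi. -/

namespace PreCalculus

section Iso

variable {k A : Type*} [CommRing k] [Ring A] [Algebra k A]

/-- A linear bijection with `a d b ↦ e(a) d e(b)` is an isomorphism of calculi. -/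
def Iso.ofIsCalculus {B : Type*} [Ring B] [Algebra k B] (e : A ≃ₐ[k] B) {Ω : PreCalculus k A}
    {Ω' : PreCalculus k B} (hΩ : Ω.IsCalculus) (Φ : Ω.Form ≃ₗ[k] Ω'.Form)
    (h : ∀ a b : A, Φ (a • Ω.d b) = e a • Ω'.d (e b)) : Iso e Ω Ω' :=
  have hl : ∀ (a : A) (ω : Ω.Form), Φ (a • ω) = e a • Φ ω := by
    intro a ω
    obtain ⟨X, rfl⟩ := Ω.isCalculus_iff.1 hΩ ω
    induction X with
    | zero => simp
    | add X Y hX hY => simp only [map_add, smul_add, hX, hY]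
    | tmul x y => rw [adb_tmul, ← mul_smul, h, h, map_mul, mul_smul]
  have hd : ∀ a : A, Φ (Ω.d a) = Ω'.d (e a) := fun a => by
    have := h 1 a
    rwa [one_smul, map_one, one_smul] at this
  { Φ with
    map_left := hl
    map_right := fun a ω => by
      change Φ (MulOpposite.op a • ω) = MulOpposite.op (e a) • Φ ω
      obtain ⟨X, rfl⟩ := Ω.isCalculus_iff.1 hΩ ω
      induction X with
      | zero => simp
      | add X Y hX hY => simp only [map_add, smul_add, hX, hY]
      | tmul x y =>
        -- By the Leibniz rule, `d` and left multiplication determine right multiplication on forms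
        -- `x d y`.
        have h1 : MulOpposite.op a • Ω.d y = Ω.d (y * a) - y • Ω.d a := by rw [Ω.leibniz]; abel
        have h2 : MulOpposite.op (e a) • Ω'.d (e y) = Ω'.d (e (y * a)) - e y • Ω'.d (e a) := by
          rw [map_mul, Ω'.leibniz]; abel
        rw [adb_tmul, ← smul_comm x (MulOpposite.op a), h1, hl, map_sub, h, hd, hl, hd,
          ← smul_comm (e x) (MulOpposite.op (e a)), h2]
    map_d := hd }

variable {Ω Ω' : PreCalculus k A} (I : Iso AlgEquiv.refl Ω Ω')

include I

theorem Iso.extends {M : Type*} [AddCommGroup M] [Module k M] {F : A ⊗[k] A →ₗ[k] M}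
    (h : Ω'.Extends F) : Ω.Extends F := by
  obtain ⟨L, hL⟩ := h
  refine ⟨L ∘ₗ I.toLinearMap, fun a b => ?_⟩
  rw [← hL]
  have h1 : I.toLinearMap (a • Ω.d b) = a • I.toLinearMap (Ω.d b) := I.map_left a _
  have h2 : I.toLinearMap (Ω.d b) = Ω'.d b := I.map_d b
  rw [LinearMap.comp_apply, h1, h2]

theorem Iso.comp_adb : I.toLinearMap ∘ₗ Ω.adb = Ω'.adb := by
  ext a b
  have h1 : I.toLinearMap (a • Ω.d b) = a • I.toLinearMap (Ω.d b) := I.map_left a _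
  have h2 : I.toLinearMap (Ω.d b) = Ω'.d b := I.map_d b
  exact h1.trans (congrArg (a • ·) h2)

end Iso

/-- This serves the fibre: its forms come from a quotient `H⁺ / p(I)`, and the right coaction is
taken from an isomorphic calculus with an explicit basis of invariant forms. -/
theorem Iso.isBicovariant {k H : Type*} [CommRing k] [Ring H] [HopfAlgebra k H]
    {Ω Ω' : PreCalculus k H} (I : Iso AlgEquiv.refl Ω Ω') (h : Ω'.IsBicovariant) :
    Ω.IsBicovariant := by
  have key : ∀ {M N : Type _} [AddCommGroup M] [Module k M] [AddCommGroup N] [Module k N]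
      (e : M ≃ₗ[k] N) (F : H ⊗[k] H →ₗ[k] M), Ω.Extends (e.toLinearMap ∘ₗ F) → Ω.Extends F := by
    intro M N _ _ _ _ e F hF
    have := hF.comp e.symm.toLinearMap
    rwa [← LinearMap.comp_assoc, LinearEquiv.comp_coe, LinearEquiv.self_trans_symm,
      LinearEquiv.refl_toLinearMap, LinearMap.id_comp] at this
  refine ⟨key (I.toLinearEquiv.lTensor H) _ ?_, key (I.toLinearEquiv.rTensor H) _ ?_⟩
  · convert I.extends h.1 using 1
    simp only [coactSnd, ← I.comp_adb, ← LinearMap.comp_assoc]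
    congr 2
    exact (LinearMap.lTensor_comp_map ..)
  · convert I.extends h.2 using 1
    simp only [coactFst, ← I.comp_adb, ← LinearMap.comp_assoc]
    congr 2
    exact (LinearMap.rTensor_comp_map ..)

end PreCalculus

/-! ### Kernel of the Maurer–Cartan form and calculi with `Λ¹ = H⁺ / J`. -/

namespace MaurerCartanDatum

section Basic

variable {k H : Type*} [CommRing k] [Ring H]

theorem varpi_one [Bialgebra k H] (D : MaurerCartanDatum k H) : D.varpi 1 = 0 := by
  have := D.varpi_mul 1 1
  rw [mul_one, Bialgebra.counit_one, one_smul, MulOpposite.op_one, map_one D.act, Module.End.one_apply]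
    at this
  exact left_eq_add.1 this

theorem varpi_algebraMap [Bialgebra k H] (D : MaurerCartanDatum k H) (c : k) :
    D.varpi (algebraMap k H c) = 0 := by
  rw [Algebra.algebraMap_eq_smul_one, map_smul, varpi_one, smul_zero]

theorem form_one_tmul_injective [Bialgebra k H] (D : MaurerCartanDatum k H) {v : D.Lam}
    (h : D.form (1 ⊗ₜ v) = 0) : v = 0 := by
  have h' : (1 : H) ⊗ₜ[k] v = 0 := h
  simpa using congrArg (TensorProduct.lid k D.Lam ∘ (Coalgebra.counit (R := k)).rTensor D.Lam) h'

theorem maurerCartan_eq_zero_iff [HopfAlgebra k H] (D : MaurerCartanDatum k H) (x : H) :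
    D.calculus.maurerCartan x = 0 ↔ D.varpi x = 0 := by
  rw [maurerCartan_calculus]
  exact ⟨D.form_one_tmul_injective, fun h => by simp [h]⟩

theorem mem_ideal_iff [HopfAlgebra k H] (D : MaurerCartanDatum k H) (x : H) :
    x ∈ D.calculus.ideal ↔ Coalgebra.counit (R := k) x = 0 ∧ D.varpi x = 0 := by
  rw [← maurerCartan_eq_zero_iff]
  rfl

theorem ofRightIdeal_varpi_eq_zero_iff [Bialgebra k H] (J : Submodule k H)
    (hJ : ∀ x ∈ J, ∀ y : H, x * y ∈ J) (x : H) :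
    (ofRightIdeal J hJ).varpi x = 0 ↔ x - algebraMap k H (Coalgebra.counit x) ∈ J := by
  change Submodule.Quotient.mk (augProj k H x) = 0 ↔ _
  rw [Submodule.Quotient.mk_eq_zero, Submodule.mem_comap, Submodule.subtype_apply, augProj_coe]

theorem augProj_surjective [Bialgebra k H] : Function.Surjective (augProj k H) := fun x =>
  ⟨x, Subtype.ext (by
    have : Coalgebra.counit (R := k) (x : H) = 0 := x.2
    rw [augProj_coe, this, map_zero, sub_zero])⟩

theorem ofRightIdeal_varpi_surjective [Bialgebra k H] (J : Submodule k H)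
    (hJ : ∀ x ∈ J, ∀ y : H, x * y ∈ J) : Function.Surjective (ofRightIdeal J hJ).varpi :=
  (Submodule.mkQ_surjective _).comp augProj_surjective

/-- An isomorphism `H⁺ / J ≅ D.Lam` of right modules over `H⁺` gives an isomorphism of calculi. -/
theorem nonempty_iso_ofRightIdeal [HopfAlgebra k H] (J : Submodule k H)
    (hJ : ∀ x ∈ J, ∀ y : H, x * y ∈ J) (D : MaurerCartanDatum k H)
    (hD : Function.Surjective D.varpi)
    (h : ∀ x : H, Coalgebra.counit (R := k) x = 0 → (x ∈ J ↔ D.varpi x = 0)) :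
    Nonempty (PreCalculus.Iso AlgEquiv.refl (ofRightIdeal J hJ).calculus D.calculus) := by
  let K : Submodule k (augIdeal k H) := J.comap (augIdeal k H).subtype
  let φ₀ : augIdeal k H →ₗ[k] D.Lam := D.varpi ∘ₗ (augIdeal k H).subtype
  have hφ₀ : LinearMap.ker φ₀ = K := by
    ext x
    exact (h x x.2).symm
  have hs : Function.Surjective φ₀ := by
    intro v
    obtain ⟨y, rfl⟩ := hD v
    refine ⟨augProj k H y, ?_⟩
    change D.varpi (augProj k H y : H) = _
    rw [augProj_coe, map_sub, varpi_algebraMap, sub_zero]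
  let φ : (ofRightIdeal J hJ).Lam ≃ₗ[k] D.Lam :=
    (Submodule.quotEquivOfEq _ _ hφ₀.symm).trans (φ₀.quotKerEquivOfSurjective hs)
  have hφ : ∀ x, φ ((ofRightIdeal J hJ).varpi x) = D.varpi x := by
    intro x
    change D.varpi (augProj k H x : H) = _
    rw [augProj_coe, map_sub, varpi_algebraMap, sub_zero]
  refine ⟨PreCalculus.Iso.ofIsCalculus _
    (isCalculus _ (ofRightIdeal_varpi_surjective J hJ))
    ((ofRightIdeal J hJ).formEquiv.trans ((LinearEquiv.lTensor H φ).trans D.formEquiv.symm)) ?_⟩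
  intro a b
  simp only [LinearEquiv.trans_apply, formEquiv_smul, formEquiv_d, AlgEquiv.coe_refl, id_eq]
  apply D.formEquiv.injective
  rw [LinearEquiv.apply_symm_apply, formEquiv_smul, formEquiv_d]
  generalize (Coalgebra.comul b : H ⊗[k] H) = X
  induction X with
  | zero => simp
  | add X Y hX hY => simp only [map_add, smul_add, hX, hY]
  | tmul x y =>
    simp only [LinearMap.lTensor_tmul, TensorProduct.smul_tmul', LinearEquiv.lTensor_tmul]
    rw [← hφ]

end Basic

end MaurerCartanDatum

/-! ### General facts on bundles: coaction on the base and the exact sequence. -/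

section Bundle

variable {k P H : Type*} [Field k] [Ring P] [HopfAlgebra k P] [Ring H] [HopfAlgebra k H]

theorem preGaloisMap_balanced (p : P →ₐc[k] H) (x y : P) (a : bundleBase p) :
    preGaloisMap p ((x * a) ⊗ₜ y) = preGaloisMap p (x ⊗ₜ (a * y)) := by
  have ha : bundleCoaction p (a : P) = (a : P) ⊗ₜ[k] (1 : H) := a.2
  simp only [preGaloisMap, LinearMap.comp_apply,
    TensorProduct.map_tmul, LinearMap.mul'_apply, AlgHom.toLinearMap_apply, map_mul, ha,
    Algebra.TensorProduct.includeLeft_apply, mul_assoc]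

theorem preVer_balanced (p : P →ₐc[k] H) (Ω : PreCalculus k H) (x y : P) (a : bundleBase p) :
    preVer p Ω ((x * a) ⊗ₜ y) = preVer p Ω (x ⊗ₜ (a * y)) :=
  congrArg (Ω.maurerCartan.rangeRestrict.lTensor P) (preGaloisMap_balanced p x y a)

/-- If `Δ A ⊆ P ⊗ A` then `Δ` restricts to a coaction on `A`. -/
theorem exists_restrict_comul (A : Subalgebra k P)
    (h : ∀ a ∈ A, Bialgebra.comulAlgHom k P a ∈
      (Algebra.TensorProduct.map (AlgHom.id k P) A.val).range) :
    ∃ lam : A →ₐ[k] P ⊗[k] A, ∀ a : A, Algebra.TensorProduct.map (AlgHom.id k P) A.val (lam a) =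
      Bialgebra.comulAlgHom k P (a : P) := by
  let φ := Algebra.TensorProduct.map (AlgHom.id k P) A.val
  have hφ : Function.Injective φ :=
    Module.Flat.lTensor_preserves_injective_linearMap (M := P) A.val.toLinearMap
      Subtype.val_injective
  let e := AlgEquiv.ofInjective φ hφ
  refine ⟨e.symm.toAlgHom.comp (((Bialgebra.comulAlgHom k P).comp A.val).codRestrict φ.range
    (fun a => h a a.2)), fun a => ?_⟩
  exact congrArg Subtype.val (e.apply_symm_apply _)

/-- An element `i` of `I` over `p y - ε(y)` and an element `z` of `ker p` with the same `varpi` as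
`y` determine each other by `i + z = y - ε(y)`. This identifies the kernel of the induced map `Λ¹_P
→ Λ¹_H` with `ϖ(ker p)`. -/
theorem fibreCalculus_varpi_eq_zero (p : P →ₐc[k] H) (hp : Function.Surjective p)
    (D : MaurerCartanDatum k P) (y : P) :
    (MaurerCartanDatum.ofRightIdeal (D.calculus.ideal.map (p : P →ₐ[k] H).toLinearMap)
      (mul_mem_map_ideal p hp D.calculus)).varpi (p y) = 0 ↔ ∃ z, p z = 0 ∧ D.varpi z = D.varpi y := by
  rw [MaurerCartanDatum.ofRightIdeal_varpi_eq_zero_iff]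
  have hc : Coalgebra.counit (R := k) (p y) = Coalgebra.counit y := by simp
  rw [hc]
  constructor
  · rintro ⟨i, hi, hpi⟩
    replace hpi : p i = p y - algebraMap k H (Coalgebra.counit y) := hpi
    obtain ⟨-, hi⟩ := (D.mem_ideal_iff i).1 hi
    refine ⟨y - algebraMap k P (Coalgebra.counit y) - i, ?_, ?_⟩
    · rw [map_sub, map_sub, hpi, AlgHomClass.commutes, sub_self]
    · rw [map_sub, map_sub, hi, D.varpi_algebraMap, sub_zero, sub_zero]
  · rintro ⟨z, hz, hzy⟩
    have hcz : Coalgebra.counit (R := k) z = 0 := by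
      have : Coalgebra.counit (R := k) (p z) = Coalgebra.counit z := by simp
      rw [← this, hz, map_zero]
    refine ⟨y - algebraMap k P (Coalgebra.counit y) - z, (D.mem_ideal_iff _).2 ⟨?_, ?_⟩, ?_⟩
    · rw [map_sub, map_sub, hcz]; simp
    · rw [map_sub, map_sub, hzy, D.varpi_algebraMap, sub_zero, sub_self]
    · change p _ = _
      rw [map_sub, map_sub, hz, AlgHomClass.commutes, sub_zero]

/-- Exactness of `0 → P Ω¹ P → Ω¹_P → P ⊗ Λ¹ → 0`, given that `P Ω¹ P` contains `P ⊗ ϖ(ker p)`. -/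
theorem exists_exact_ver (p : P →ₐc[k] H) (hp : Function.Surjective p)
    (D : MaurerCartanDatum k P) (hD : Function.Surjective D.varpi)
    (hgen : ∀ (x z : P), p z = 0 → D.form (x ⊗ₜ D.varpi z) ∈
      Submodule.span k {η | ∃ (x y : P) (α : (D.calculus.restrict (bundleBase p)).Form),
        η = x • MulOpposite.op y • D.calculus.restrictIncl (bundleBase p) α}) :
    ∃ (incl : (D.calculus.restrict (bundleBase p)).Form →ₗ[k] D.calculus.Form)
      (ver : D.calculus.Form →ₗ[P] P ⊗[k] (fibreCalculus p hp D.calculus).invariantForms),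
      (∀ a b : bundleBase p, incl (a • (D.calculus.restrict (bundleBase p)).d b) =
        (a : P) • D.calculus.d (b : P)) ∧
      (∀ x y : P, ver (x • D.calculus.d y) =
        preVer p (fibreCalculus p hp D.calculus) (x ⊗ₜ y)) ∧
      Function.Surjective ver ∧
      ∀ ω : D.calculus.Form, ver ω = 0 ↔ ω ∈ Submodule.span k
        {η | ∃ (x y : P) (α : (D.calculus.restrict (bundleBase p)).Form),
          η = x • MulOpposite.op y • incl α} := by
  set DH := MaurerCartanDatum.ofRightIdeal (D.calculus.ideal.map (p : P →ₐ[k] H).toLinearMap)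
      (mul_mem_map_ideal p hp D.calculus) with hDH
  have hΩH : fibreCalculus p hp D.calculus = DH.calculus := rfl
  rw [hΩH]
  let m : H →ₗ[k] DH.calculus.invariantForms := DH.calculus.maurerCartan.rangeRestrict
  have hm : ∀ y : P, m (p y) = 0 ↔ ∃ z, p z = 0 ∧ D.varpi z = D.varpi y := by
    intro y
    rw [← fibreCalculus_varpi_eq_zero p hp D y, ← MaurerCartanDatum.maurerCartan_eq_zero_iff]
    exact Subtype.ext_iff
  -- A linear section of `varpi` defines `θ`. The choice is immaterial: two preimages of one vector
  -- differ by an element of `ker varpi`, to which `hm` applies with `z = 0`.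
  obtain ⟨s, hs⟩ := LinearMap.exists_rightInverse_of_surjective D.varpi
    (LinearMap.range_eq_top.2 hD)
  let θ : D.Lam →ₗ[k] DH.calculus.invariantForms := m ∘ₗ (p : P →ₐ[k] H).toLinearMap ∘ₗ s
  have hθ : ∀ y, θ (D.varpi y) = m (p y) := by
    intro y
    change m (p (s (D.varpi y))) = m (p y)
    rw [← sub_eq_zero, ← map_sub, ← map_sub, hm]
    refine ⟨0, map_zero _, ?_⟩
    rw [map_sub, ← LinearMap.comp_apply, hs, LinearMap.id_apply, map_zero, sub_self]
  have hθs : Function.Surjective θ := by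
    rintro ⟨_, ⟨h, rfl⟩⟩
    obtain ⟨y, rfl⟩ := hp h
    exact ⟨D.varpi y, hθ y⟩
  let ver : D.calculus.Form →ₗ[P] P ⊗[k] DH.calculus.invariantForms :=
    { toFun := fun ω => θ.lTensor P (D.formEquiv ω)
      map_add' := fun x y => by simp only [map_add]
      map_smul' := fun x ω => by
        rw [D.formEquiv_smul, RingHom.id_apply]
        generalize D.formEquiv ω = X
        induction X with
        | zero => simp
        | add X Y hX hY => simp only [map_add, smul_add, hX, hY]
        | tmul y v => simp [TensorProduct.smul_tmul'] }
  have hver : ∀ x y : P, ver (x • D.calculus.d y) = preVer p DH.calculus (x ⊗ₜ y) := by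
    intro x y
    rw [map_smul]
    change x • θ.lTensor P (D.varpi.lTensor P (Coalgebra.comul y)) = m.lTensor P
      (x ⊗ₜ[k] (1 : H) * Algebra.TensorProduct.map (AlgHom.id k P) (p : P →ₐ[k] H)
        (Coalgebra.comul y))
    generalize (Coalgebra.comul y : P ⊗[k] P) = X
    induction X with
    | zero => simp
    | add X Y hX hY => simp only [map_add, smul_add, mul_add, hX, hY]
    | tmul y v => simp [TensorProduct.smul_tmul', hθ]
  refine ⟨D.calculus.restrictIncl _, ver, fun a b => rfl, hver,
    (LinearMap.lTensor_surjective P hθs).comp D.formEquiv.surjective, fun ω => ⟨fun h => ?_, ?_⟩⟩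
  -- By right exactness the kernel of `id ⊗ θ` is the image of `P ⊗ ker θ`, and `ker θ = ϖ(ker p)`.
  · have h1 : D.formEquiv ω ∈ LinearMap.range ((LinearMap.ker θ).subtype.lTensor P) :=
      ((lTensor_exact P (LinearMap.exact_subtype_ker_map θ) hθs) (D.formEquiv ω)).1 h
    obtain ⟨X, hX⟩ := h1
    obtain rfl : D.form ((LinearMap.ker θ).subtype.lTensor P X) = ω := by
      rw [hX, D.form_formEquiv]
    clear hX h
    induction X with
    | zero => simp
    | add X Y hX hY => simp only [map_add]; exact add_mem hX hY
    | tmul x v =>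
      obtain ⟨v, hv⟩ := v
      obtain ⟨y, rfl⟩ := hD v
      obtain ⟨z, hz, hzy⟩ := (hm y).1 ((hθ y).symm.trans hv)
      rw [LinearMap.lTensor_tmul, Submodule.subtype_apply]
      simp only [← hzy]
      exact hgen x z hz
  · intro h
    induction h using Submodule.span_induction with
    | zero => simp
    | add x y _ _ hx hy => rw [map_add, hx, hy, add_zero]
    | smul c x _ hx =>
      rw [← algebraMap_smul P c x, map_smul, hx, smul_zero]
    | mem η hη =>
      obtain ⟨x, y, α, rfl⟩ := hη
      obtain ⟨X, rfl⟩ := (PreCalculus.isCalculus_iff _).1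
        (D.calculus.restrict_isCalculus (bundleBase p)) α
      induction X with
      | zero => simp
      | add X Y hX hY => simp only [map_add, smul_add, hX, hY, add_zero]
      | tmul a b =>
        -- With `(d b) y = d(b y) - b d y`, the two values of `ver` agree because the Galois map is
        -- balanced over the base.
        have h1 : MulOpposite.op y • D.calculus.d (b : P) =
            (1 : P) • D.calculus.d ((b : P) * y) - (b : P) • D.calculus.d y := by
          rw [D.calculus.leibniz, one_smul]; abel
        rw [PreCalculus.adb_tmul, PreCalculus.restrictIncl_smul, PreCalculus.restrictIncl_d,
          ← smul_comm (a : P) (MulOpposite.op y), h1, map_smul, map_smul, map_sub, hver, hver,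
          ← preVer_balanced, one_mul,
          sub_self, smul_zero, smul_zero]

end Bundle

/-! ### The base of `D^∨(G) → ℂ(G)` and the Galois map. -/

namespace Dvee

variable {G : Type*} [Group G] [Fintype G] [DecidableEq G]

theorem ext_el {M : Type*} [AddCommGroup M] [Module ℂ M] {f f' : Dvee G →ₗ[ℂ] M}
    (h : ∀ g x : G, f (el g x) = f' (el g x)) : f = f' :=
  (basis G).ext fun x => by rw [basis_apply]; exact h x.1 x.2

theorem projFun_el (g h : G) : projFun G (el g h) = FunAlg.delta g := projAlgHom_el g h

theorem bundleCoaction_el (g h : G) : bundleCoaction (projFun G) (el g h) =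
    ∑ f : G, el f (f⁻¹ * g * h * g⁻¹ * f) ⊗ₜ[ℂ] FunAlg.delta (f⁻¹ * g) := by
  change Algebra.TensorProduct.map (AlgHom.id ℂ (Dvee G)) (projFun G : Dvee G →ₐ[ℂ] FunAlg G)
    (Coalgebra.comul (R := ℂ) (el g h)) = _
  rw [comul_el, map_sum]
  exact Finset.sum_congr rfl fun f _ => by
    rw [Algebra.TensorProduct.map_tmul]; exact congrArg _ (projFun_el _ _)

/-- `∑_f δ_f ⊗ f⁻¹gf`. -/
noncomputable def iota (g : G) : Dvee G := ∑ f : G, el f (f⁻¹ * g * f)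

theorem iota_mul_el (g f h : G) : iota g * el f h = el f (f⁻¹ * g * f * h) := by
  simp [iota, Finset.sum_mul, el_mul_el]

theorem el_mul_iota (g f h : G) : el f h * iota g = el f (h * (f⁻¹ * g * f)) := by
  simp [iota, Finset.mul_sum, el_mul_el]

theorem iota_mul_iota (g h : G) : iota g * iota h = iota (g * h) := by
  rw [show iota (g * h) = ∑ f : G, el f (f⁻¹ * (g * h) * f) from rfl, iota, Finset.sum_mul]
  exact Finset.sum_congr rfl fun f _ => by rw [el_mul_iota]; congr 1; group

theorem iota_one : iota (1 : G) = 1 := by simp [iota, one_eq_sum]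

theorem comul_iota (g : G) : Coalgebra.comul (R := ℂ) (iota g) =
    ∑ f : G, el f (f⁻¹ * g * f) ⊗ₜ[ℂ] iota (f⁻¹ * g * f) := by
  simp only [iota, map_sum, comul_el, TensorProduct.tmul_sum]
  rw [Finset.sum_comm]
  refine Finset.sum_congr rfl fun f _ => Fintype.sum_equiv (Equiv.mulLeft f⁻¹) _ _ fun u => ?_
  simp [mul_assoc]

theorem iota_mem_bundleBase (g : G) : iota g ∈ bundleBase (projFun G) := by
  change bundleCoaction (projFun G) (iota g) = iota g ⊗ₜ[ℂ] (1 : FunAlg G)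
  simp only [iota, map_sum, bundleCoaction_el, FunAlg.one_eq_sum, TensorProduct.tmul_sum,
    TensorProduct.sum_tmul]
  rw [Finset.sum_comm]
  conv_rhs => rw [Finset.sum_comm]
  refine Finset.sum_congr rfl fun f _ => Fintype.sum_equiv (Equiv.mulLeft f⁻¹) _ _ fun u => ?_
  simp [mul_assoc]

/-- `g ↦ ∑_f δ_f ⊗ f⁻¹gf` as a map of algebras. -/
noncomputable def iotaHom (G : Type*) [Group G] [Fintype G] [DecidableEq G] :
    MonoidAlgebra ℂ G →ₐ[ℂ] Dvee G :=
  MonoidAlgebra.lift ℂ _ _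
    { toFun := iota
      map_one' := iota_one
      map_mul' := fun g h => (iota_mul_iota g h).symm }

@[simp] theorem iotaHom_single (g : G) : iotaHom G (MonoidAlgebra.single g 1) = iota g := by
  simp [iotaHom]

/-- `δ_g ⊗ h ↦ δ_{g,e} h`. -/
noncomputable def evalOne (G : Type*) [Group G] [Fintype G] [DecidableEq G] :
    Dvee G →ₗ[ℂ] MonoidAlgebra ℂ G :=
  (basis G).constr ℂ fun x => if x.1 = 1 then MonoidAlgebra.single x.2 1 else 0

theorem evalOne_el (g h : G) :
    evalOne G (el g h) = if g = 1 then MonoidAlgebra.single h 1 else 0 := by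
  rw [← basis_apply (g, h)]; exact (basis G).constr_basis ℂ _ (g, h)

/-- Only the summand `f = e` of `iota g` survives, and it is `δ_e ⊗ g`; hence `iotaHom` is
injective. -/
theorem evalOne_iotaHom (x : MonoidAlgebra ℂ G) : evalOne G (iotaHom G x) = x := by
  have : evalOne G ∘ₗ (iotaHom G).toLinearMap = LinearMap.id :=
    (MonoidAlgebra.basis G ℂ).ext fun g => by
      simp [MonoidAlgebra.basis_apply, iota, evalOne_el]
  exact LinearMap.congr_fun this x

/-- Coinvariants are obtained by averaging over the fibre. With `σ` the sum of values on `G`, the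
map `(id ⊗ σ) Δ_R` sends `δ_g ⊗ h` to `iota (ghg⁻¹)`, and it multiplies a coinvariant element by
`|G|`. -/
theorem range_iotaHom : (iotaHom G).range = bundleBase (projFun G) := by
  apply le_antisymm
  · rintro _ ⟨x, rfl⟩
    change iotaHom G x ∈ _
    induction x using MonoidAlgebra.induction_linear with
    | zero => simp
    | add x y hx hy => rw [map_add]; exact add_mem hx hy
    | single g c =>
      have : (MonoidAlgebra.single g c : MonoidAlgebra ℂ G) = c • MonoidAlgebra.single g 1 := by simp
      rw [this, map_smul, iotaHom_single]
      exact Subalgebra.smul_mem _ (iota_mem_bundleBase g) c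
  · intro a ha
    replace ha : bundleCoaction (projFun G) a = a ⊗ₜ[ℂ] (1 : FunAlg G) := ha
    let σ : FunAlg G →ₗ[ℂ] ℂ := (FunAlg.basis G).constr ℂ fun _ => 1
    have hσ : ∀ g, σ (FunAlg.delta g) = 1 := fun g => by
      rw [← FunAlg.basis_apply]; exact (FunAlg.basis G).constr_basis ℂ _ g
    let T : Dvee G ⊗[ℂ] FunAlg G →ₗ[ℂ] Dvee G :=
      (TensorProduct.rid ℂ (Dvee G)).toLinearMap ∘ₗ σ.lTensor (Dvee G)
    have hT : ∀ x : Dvee G, T (bundleCoaction (projFun G) x) ∈ (iotaHom G).range := by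
      intro x
      have h1 : T ∘ₗ (bundleCoaction (projFun G)).toLinearMap =
          (basis G).constr ℂ fun x => iota (x.1 * x.2 * x.1⁻¹) := by
        refine (basis G).ext fun x => ?_
        rw [(basis G).constr_basis, basis_apply, LinearMap.comp_apply, AlgHom.toLinearMap_apply,
          bundleCoaction_el]
        simp [T, hσ, iota, mul_assoc]
      have h2 := LinearMap.congr_fun h1 x
      rw [LinearMap.comp_apply, AlgHom.toLinearMap_apply, Module.Basis.constr_apply_fintype] at h2
      rw [h2]
      exact sum_mem fun y _ => Subalgebra.smul_mem _ ((iotaHom G).mem_range.2 ⟨_, iotaHom_single _⟩) _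
    have h3 := hT a
    have h4 : T (a ⊗ₜ[ℂ] (1 : FunAlg G)) = (Fintype.card G : ℂ) • a := by
      simp [T, FunAlg.one_eq_sum, hσ]
    rw [ha, h4] at h3
    have h5 := Subalgebra.smul_mem _ h3 (Fintype.card G : ℂ)⁻¹
    rwa [inv_smul_smul₀ (by exact_mod_cast Fintype.card_ne_zero)] at h5

/-- The isomorphism `ℂG ≅ A`, `g ↦ ∑_f δ_f ⊗ f⁻¹gf`. -/
noncomputable def baseEquiv (G : Type*) [Group G] [Fintype G] [DecidableEq G] :
    MonoidAlgebra ℂ G ≃ₐ[ℂ] bundleBase (projFun G) :=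
  (AlgEquiv.ofInjective (iotaHom G)
    (Function.LeftInverse.injective evalOne_iotaHom)).trans
    (Subalgebra.equivOfEq _ _ range_iotaHom)

theorem comul_mem_range_of_mem_bundleBase (a : Dvee G) (ha : a ∈ bundleBase (projFun G)) :
    Bialgebra.comulAlgHom ℂ (Dvee G) a ∈ (Algebra.TensorProduct.map (AlgHom.id ℂ (Dvee G))
      (bundleBase (projFun G)).val).range := by
  rw [← range_iotaHom] at ha
  obtain ⟨x, rfl⟩ := ha
  change Coalgebra.comul (iotaHom G x) ∈ _
  induction x using MonoidAlgebra.induction_linear with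
  | zero => rw [map_zero, map_zero]; exact zero_mem _
  | add x y hx hy => rw [map_add, map_add]; exact add_mem hx hy
  | single g c =>
    have : (MonoidAlgebra.single g c : MonoidAlgebra ℂ G) = c • MonoidAlgebra.single g 1 := by simp
    rw [this, map_smul, map_smul, iotaHom_single, comul_iota]
    refine Subalgebra.smul_mem _ (sum_mem fun f _ => ?_) c
    exact ⟨el f (f⁻¹ * g * f) ⊗ₜ ⟨_, iota_mem_bundleBase (f⁻¹ * g * f)⟩, rfl⟩

theorem preGaloisMap_el (x : Dvee G) (f h : G) :
    preGaloisMap (projFun G) (x ⊗ₜ el f h) =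
      ∑ u : G, (x * el u (u⁻¹ * f * h * f⁻¹ * u)) ⊗ₜ[ℂ] FunAlg.delta (u⁻¹ * f) := by
  have : preGaloisMap (projFun G) (x ⊗ₜ el f h) =
    (x ⊗ₜ[ℂ] (1 : FunAlg G)) * bundleCoaction (projFun G) (el f h) := rfl
  rw [this, bundleCoaction_el, Finset.mul_sum]
  exact Finset.sum_congr rfl fun u _ => by rw [Algebra.TensorProduct.tmul_mul_tmul, one_mul]

/-- The inverse sends `(δ_g ⊗ h) ⊗ δ_s` to the class of `(δ_g ⊗ h) ⊗ (δ_{gs} ⊗ 1)`. Modulo the base,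
the second factor can be stripped of its group part. -/
theorem galoisMap_bijective : Function.Bijective (galoisMap (projFun G)) := by
  let B := (basis G).tensorProduct (FunAlg.basis G)
  let inv : Dvee G ⊗[ℂ] FunAlg G →ₗ[ℂ]
      (Dvee G ⊗[ℂ] Dvee G) ⧸ balancedRelations (bundleBase (projFun G)) :=
    B.constr ℂ fun x => Submodule.Quotient.mk (el x.1.1 x.1.2 ⊗ₜ el (x.1.1 * x.2) 1)
  have hinv : ∀ g h s : G, inv (el g h ⊗ₜ FunAlg.delta s) =
      Submodule.Quotient.mk (el g h ⊗ₜ el (g * s) 1) := by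
    intro g h s
    have := B.constr_basis ℂ (fun x => (Submodule.Quotient.mk (el x.1.1 x.1.2 ⊗ₜ el (x.1.1 * x.2) 1) :
      (Dvee G ⊗[ℂ] Dvee G) ⧸ balancedRelations (bundleBase (projFun G)))) ((g, h), s)
    rwa [Module.Basis.tensorProduct_apply, basis_apply, FunAlg.basis_apply] at this
  have hG : ∀ X : Dvee G ⊗[ℂ] Dvee G, galoisMap (projFun G) (Submodule.Quotient.mk X) =
      preGaloisMap (projFun G) X := fun X => rfl
  have hR : galoisMap (projFun G) ∘ₗ inv = LinearMap.id := by
    refine B.ext fun ⟨⟨g, h⟩, s⟩ => ?_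
    rw [Module.Basis.tensorProduct_apply, basis_apply, FunAlg.basis_apply, LinearMap.comp_apply,
      hinv, hG, preGaloisMap_el]
    rw [Finset.sum_eq_single g (fun u _ hu => by
      rw [el_mul_el, if_neg hu.symm, TensorProduct.zero_tmul]) (by simp)]
    simp [el_mul_el]
  have hL : inv ∘ₗ galoisMap (projFun G) = LinearMap.id := by
    refine Submodule.linearMap_qext _ (((basis G).tensorProduct (basis G)).ext ?_)
    rintro ⟨⟨g, h⟩, ⟨f, k⟩⟩
    rw [Module.Basis.tensorProduct_apply, basis_apply, basis_apply]
    change inv (galoisMap (projFun G) (Submodule.Quotient.mk (el g h ⊗ₜ el f k))) =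
      Submodule.Quotient.mk (el g h ⊗ₜ el f k)
    rw [hG, preGaloisMap_el, Finset.sum_eq_single g (fun u _ hu => by
      rw [el_mul_el, if_neg (fun h => hu h.symm), TensorProduct.zero_tmul]) (by simp),
      el_mul_el, if_pos rfl, hinv, Submodule.Quotient.eq]
    -- Since `δ_f ⊗ k = iota (fkf⁻¹) · (δ_f ⊗ 1)`, the factor `iota (fkf⁻¹)` moves across the
    -- balanced tensor product.
    refine Submodule.subset_span ⟨el g h, ⟨_, iota_mem_bundleBase (f * k * f⁻¹)⟩, el f 1, ?_⟩
    rw [el_mul_iota, iota_mul_el]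
    simp [mul_assoc]
  exact ⟨Function.LeftInverse.injective (g := inv) (LinearMap.congr_fun hL),
    Function.RightInverse.surjective (g := inv) (LinearMap.congr_fun hR)⟩

/-- `ker p` is spanned by the elements `δ_g ⊗ h - δ_g ⊗ 1`. -/
theorem map_mem_of_projFun_eq_zero {M : Type*} [AddCommGroup M] [Module ℂ M] (F : Dvee G →ₗ[ℂ] M)
    (N : Submodule ℂ M) (hF : ∀ g h : G, F (el g h - el g 1) ∈ N) {z : Dvee G}
    (hz : projFun G z = 0) : F z ∈ N := by
  let s : FunAlg G →ₗ[ℂ] Dvee G := (FunAlg.basis G).constr ℂ fun g => el g 1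
  have hs : ∀ g, s (FunAlg.delta g) = el g 1 := fun g => by
    rw [← FunAlg.basis_apply]; exact (FunAlg.basis G).constr_basis ℂ _ g
  -- Modulo `N`, the map `F` factors through `p` by way of its section `δ_g ↦ δ_g ⊗ 1`.
  have h1 : N.mkQ ∘ₗ F = N.mkQ ∘ₗ F ∘ₗ s ∘ₗ (projFun G : Dvee G →ₐ[ℂ] FunAlg G).toLinearMap := by
    refine ext_el fun g h => ?_
    change (Submodule.Quotient.mk (F (el g h)) : M ⧸ N) =
      Submodule.Quotient.mk (F (s (projFun G (el g h))))
    rw [projFun_el, hs, Submodule.Quotient.eq, ← map_sub]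
    exact hF g h
  have h2 := LinearMap.congr_fun h1 z
  change (Submodule.Quotient.mk (F z) : M ⧸ N) = Submodule.Quotient.mk (F (s (projFun G z))) at h2
  rwa [hz, map_zero, map_zero, Submodule.Quotient.mk_zero, Submodule.Quotient.mk_eq_zero] at h2

end Dvee

/-! ### Recognising a restricted calculus. -/

namespace PreCalculus

/-- Only injectivity into the ambient forms has to be supplied: the image is the span of the `e(a) d
e(b)`, which is all of `B (d B)` because `e` is onto. -/
theorem nonempty_iso_restrict {k A P : Type*} [CommRing k] [Ring A] [Algebra k A] [Ring P]
    [Algebra k P] {B : Subalgebra k P} (e : A ≃ₐ[k] B) {Ω : PreCalculus k A}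
    {Ω' : PreCalculus k P} (hΩ : Ω.IsCalculus) (Φ : Ω.Form →ₗ[k] Ω'.Form)
    (hΦ : Function.Injective Φ) (h : ∀ a b : A, Φ (a • Ω.d b) = (e a : P) • Ω'.d (e b : P)) :
    Nonempty (Iso e Ω (Ω'.restrict B)) := by
  have hadb : ∀ X : A ⊗[k] A, Φ (Ω.adb X) = Ω'.restrictIncl B ((Ω'.restrict B).adb
      (TensorProduct.map e.toLinearMap e.toLinearMap X)) := by
    intro X
    induction X with
    | zero => simp
    | add X Y hX hY => simp only [map_add, hX, hY]
    | tmul x y => simp [h]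
  have hr : ∀ ω, Φ ω ∈ LinearMap.range (Ω'.restrictIncl B) := by
    intro ω
    obtain ⟨X, rfl⟩ := Ω.isCalculus_iff.1 hΩ ω
    exact ⟨_, (hadb X).symm⟩
  let i := LinearEquiv.ofInjective _ (Ω'.restrictIncl_injective B)
  let Ψ : Ω.Form →ₗ[k] (Ω'.restrict B).Form := i.symm.toLinearMap ∘ₗ Φ.codRestrict _ hr
  have hΨ : ∀ ω, Ω'.restrictIncl B (Ψ ω) = Φ ω := fun ω =>
    congrArg Subtype.val (i.apply_symm_apply (Φ.codRestrict _ hr ω))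
  have hinj : Function.Injective Ψ := fun x y hxy => hΦ (by rw [← hΨ, ← hΨ, hxy])
  have hsurj : Function.Surjective Ψ := by
    intro ω
    obtain ⟨X, rfl⟩ := (isCalculus_iff _).1 (Ω'.restrict_isCalculus B) ω
    refine ⟨Ω.adb (TensorProduct.map e.symm.toLinearMap e.symm.toLinearMap X),
      Ω'.restrictIncl_injective B ?_⟩
    rw [hΨ, hadb]
    congr 2
    induction X with
    | zero => simp
    | add X Y hX hY => simp only [map_add, hX, hY]
    | tmul x y => simp
  exact ⟨Iso.ofIsCalculus e hΩ (LinearEquiv.ofBijective Ψ ⟨hinj, hsurj⟩) fun a b =>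
    Ω'.restrictIncl_injective B ((hΨ _).trans (h a b))⟩

end PreCalculus

/-! ### Crossed modules: the map `twist` and the right coaction on `End W`. -/

section CrossedModule

set_option linter.unusedSectionVars false

open Dvee

variable {G : Type*} [Group G] [Fintype G] [DecidableEq G] {W : Type*} [AddCommGroup W]
  [Module ℂ W] (M : FunAlg G →ₐ[ℂ] Module.End ℂ W) (ρ : Representation ℂ G W)

/-- The map `ϖ ∘ π_ε` of the calculus of a crossed module, with values in `End W`. -/
noncomputable def doubleVarpi : Dvee G →ₗ[ℂ] Module.End ℂ W :=
  doubleRep M ρ - (LinearMap.toSpanSingleton ℂ _ 1) ∘ₗ Coalgebra.counit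

theorem doubleRep_el (g h : G) : doubleRep M ρ (el g h) = M (FunAlg.delta g) * ρ h := by
  have := doubleRep_mk M ρ (FunAlg.delta g) (MonoidAlgebra.single h 1)
  rwa [ρ.asAlgebraHom_single_one] at this

theorem doubleVarpi_apply (x : Dvee G) : doubleVarpi M ρ x =
    doubleRep M ρ x - Coalgebra.counit (R := ℂ) x • (1 : Module.End ℂ W) := rfl

theorem doubleVarpi_el (g h : G) : doubleVarpi M ρ (el g h) =
    M (FunAlg.delta g) * ρ h - if g = 1 then 1 else 0 := by
  rw [doubleVarpi_apply, doubleRep_el, counit_el, ite_smul, one_smul, zero_smul]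

theorem endAct_el (g h : G) (T : Module.End ℂ W) :
    endAct M ρ (el g h) T = M (FunAlg.delta g) * (T * ρ h) := by
  have := endAct_mk M ρ (FunAlg.delta g) (MonoidAlgebra.single h 1) T
  rwa [ρ.asAlgebraHom_single_one] at this

theorem map_delta_mul_delta (g h : G) : M (FunAlg.delta g) * M (FunAlg.delta h) =
    if g = h then M (FunAlg.delta g) else 0 := by
  rw [← map_mul, FunAlg.delta_mul_delta]
  split_ifs <;> simp

theorem sum_map_delta : ∑ g : G, M (FunAlg.delta g) = 1 := by
  rw [← map_sum, ← FunAlg.one_eq_sum, map_one]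

/-- `W` is a crossed module: `h ▷ (δ_g ▷ w) = δ_{hgh⁻¹} ▷ (h ▷ w)`. -/
def IsCrossed : Prop :=
  ∀ h g : G, ρ h * M (FunAlg.delta g) = M (FunAlg.delta (h * g * h⁻¹)) * ρ h

/-- `T ↦ ∑_f δ_f f⁻¹ T f` on `End W`. -/
noncomputable def twist : Module.End ℂ W →ₗ[ℂ] Module.End ℂ W :=
  ∑ f : G, LinearMap.mulLeft ℂ (M (FunAlg.delta f) * ρ f⁻¹) ∘ₗ LinearMap.mulRight ℂ (ρ f)

theorem twist_apply (T : Module.End ℂ W) :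
    twist M ρ T = ∑ f : G, M (FunAlg.delta f) * ρ f⁻¹ * (T * ρ f) := by
  simp [twist, mul_assoc]

theorem map_delta_mul_twist (f : G) (T : Module.End ℂ W) :
    M (FunAlg.delta f) * twist M ρ T = M (FunAlg.delta f) * ρ f⁻¹ * (T * ρ f) := by
  rw [twist_apply, Finset.mul_sum, Finset.sum_eq_single f]
  · rw [← mul_assoc, ← mul_assoc (M _) (M _), map_delta_mul_delta, if_pos rfl]
  · intro u _ hu
    rw [← mul_assoc, ← mul_assoc (M _) (M _), map_delta_mul_delta, if_neg hu.symm, zero_mul, zero_mul]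
  · simp

theorem twist_rep (g : G) : twist M ρ (ρ g) = doubleRep M ρ (iota g) := by
  rw [twist_apply, iota, map_sum]
  exact Finset.sum_congr rfl fun f _ => by
    rw [doubleRep_el, mul_assoc, ← map_mul, ← map_mul, mul_assoc]

theorem twist_one : twist M ρ 1 = 1 := by
  rw [twist_apply]
  refine Eq.trans ?_ (sum_map_delta M)
  exact Finset.sum_congr rfl fun f _ => by
    rw [one_mul, mul_assoc, ← map_mul, inv_mul_cancel, map_one, mul_one]

theorem counit_iota (g : G) : Coalgebra.counit (R := ℂ) (iota g) = 1 := by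
  simp [iota, counit_el]

/-- This is the purpose of `twist`: it matches the Maurer–Cartan forms of `ℂG` and of the base. -/
theorem doubleVarpi_iota (g : G) : doubleVarpi M ρ (iota g) = twist M ρ (ρ g - 1) := by
  rw [doubleVarpi_apply, counit_iota, one_smul, map_sub, twist_rep, twist_one]

variable {M ρ}

/-- In a crossed module `f` commutes with `δ_f`, so `δ_f (twist T) = f⁻¹ (δ_f T) f`. This determines
every `δ_f T`, and these add up to `T`. -/
theorem twist_injective (hM : IsCrossed M ρ) : Function.Injective (twist M ρ) := by
  rw [← LinearMap.ker_eq_bot, LinearMap.ker_eq_bot']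
  intro T hT
  have h1 : ∀ f : G, M (FunAlg.delta f) * T = 0 := by
    intro f
    have h2 := map_delta_mul_twist M ρ f T
    have h3 : M (FunAlg.delta f) * ρ f⁻¹ = ρ f⁻¹ * M (FunAlg.delta f) := by
      rw [hM]; congr 3; group
    rw [hT, mul_zero, h3] at h2
    have h4 := congrArg (fun X => ρ f * X * ρ f⁻¹) h2
    simp only [mul_zero, zero_mul, mul_assoc, ← map_mul, mul_inv_cancel, map_one, mul_one] at h4
    rw [← mul_assoc, ← map_mul, mul_inv_cancel, map_one, one_mul] at h4
    exact h4.symm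
  rw [← one_mul T, ← sum_map_delta M, Finset.sum_mul]
  exact Finset.sum_eq_zero fun f _ => h1 f

variable (M ρ) in
/-- The right coaction `T ↦ ∑ f⁻¹ δ_a T δ_b f ⊗ (δ_{f⁻¹} ⊗ a b⁻¹)` on `End W`. -/
noncomputable def endCoact : Module.End ℂ W →ₗ[ℂ] Module.End ℂ W ⊗[ℂ] Dvee G :=
  ∑ f : G, ∑ a : G, ∑ b : G, (TensorProduct.mk ℂ (Module.End ℂ W) (Dvee G)).flip
    (el f⁻¹ (a * b⁻¹)) ∘ₗ LinearMap.mulLeft ℂ (ρ f⁻¹ * M (FunAlg.delta a)) ∘ₗ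
      LinearMap.mulRight ℂ (M (FunAlg.delta b) * ρ f)

/-- The operator `δ_s h` is homogeneous: it maps degree `h⁻¹sh` to degree `s`. Only `a = s` and `b =
h⁻¹sh` contribute to the double sum. -/
theorem endCoact_el (hM : IsCrossed M ρ) (s h : G) :
    endCoact M ρ (M (FunAlg.delta s) * ρ h) =
      ∑ u : G, (ρ u⁻¹ * M (FunAlg.delta s) * (ρ h * ρ u)) ⊗ₜ el u⁻¹ (s * h⁻¹ * s⁻¹ * h) := by
  simp only [endCoact, LinearMap.sum_apply, LinearMap.comp_apply, LinearMap.mulLeft_apply,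
    LinearMap.mulRight_apply, LinearMap.flip_apply, TensorProduct.mk_apply]
  refine Finset.sum_congr rfl fun u _ => ?_
  have h1 : ∀ a b : G, ρ u⁻¹ * M (FunAlg.delta a) * (M (FunAlg.delta s) * ρ h *
      (M (FunAlg.delta b) * ρ u)) = if a = s ∧ s = h * b * h⁻¹ then
        ρ u⁻¹ * M (FunAlg.delta s) * (ρ h * ρ u) else 0 := by
    intro a b
    have : ρ u⁻¹ * M (FunAlg.delta a) * (M (FunAlg.delta s) * ρ h * (M (FunAlg.delta b) * ρ u)) =
        ρ u⁻¹ * ((M (FunAlg.delta a) * M (FunAlg.delta s)) * (ρ h * M (FunAlg.delta b))) * ρ u := by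
      noncomm_ring
    rw [this, hM h b, map_delta_mul_delta]
    by_cases h1 : a = s
    · subst h1
      rw [if_pos rfl, ← mul_assoc (M _), map_delta_mul_delta]
      by_cases h2 : a = h * b * h⁻¹
      · rw [if_pos h2, if_pos ⟨rfl, h2⟩]; noncomm_ring
      · rw [if_neg h2, if_neg (fun h => h2 h.2)]; simp
    · rw [if_neg h1, if_neg (fun h => h1 h.1)]; simp
  simp only [h1]
  rw [Finset.sum_eq_single s, Finset.sum_eq_single (h⁻¹ * s * h)]
  · rw [if_pos ⟨rfl, by group⟩]; congr 2; group
  · intro b _ hb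
    rw [if_neg, TensorProduct.zero_tmul]
    rintro ⟨-, rfl⟩
    exact hb (by group)
  · simp
  · intro a _ ha
    exact Finset.sum_eq_zero fun b _ => by rw [if_neg (fun h => ha h.1), TensorProduct.zero_tmul]
  · simp

theorem endCoact_one (hM : IsCrossed M ρ) : endCoact M ρ 1 = 1 ⊗ₜ 1 := by
  have : (1 : Module.End ℂ W) = ∑ s : G, M (FunAlg.delta s) * ρ 1 := by
    rw [← Finset.sum_mul, sum_map_delta, map_one, one_mul]
  conv_lhs => rw [this]
  rw [map_sum]
  simp only [endCoact_el hM]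
  rw [Finset.sum_comm, one_eq_sum, TensorProduct.tmul_sum]
  refine Fintype.sum_equiv (Equiv.inv G) _ _ fun u => ?_
  simp only [inv_one, mul_one, mul_inv_cancel, Equiv.inv_apply]
  rw [← TensorProduct.sum_tmul]
  congr 1
  rw [map_one, one_mul, ← Finset.sum_mul, ← Finset.mul_sum, sum_map_delta, mul_one, ← map_mul,
    inv_mul_cancel, map_one]

/-- This is the condition on `R` in `extends_coactFst`, for `R = endCoact`. -/
theorem coactMul_endCoact (hM : IsCrossed M ρ) (x : Dvee G) :
    ((LinearMap.mul' ℂ (Dvee G)).lTensor (Module.End ℂ W) ∘ₗ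
      (TensorProduct.leftComm ℂ (Dvee G) (Module.End ℂ W) (Dvee G)).toLinearMap)
      ((endCoact M ρ ∘ₗ doubleVarpi M ρ).lTensor (Dvee G) (Coalgebra.comul x)) =
    (doubleVarpi M ρ).rTensor (Dvee G) (Coalgebra.comul x) := by
  set m := ((LinearMap.mul' ℂ (Dvee G)).lTensor (Module.End ℂ W) ∘ₗ
      (TensorProduct.leftComm ℂ (Dvee G) (Module.End ℂ W) (Dvee G)).toLinearMap) with hm_def
  have hm : ∀ (a b : Dvee G) (T : Module.End ℂ W), m (a ⊗ₜ (T ⊗ₜ b)) = T ⊗ₜ (a * b) := by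
    intro a b T; simp [m]
  suffices h : m ∘ₗ (endCoact M ρ ∘ₗ doubleVarpi M ρ).lTensor (Dvee G) ∘ₗ Coalgebra.comul =
      (doubleVarpi M ρ).rTensor (Dvee G) ∘ₗ Coalgebra.comul from LinearMap.congr_fun h x
  refine ext_el fun g h => ?_
  simp only [LinearMap.comp_apply, comul_el, map_sum, LinearMap.lTensor_tmul,
    LinearMap.rTensor_tmul]
  -- The substitution `f ↦ g f⁻¹` on the right makes the two sums agree term by term: multiplying by
  -- an element over `δ_f` leaves only `u = f⁻¹` in `endCoact`, with second leg `δ_f ⊗ h`.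
  rw [← Equiv.sum_comp ((Equiv.inv G).trans (Equiv.mulLeft g))
    (fun f => doubleVarpi M ρ (el f (f⁻¹ * g * h * g⁻¹ * f)) ⊗ₜ[ℂ] el (f⁻¹ * g) h)]
  refine Finset.sum_congr rfl fun f _ => ?_
  have h1 : m (el f (f⁻¹ * g * h * g⁻¹ * f) ⊗ₜ endCoact M ρ (M (FunAlg.delta (f⁻¹ * g)) * ρ h)) =
      (M (FunAlg.delta (g * f⁻¹)) * ρ (f * h * f⁻¹)) ⊗ₜ el f h := by
    rw [endCoact_el hM, TensorProduct.tmul_sum, map_sum, Finset.sum_eq_single f⁻¹]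
    · rw [hm, el_mul_el, inv_inv, if_pos rfl, hM]
      congr 1
      · rw [mul_assoc, ← map_mul, ← map_mul]
        exact congrArg₂ (· * ·) (congrArg (fun x => M (FunAlg.delta x)) (by group))
          (congrArg ρ (by group))
      · congr 1; group
    · intro u _ hu
      rw [hm, el_mul_el, if_neg (fun h => hu (by rw [h, inv_inv])), TensorProduct.tmul_zero]
    · simp
  rw [doubleVarpi_el, map_sub, TensorProduct.tmul_sub, map_sub, h1, apply_ite (endCoact M ρ),
    endCoact_one hM, map_zero, Equiv.trans_apply, Equiv.inv_apply, Equiv.coe_mulLeft,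
    doubleVarpi_el, TensorProduct.sub_tmul]
  have e1 : (g * f⁻¹)⁻¹ * g * h * g⁻¹ * (g * f⁻¹) = f * h * f⁻¹ := by group
  have e2 : (g * f⁻¹)⁻¹ * g = f := by group
  rw [e1, e2]
  congr 1
  by_cases hfg : f = g
  · subst hfg
    simp [hm]
  · have h3 : ¬ (f⁻¹ * g = 1) := fun h => hfg (inv_mul_eq_one.1 h)
    have h4 : ¬ (g * f⁻¹ = 1) := fun h => hfg (mul_inv_eq_one.1 h).symm
    simp [h3, h4]

theorem doubleDatum_isBicovariant (hM : IsCrossed M ρ) :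
    (doubleDatum M ρ).calculus.IsBicovariant :=
  (doubleDatum M ρ).isBicovariant (endCoact M ρ) (coactMul_endCoact hM)

end CrossedModule

/-! ### Forms of a crossed module: horizontal forms and the calculus on the base. -/

section CrossedModule

set_option linter.unusedSectionVars false

open Dvee

variable {G : Type*} [Group G] [Fintype G] [DecidableEq G] {W : Type*} [AddCommGroup W]
  [Module ℂ W] {M : FunAlg G →ₐ[ℂ] Module.End ℂ W} {ρ : Representation ℂ G W}

variable (M ρ) in
/-- The forms of the calculus of a crossed module are `D^∨(G) ⊗ End W`. -/
noncomputable def doubleForm : Dvee G ⊗[ℂ] Module.End ℂ W →ₗ[ℂ] (doubleDatum M ρ).calculus.Form :=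
  (doubleDatum M ρ).form

theorem smul_doubleForm (x y : Dvee G) (T : Module.End ℂ W) :
    x • doubleForm M ρ (y ⊗ₜ T) = doubleForm M ρ ((x * y) ⊗ₜ T) := rfl

theorem doubleDatum_d (x : Dvee G) : (doubleDatum M ρ).calculus.d x =
    doubleForm M ρ ((doubleVarpi M ρ).lTensor (Dvee G) (Coalgebra.comul x)) := rfl

theorem doubleDatum_d_iota (g : G) : (doubleDatum M ρ).calculus.d (iota g) =
    ∑ u : G, doubleForm M ρ (el u (u⁻¹ * g * u) ⊗ₜ twist M ρ (ρ (u⁻¹ * g * u) - 1)) := by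
  rw [doubleDatum_d, comul_iota, map_sum, map_sum]
  exact Finset.sum_congr rfl fun u _ => by rw [LinearMap.lTensor_tmul, doubleVarpi_iota]

theorem op_el_one_smul_doubleForm (g : G) (y : Dvee G) (T : Module.End ℂ W) :
    MulOpposite.op (el g 1) • doubleForm M ρ (y ⊗ₜ T) =
      ∑ s : G, doubleForm M ρ ((y * el s 1) ⊗ₜ (M (FunAlg.delta (s⁻¹ * g)) * T)) := by
  have h1 : ∀ X : Dvee G ⊗[ℂ] Dvee G, (doubleDatum M ρ).form ((doubleDatum M ρ).rightMul X (y ⊗ₜ T)) =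
      doubleForm M ρ (TensorProduct.map (LinearMap.mulLeft ℂ y) ((endAct M ρ).flip T) X) := by
    intro X
    induction X with
    | zero => simp
    | add X Y hX hY => simp only [map_add, LinearMap.add_apply, hX, hY]
    | tmul a b => rfl
  have h2 : MulOpposite.op (el g 1) • doubleForm M ρ (y ⊗ₜ T) =
    (doubleDatum M ρ).form ((doubleDatum M ρ).rightMul (Coalgebra.comul (el g 1)) (y ⊗ₜ T)) := rfl
  rw [h2, h1, comul_el, map_sum, map_sum]
  refine Finset.sum_congr rfl fun s _ => ?_
  rw [TensorProduct.map_tmul, LinearMap.mulLeft_apply, LinearMap.flip_apply, endAct_el, map_one,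
    mul_one]
  simp

/-- Left multiplication over `δ_t` selects the summand `u = t` of `d (iota k)`, and `k` is such that
`t⁻¹kt = ghg⁻¹`, which the factor `gh⁻¹g⁻¹` cancels. Right multiplication by `δ_{tg} ⊗ 1` then
applies `δ_g` to the endomorphism, and `δ_g · twist (ghg⁻¹ - 1) = δ_g (h - 1)`. -/
theorem doubleForm_ker_eq (t g h : G) :
    doubleForm M ρ (el t 1 ⊗ₜ doubleVarpi M ρ (el g h - el g 1)) =
      el t (g * h⁻¹ * g⁻¹) • MulOpposite.op (el (t * g) 1) •
        (doubleDatum M ρ).calculus.d (iota (t * g * h * g⁻¹ * t⁻¹)) := by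
  set k := t * g * h * g⁻¹ * t⁻¹ with hk
  rw [doubleDatum_d_iota, Finset.smul_sum, Finset.smul_sum, Finset.sum_eq_single t]
  · rw [op_el_one_smul_doubleForm, Finset.smul_sum, Finset.sum_eq_single t]
    · have e1 : t⁻¹ * k * t = g * h * g⁻¹ := by rw [hk]; group
      have e2 : t⁻¹ * (t * g) = g := by group
      rw [smul_doubleForm, e1, e2, el_mul_el, if_pos rfl, el_mul_el, if_pos rfl, map_sub (doubleVarpi M ρ),
        doubleVarpi_el, doubleVarpi_el, map_delta_mul_twist]
      congr 2
      · congr 1; group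
      · have e3 : g⁻¹ * (g * h * g⁻¹ * g) = h := by group
        rw [map_one, mul_one, sub_sub_sub_cancel_right, sub_mul, mul_sub, one_mul, ← map_mul,
          mul_assoc (M _) (ρ g⁻¹) (ρ _), ← map_mul, mul_assoc (M _) (ρ g⁻¹) (ρ _), ← map_mul, e3,
          inv_mul_cancel, map_one, mul_one]
    · intro s _ hs
      rw [smul_doubleForm, el_mul_el, if_neg hs.symm, mul_zero, TensorProduct.zero_tmul, map_zero]
    · simp
  · intro u _ hu
    rw [smul_comm (el t _) (MulOpposite.op (el (t * g) 1)), smul_doubleForm, el_mul_el,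
      if_neg hu.symm, TensorProduct.zero_tmul, map_zero, smul_zero]
  · simp

theorem doubleForm_mem_span (x z : Dvee G) (hz : projFun G z = 0) :
    (doubleDatum M ρ).form (x ⊗ₜ (doubleDatum M ρ).varpi z) ∈ Submodule.span ℂ {η |
      ∃ (x y : Dvee G) (α : ((doubleDatum M ρ).calculus.restrict (bundleBase (projFun G))).Form),
        η = x • MulOpposite.op y •
          (doubleDatum M ρ).calculus.restrictIncl (bundleBase (projFun G)) α} := by
  change (doubleForm M ρ ∘ₗ TensorProduct.mk ℂ (Dvee G) (Module.End ℂ W) x ∘ₗ doubleVarpi M ρ) z ∈ _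
  refine map_mem_of_projFun_eq_zero _ _ (fun g h => ?_) hz
  simp only [LinearMap.comp_apply, TensorProduct.mk_apply]
  -- Splitting `x = ∑_t x (δ_t ⊗ 1)` reduces to the forms treated in `doubleForm_ker_eq`.
  have h1 : doubleForm M ρ (x ⊗ₜ doubleVarpi M ρ (el g h - el g 1)) =
      ∑ t : G, x • doubleForm M ρ (el t 1 ⊗ₜ doubleVarpi M ρ (el g h - el g 1)) := by
    simp only [smul_doubleForm]
    rw [← map_sum, ← TensorProduct.sum_tmul, ← Finset.mul_sum, ← one_eq_sum, mul_one]
  rw [h1]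
  refine sum_mem fun t _ => ?_
  rw [doubleForm_ker_eq, ← mul_smul]
  refine Submodule.subset_span ⟨_, el (t * g) 1,
    ((doubleDatum M ρ).calculus.restrict (bundleBase (projFun G))).d
      ⟨_, iota_mem_bundleBase (t * g * h * g⁻¹ * t⁻¹)⟩, rfl⟩

theorem repDatum_varpi_surjective (ρ : Representation ℂ G W) :
    Function.Surjective (repDatum ρ).varpi := by
  rintro ⟨_, ⟨y, hy, rfl⟩⟩
  obtain ⟨x, hx⟩ := MaurerCartanDatum.augProj_surjective (k := ℂ) ⟨y, hy⟩
  refine ⟨x, Subtype.ext ?_⟩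
  change ρ.asAlgebraHom (augProj ℂ _ x : MonoidAlgebra ℂ G) = _
  rw [hx]
  rfl

variable (M ρ) in
/-- `h ⊗ T ↦ ∑_u δ_u ⊗ u⁻¹hu ⊗ twist (u⁻¹ T u)` -/
noncomputable def baseFormMap : MonoidAlgebra ℂ G ⊗[ℂ] repImage ρ →ₗ[ℂ]
    Dvee G ⊗[ℂ] Module.End ℂ W :=
  ∑ u : G, TensorProduct.map
    ((MonoidAlgebra.basis G ℂ).constr ℂ fun h => el u (u⁻¹ * h * u))
    (twist M ρ ∘ₗ LinearMap.mulLeft ℂ (ρ u⁻¹) ∘ₗ LinearMap.mulRight ℂ (ρ u) ∘ₗ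
      (repImage ρ).subtype)

theorem baseFormMap_tmul (h : G) (T : repImage ρ) :
    baseFormMap M ρ (MonoidAlgebra.single h 1 ⊗ₜ T) =
      ∑ u : G, el u (u⁻¹ * h * u) ⊗ₜ twist M ρ (ρ u⁻¹ * (T * ρ u)) := by
  have : ∀ u : G, (MonoidAlgebra.basis G ℂ).constr ℂ (fun h => el u (u⁻¹ * h * u))
      (MonoidAlgebra.single h 1) = el u (u⁻¹ * h * u) := fun u => by
    rw [← MonoidAlgebra.basis_apply]; exact (MonoidAlgebra.basis G ℂ).constr_basis ℂ _ h
  simp [baseFormMap, this]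

/-- Evaluating the first leg at `e` keeps only `u = e` and leaves `id ⊗ twist`, which is injective.
-/
theorem baseFormMap_injective (hM : IsCrossed M ρ) : Function.Injective (baseFormMap M ρ) := by
  have h1 : (evalOne G).rTensor (Module.End ℂ W) ∘ₗ baseFormMap M ρ =
      (twist M ρ ∘ₗ (repImage ρ).subtype).lTensor (MonoidAlgebra ℂ G) := by
    refine TensorProduct.ext ((MonoidAlgebra.basis G ℂ).ext fun h => LinearMap.ext fun T => ?_)
    rw [MonoidAlgebra.basis_apply]
    change (evalOne G).rTensor (Module.End ℂ W) (baseFormMap M ρ (_ ⊗ₜ T)) =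
      (twist M ρ ∘ₗ (repImage ρ).subtype).lTensor (MonoidAlgebra ℂ G) (_ ⊗ₜ T)
    simp only [baseFormMap_tmul, map_sum, LinearMap.rTensor_tmul, evalOne_el,
      LinearMap.lTensor_tmul]
    rw [Finset.sum_eq_single 1 (fun u _ hu => by rw [if_neg hu, TensorProduct.zero_tmul]) (by simp)]
    simp
  have h2 : Function.Injective ((twist M ρ ∘ₗ (repImage ρ).subtype).lTensor
      (MonoidAlgebra ℂ G)) :=
    Module.Flat.lTensor_preserves_injective_linearMap _
      ((twist_injective hM).comp Subtype.val_injective)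
  rw [← h1] at h2
  exact Function.Injective.of_comp (f := (evalOne G).rTensor (Module.End ℂ W)) h2

/-- In `Ω¹_ρ` one has `h d g = hg ⊗ (ρ(g) - 1)`. Conjugation by `u` turns `ρ(g) - 1` into `ρ(u⁻¹gu)
- 1`, the factor that `Δ (iota g)` produces over `δ_u`. -/
theorem baseFormMap_smul_d (g h : G) :
    doubleForm M ρ (baseFormMap M ρ ((repDatum ρ).formEquiv
      ((MonoidAlgebra.single h (1 : ℂ) : MonoidAlgebra ℂ G) •
        (repCalculus ρ).d (MonoidAlgebra.single g 1)))) =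
      iota h • (doubleDatum M ρ).calculus.d (iota g) := by
  have h1 : (repDatum ρ).formEquiv ((MonoidAlgebra.single h (1 : ℂ) : MonoidAlgebra ℂ G) •
        (repCalculus ρ).d (MonoidAlgebra.single g 1)) =
      (MonoidAlgebra.single (h * g) (1 : ℂ) : MonoidAlgebra ℂ G) ⊗ₜ[ℂ]
        (repDatum ρ).varpi (MonoidAlgebra.single g 1) := by
    change (MonoidAlgebra.single h (1 : ℂ) : MonoidAlgebra ℂ G) • (repDatum ρ).varpi.lTensor _
      (Coalgebra.comul (R := ℂ) (MonoidAlgebra.single g (1 : ℂ) : MonoidAlgebra ℂ G)) = _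
    rw [MonoidAlgebra.comul_single]
    simp [TensorProduct.smul_tmul']
  rw [h1]
  let T : repImage ρ := (repDatum ρ).varpi (MonoidAlgebra.single g 1)
  have h2 : (T : Module.End ℂ W) = ρ g - 1 := by
    change ρ.asAlgebraHom (augProj ℂ (MonoidAlgebra ℂ G) (MonoidAlgebra.single g 1) :
      MonoidAlgebra ℂ G) = _
    rw [augProj_coe, map_sub, ρ.asAlgebraHom_single_one, MonoidAlgebra.counit_single]
    simp
  rw [doubleDatum_d_iota, Finset.smul_sum]
  refine (congrArg _ (baseFormMap_tmul (h * g) T)).trans ?_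
  rw [map_sum]
  refine Finset.sum_congr rfl fun u _ => ?_
  rw [smul_doubleForm, iota_mul_el, h2, sub_mul, mul_sub, one_mul, ← map_mul, ← map_mul, ← map_mul,
    inv_mul_cancel, map_one]
  have e1 : u⁻¹ * (h * g) * u = u⁻¹ * h * u * (u⁻¹ * g * u) := by group
  rw [e1, mul_assoc u⁻¹ g u]

/-- The calculus on the base of the bundle is `Ω¹_ρ`. -/
theorem nonempty_iso_repCalculus (hM : IsCrossed M ρ) :
    Nonempty (PreCalculus.Iso (baseEquiv G) (repCalculus ρ)
      ((doubleDatum M ρ).calculus.restrict (bundleBase (projFun G)))) := by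
  let Φ : (repCalculus ρ).Form →ₗ[ℂ] (doubleDatum M ρ).calculus.Form :=
    doubleForm M ρ ∘ₗ baseFormMap M ρ ∘ₗ (repDatum ρ).formEquiv.toLinearMap
  refine PreCalculus.nonempty_iso_restrict (baseEquiv G)
    ((repDatum ρ).isCalculus (repDatum_varpi_surjective ρ)) Φ
    (((doubleDatum M ρ).formEquiv.symm.injective.comp (baseFormMap_injective hM)).comp
      (repDatum ρ).formEquiv.injective) fun a b => ?_
  have h1 : Φ ∘ₗ (repCalculus ρ).adb = (doubleDatum M ρ).calculus.adb ∘ₗ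
      TensorProduct.map (iotaHom G).toLinearMap (iotaHom G).toLinearMap := by
    refine TensorProduct.ext ((MonoidAlgebra.basis G ℂ).ext fun h =>
      (MonoidAlgebra.basis G ℂ).ext fun g => ?_)
    rw [MonoidAlgebra.basis_apply, MonoidAlgebra.basis_apply]
    refine (baseFormMap_smul_d g h).trans ?_
    rw [← iotaHom_single, ← iotaHom_single]
    rfl
  exact LinearMap.congr_fun h1 (a ⊗ₜ b)

end CrossedModule

/-! ### The calculi of conjugation-stable sets on `ℂ(G)`. -/

section SetCalculus

set_option linter.unusedSectionVars false

variable {G : Type*} [Group G] [Fintype G] [DecidableEq G]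

theorem FunAlg.counit_apply (f : FunAlg G) : Coalgebra.counit (R := ℂ) f = (f : G → ℂ) 1 := by
  have : (Coalgebra.counit : FunAlg G →ₗ[ℂ] ℂ) = (LinearMap.proj 1 : (G → ℂ) →ₗ[ℂ] ℂ) := by
    refine (FunAlg.basis G).ext fun g => ?_
    rw [FunAlg.basis_apply, FunAlg.counit_delta]
    change _ = (Pi.single g (1 : ℂ) : G → ℂ) 1
    rw [Pi.single_apply]
    simp only [eq_comm]
  exact LinearMap.congr_fun this f

theorem FunAlg.delta_apply (g x : G) : (FunAlg.delta g : G → ℂ) x = if x = g then 1 else 0 :=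
  Pi.single_apply g (1 : ℂ) x

theorem setDatum_varpi_apply (S : Set G) (f : FunAlg G) (s : S) :
    ((setDatum S).varpi f : S → ℂ) s = (f : G → ℂ) s - (f : G → ℂ) 1 := by
  change (f : G → ℂ) s - Coalgebra.counit (R := ℂ) f = _
  rw [FunAlg.counit_apply]

theorem setDatum_varpi_surjective {S : Set G} (hS : (1 : G) ∉ S) :
    Function.Surjective (setDatum S).varpi := by
  classical
  intro v
  -- Extension by zero vanishes at `e` because `e ∉ S`, so the counit term drops out.
  let f : FunAlg G := fun g => if h : g ∈ S then (v : S → ℂ) ⟨g, h⟩ else 0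
  refine ⟨f, funext fun s => (setDatum_varpi_apply S f s).trans ?_⟩
  simp [f, hS]

theorem setDatum_varpi_eq_zero_iff (S : Set G) (f : FunAlg G)
    (hf : Coalgebra.counit (R := ℂ) f = 0) :
    (setDatum S).varpi f = 0 ↔ ∀ s ∈ S, (f : G → ℂ) s = 0 := by
  rw [FunAlg.counit_apply] at hf
  have h1 : ∀ s : S, ((setDatum S).varpi f : S → ℂ) s = (f : G → ℂ) s := fun s => by
    rw [setDatum_varpi_apply, hf, sub_zero]
  constructor
  · intro h s hs
    rw [← h1 ⟨s, hs⟩, h]; rfl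
  · intro h
    exact funext fun s => (h1 s).trans (h s s.2)

/-- The right coaction `e_s ↦ ∑_f e_{f⁻¹sf} ⊗ δ_{f⁻¹}` on `Λ¹_S`. -/
noncomputable def setCoact (S : Set G) (hS : ∀ u : G, ∀ s ∈ S, u * s * u⁻¹ ∈ S) :
    (S → ℂ) →ₗ[ℂ] (S → ℂ) ⊗[ℂ] FunAlg G :=
  ∑ u : G, (TensorProduct.mk ℂ (S → ℂ) (FunAlg G)).flip (FunAlg.delta u⁻¹) ∘ₗ
    LinearMap.funLeft ℂ ℂ fun s : S => (⟨u * s * u⁻¹, hS u s s.2⟩ : S)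

/-- After the substitution `a ↦ g a⁻¹` the terms agree one by one, since conjugation by `a` takes
`a⁻¹g` to `g a⁻¹`. Stability of `S` makes the coaction well defined. -/
theorem setCalculus_isBicovariant (S : Set G) (hS : ∀ u : G, ∀ s ∈ S, u * s * u⁻¹ ∈ S) :
    (setCalculus S).IsBicovariant := by
  let ϖ : FunAlg G →ₗ[ℂ] (S → ℂ) := (setDatum S).varpi
  let m : FunAlg G ⊗[ℂ] ((S → ℂ) ⊗[ℂ] FunAlg G) →ₗ[ℂ] (S → ℂ) ⊗[ℂ] FunAlg G :=
    (LinearMap.mul' ℂ (FunAlg G)).lTensor (S → ℂ) ∘ₗ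
      (TensorProduct.leftComm ℂ (FunAlg G) (S → ℂ) (FunAlg G)).toLinearMap
  have hm : ∀ (a b : FunAlg G) (v : S → ℂ), m (a ⊗ₜ (v ⊗ₜ b)) = v ⊗ₜ (a * b) := by
    intro a b v; simp [m]
  suffices h : m ∘ₗ (setCoact S hS ∘ₗ ϖ).lTensor (FunAlg G) ∘ₗ Coalgebra.comul =
      ϖ.rTensor (FunAlg G) ∘ₗ Coalgebra.comul from
    (setDatum S).isBicovariant (setCoact S hS) (LinearMap.congr_fun h)
  refine (FunAlg.basis G).ext fun g => ?_
  simp only [FunAlg.basis_apply, LinearMap.comp_apply, FunAlg.comul_delta, map_sum,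
    LinearMap.lTensor_tmul, LinearMap.rTensor_tmul]
  rw [← Equiv.sum_comp ((Equiv.inv G).trans (Equiv.mulLeft g))
    (fun a => ϖ (FunAlg.delta a) ⊗ₜ[ℂ] FunAlg.delta (a⁻¹ * g))]
  refine Finset.sum_congr rfl fun a _ => ?_
  simp only [setCoact, LinearMap.sum_apply, LinearMap.comp_apply, LinearMap.flip_apply,
    TensorProduct.mk_apply, TensorProduct.tmul_sum, map_sum, hm, FunAlg.delta_mul_delta]
  rw [Finset.sum_eq_single a⁻¹ (fun u _ hu => by
    rw [if_neg (fun h => hu (by rw [h, inv_inv])), TensorProduct.tmul_zero]) (by simp),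
    if_pos (inv_inv a).symm, Equiv.trans_apply, Equiv.inv_apply, Equiv.coe_mulLeft]
  have e2 : (g * a⁻¹)⁻¹ * g = a := by group
  rw [e2]
  congr 1
  funext s
  rw [LinearMap.funLeft_apply]
  refine (setDatum_varpi_apply S _ _).trans (Eq.trans ?_ (setDatum_varpi_apply S _ _).symm)
  simp only [FunAlg.delta_apply, inv_inv]
  have e3 : (a⁻¹ * (s : G) * a = a⁻¹ * g) ↔ ((s : G) = g * a⁻¹) := by
    rw [mul_assoc, mul_right_inj, eq_mul_inv_iff_mul_eq]
  have e4 : (1 = a⁻¹ * g) ↔ (1 = g * a⁻¹) := by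
    rw [eq_inv_mul_iff_mul_eq, mul_one, eq_mul_inv_iff_mul_eq, one_mul]
  simp only [e3, e4]

end SetCalculus

/-! ### Irreducible representations: invariants and Burnside's theorem. -/

section Irreducible

variable {k Γ V : Type*} [Field k] [Group Γ] [AddCommGroup V] [Module k V]

theorem Representation.invariants_eq_bot (π : Representation k Γ V) [π.IsIrreducible]
    (h : ¬ π.IsTrivial) {v : V} (hv : ∀ g, π g v = v) : v = 0 := by
  let σ : Subrepresentation π := ⟨π.invariants, fun g v hv => by rwa [hv g]⟩
  rcases eq_bot_or_eq_top σ with h1 | h1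
  · have : v ∈ σ := hv
    rw [h1] at this
    exact this
  · refine absurd ⟨fun g => LinearMap.ext fun w => ?_⟩ h
    have : w ∈ σ := by rw [h1]; trivial
    exact this g

theorem Representation.IsIrreducible.nontrivial_space (π : Representation k Γ V)
    [π.IsIrreducible] : Nontrivial V :=
  IsSimpleModule.nontrivial (MonoidAlgebra k Γ) π.asModule

/-- Burnside's theorem: an irreducible representation of a finite group over an algebraically
closed field spans the endomorphism algebra. -/
theorem Representation.asAlgebraHom_surjective [IsAlgClosed k] [Finite Γ]
    (π : Representation k Γ V) [π.IsIrreducible] : Function.Surjective π.asAlgebraHom := by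
  have : Module.Finite k (MonoidAlgebra k Γ) :=
    Module.Finite.of_basis (MonoidAlgebra.basis Γ k)
  have : Module.Finite k π.asModule := Module.Finite.trans (MonoidAlgebra k Γ) π.asModule
  intro f
  -- By Schur's lemma the commutant consists of scalars, so every linear `f` lies in the double
  -- commutant. Jacobson density then yields an element of the group algebra agreeing with `f` on a
  -- finite spanning set.
  let F : Module.End (Module.End (MonoidAlgebra k Γ) π.asModule) π.asModule :=
    { toFun := f
      map_add' := f.map_add
      map_smul' := fun φ v => by
        obtain ⟨c, rfl⟩ := (IsSimpleModule.algebraMap_end_bijective_of_isAlgClosed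
          (A := MonoidAlgebra k Γ) (V := π.asModule) k).2 φ
        exact f.map_smul c v }
  obtain ⟨s, hs⟩ := Module.Finite.fg_top (R := k) (M := π.asModule)
  obtain ⟨a, ha⟩ := jacobson_density F s
  refine ⟨a, ?_⟩
  have h1 : Set.EqOn (π.asAlgebraHom a) f (s : Set π.asModule) := fun v hv => (ha v hv).symm
  exact LinearMap.ext_on hs h1

end Irreducible

/-! ### The module `V_{C,π}`: surjectivity of `varpi` and the ideal `p(I)`. -/

section Double

set_option linter.unusedSectionVars false

open Dvee

variable {G : Type*} [Group G] {r : G} {V : Type*} [AddCommGroup V] [Module ℂ V]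

theorem gradeAct_single (f : FunAlg G) (c : conjugatesOf r) (w : V) :
    gradeAct r V f (Finsupp.single c w) = Finsupp.single c ((f : G → ℂ) c • w) := by
  simp [gradeAct]

theorem gradeAct_apply (f : FunAlg G) (w : conjugatesOf r →₀ V) (c : conjugatesOf r) :
    gradeAct r V f w c = (f : G → ℂ) c • w c := by
  induction w using Finsupp.induction_linear with
  | zero => simp
  | add x y hx hy => rw [map_add, Finsupp.add_apply, hx, hy, Finsupp.add_apply, smul_add]
  | single c' w =>
    rw [gradeAct_single]
    by_cases h : c' = c
    · subst h; simp
    · simp [Finsupp.single_eq_of_ne (Ne.symm h)]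

variable (q : conjugatesOf r → G) (hq : ∀ c, q c * r * (q c)⁻¹ = c)
  (π : Representation ℂ (Subgroup.centralizer ({r} : Set G)) V)

theorem inducedRep_single (h : G) (c : conjugatesOf r) (w : V) :
    inducedRep q hq π h (Finsupp.single c w) =
      Finsupp.single (conjClassAct h c) (π (centCocycle q hq h c) w) := by
  simp [inducedRep]

theorem conjClassAct_injective (h : G) :
    Function.Injective (conjClassAct h : conjugatesOf r → conjugatesOf r) := by
  intro c c' hc
  have := congrArg Subtype.val hc
  exact Subtype.ext (by simpa [conjClassAct] using this)

theorem inducedRep_apply (h : G) (w : conjugatesOf r →₀ V) (c : conjugatesOf r) :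
    inducedRep q hq π h w (conjClassAct h c) = π (centCocycle q hq h c) (w c) := by
  induction w using Finsupp.induction_linear with
  | zero => simp
  | add x y hx hy => rw [map_add, Finsupp.add_apply, hx, hy, Finsupp.add_apply, map_add]
  | single c' w =>
    rw [inducedRep_single]
    by_cases h1 : c' = c
    · subst h1; simp
    · rw [Finsupp.single_eq_of_ne (fun h2 => h1 (conjClassAct_injective h h2).symm),
        Finsupp.single_eq_of_ne (Ne.symm h1), map_zero]

/-- `q_{c'} z q_c⁻¹` maps `c` to `c'` and acts there by `π(z)`. -/
theorem inducedRep_single_transport (c c' : conjugatesOf r)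
    (z : Subgroup.centralizer ({r} : Set G)) (w : V) :
    inducedRep q hq π (q c' * z * (q c)⁻¹) (Finsupp.single c w) = Finsupp.single c' (π z w) := by
  have hz : (z : G) * r * (z : G)⁻¹ = r := by
    rw [Subgroup.mem_centralizer_singleton_iff.1 z.2, mul_inv_cancel_right]
  have h1 : conjClassAct (q c' * z * (q c)⁻¹) c = c' := by
    refine Subtype.ext ?_
    change q c' * z * (q c)⁻¹ * (c : G) * (q c' * z * (q c)⁻¹)⁻¹ = (c' : G)
    rw [← hq c, ← hq c']
    calc _ = q c' * ((z : G) * r * (z : G)⁻¹) * (q c')⁻¹ := by group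
      _ = _ := by rw [hz]
  have h2 : centCocycle q hq (q c' * z * (q c)⁻¹) c = z := by
    refine Subtype.ext ?_
    change (q (conjClassAct (q c' * z * (q c)⁻¹) c))⁻¹ * (q c' * z * (q c)⁻¹) * q c = z
    rw [h1]
    group
  rw [inducedRep_single, h1, h2]

/-- The elements `q_c z q_c⁻¹` fix `c` and act on its block by `π(z)`, so each component of an
invariant vector is `π`-invariant and hence zero. -/
theorem inducedRep_invariants_eq_zero [π.IsIrreducible] (hπ : ¬ π.IsTrivial)
    {w : conjugatesOf r →₀ V} (hw : ∀ h, inducedRep q hq π h w = w) : w = 0 := by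
  refine Finsupp.ext fun c => π.invariants_eq_bot hπ fun z => ?_
  have h1 := inducedRep_apply q hq π (q c * z * (q c)⁻¹) w c
  have h2 : ∀ v, Finsupp.single (conjClassAct (q c * z * (q c)⁻¹) c)
      (π (centCocycle q hq (q c * z * (q c)⁻¹) c) v) = Finsupp.single c (π z v) := fun v => by
    rw [← inducedRep_single, inducedRep_single_transport]
  have h3 : conjClassAct (q c * z * (q c)⁻¹) c = c := by
    have hz : (z : G) * r * (z : G)⁻¹ = r := by
      rw [Subgroup.mem_centralizer_singleton_iff.1 z.2, mul_inv_cancel_right]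
    refine Subtype.ext ?_
    change q c * z * (q c)⁻¹ * (c : G) * (q c * z * (q c)⁻¹)⁻¹ = (c : G)
    rw [← hq c]
    calc _ = q c * ((z : G) * r * (z : G)⁻¹) * (q c)⁻¹ := by group
      _ = _ := by rw [hz]
  have h4 := h2 (w c)
  rw [h3] at h4 h1
  rw [hw] at h1
  exact (Finsupp.single_injective c h4).symm.trans h1.symm

variable [DecidableEq G] [Fintype G]

theorem gradeAct_delta_single (g : G) (c : conjugatesOf r) (w : V) :
    gradeAct r V (FunAlg.delta g) (Finsupp.single c w) =
      if (c : G) = g then Finsupp.single c w else 0 := by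
  rw [gradeAct_single, FunAlg.delta_apply]
  split_ifs <;> simp

theorem gradeAct_inducedRep_isCrossed : IsCrossed (gradeAct r V) (inducedRep q hq π) := by
  intro h g
  ext c w : 2
  simp only [LinearMap.comp_apply, Module.End.mul_apply, Finsupp.lsingle_apply, inducedRep_single,
    gradeAct_delta_single]
  have h1 : ((conjClassAct h c : conjugatesOf r) : G) = h * g * h⁻¹ ↔ (c : G) = g := by
    simp [conjClassAct]
  simp only [h1]
  split_ifs
  · rw [inducedRep_single]
  · rw [map_zero]

theorem sum_inducedRep [π.IsIrreducible] (hπ : ¬ π.IsTrivial) :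
    ∑ h : G, inducedRep q hq π h = 0 := by
  refine LinearMap.ext fun w => inducedRep_invariants_eq_zero q hq π hπ fun g => ?_
  rw [LinearMap.sum_apply, map_sum]
  exact Fintype.sum_equiv (Equiv.mulLeft g) _ _ fun h => by
    rw [Equiv.coe_mulLeft, map_mul, Module.End.mul_apply]

/-- `|G|⁻¹ ∑_h h`. -/
noncomputable def groupAverage (G : Type*) [Group G] [Fintype G] : MonoidAlgebra ℂ G :=
  (Fintype.card G : ℂ)⁻¹ • ∑ h : G, MonoidAlgebra.single h 1

theorem counit_groupAverage : Coalgebra.counit (R := ℂ) (groupAverage G) = 1 := by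
  simp [groupAverage]

theorem asAlgebraHom_groupAverage [π.IsIrreducible] (hπ : ¬ π.IsTrivial) :
    (inducedRep q hq π).asAlgebraHom (groupAverage G) = 0 := by
  rw [groupAverage, map_smul, map_sum]
  simp only [Representation.asAlgebraHom_single_one]
  rw [sum_inducedRep q hq π hπ, smul_zero]

theorem projFun_mk (f : FunAlg G) (a : MonoidAlgebra ℂ G) :
    projFun G (mk f a) = Coalgebra.counit (R := ℂ) a • f := by
  change Algebra.TensorProduct.rid ℂ ℂ (FunAlg G) (f ⊗ₜ[ℂ] Coalgebra.counit (R := ℂ) a) = _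
  simp

theorem counit_eq_counit_projFun (x : Dvee G) :
    Coalgebra.counit (R := ℂ) x = Coalgebra.counit (R := ℂ) (projFun G x) := by simp

/-- The element `δ_{c'} ⊗ q_{c'} z q_c⁻¹` acts as `π(z)` from block `c` to block `c'` and as zero on
the other blocks. By Burnside's theorem the `π(z)` span `End V`, so all blocks of an operator are
reached. -/
theorem doubleRep_surjective [π.IsIrreducible] :
    Function.Surjective (doubleRep (gradeAct r V) (inducedRep q hq π)) := by
  have : Finite (conjugatesOf r) := inferInstance
  have := Fintype.ofFinite (conjugatesOf r)
  rw [← LinearMap.range_eq_top, eq_top_iff]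
  rintro T -
  have h1 : ∀ (c c' : conjugatesOf r) (E : Module.End ℂ V), (Finsupp.lsingle c' ∘ₗ E ∘ₗ
      Finsupp.lapply c : Module.End ℂ (conjugatesOf r →₀ V)) ∈
        LinearMap.range (doubleRep (gradeAct r V) (inducedRep q hq π)) := by
    intro c c' E
    obtain ⟨a, rfl⟩ := π.asAlgebraHom_surjective E
    induction a using MonoidAlgebra.induction_linear with
    | zero => simp
    | add x y hx hy =>
      rw [map_add, LinearMap.add_comp, LinearMap.comp_add]; exact add_mem hx hy
    | single z x =>
      rw [Representation.asAlgebraHom_single, LinearMap.smul_comp, LinearMap.comp_smul]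
      refine Submodule.smul_mem _ _ ⟨el c' (q c' * z * (q c)⁻¹), ?_⟩
      rw [doubleRep_el]
      ext b w : 2
      simp only [LinearMap.comp_apply, Module.End.mul_apply, Finsupp.lsingle_apply,
        Finsupp.lapply_apply]
      by_cases hb : b = c
      · subst hb
        rw [inducedRep_single_transport, gradeAct_single, FunAlg.delta_apply, if_pos rfl, one_smul,
          Finsupp.single_eq_same]
      · rw [Finsupp.single_eq_of_ne (Ne.symm hb), map_zero, Finsupp.single_zero, inducedRep_single,
          gradeAct_single, FunAlg.delta_apply, if_neg, zero_smul, Finsupp.single_zero]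
        intro h2
        -- Only the permutation of `C` matters here. The trivial representation on `ℂ` supplies a
        -- nonzero vector, from which `c ↦ c'` is read off.
        have h3 := inducedRep_single_transport q hq (1 : Representation ℂ _ ℂ) c c' z 1
        rw [inducedRep_single] at h3
        have h4 := (Finsupp.single_eq_single_iff _ _ _ _).1 h3
        rcases h4 with ⟨h4, -⟩ | ⟨h4, -⟩
        · exact hb (conjClassAct_injective _ ((Subtype.ext h2).trans h4.symm))
        · simp at h4
  have h2 : T = ∑ c : conjugatesOf r, ∑ c' : conjugatesOf r,
      Finsupp.lsingle c' ∘ₗ (Finsupp.lapply c' ∘ₗ T ∘ₗ Finsupp.lsingle c) ∘ₗ Finsupp.lapply c := by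
    ext b w c'
    simp only [LinearMap.comp_apply, LinearMap.sum_apply, Finsupp.lsingle_apply,
        Finsupp.lapply_apply, Finsupp.finsetSum_apply]
    rw [Finset.sum_eq_single b, Finset.sum_eq_single c']
    · simp
    · intro c _ hc; rw [Finsupp.single_eq_of_ne (Ne.symm hc)]
    · simp
    · intro c _ hc; simp [Finsupp.single_eq_of_ne hc]
    · simp
  rw [h2]
  exact sum_mem fun c _ => sum_mem fun c' _ => h1 c c' _

/-- If `x` acts by zero and has counit `1`, then `y - ε(y) x` lies in the augmentation ideal and
acts as `y`. -/
theorem doubleDatum_varpi_surjective [π.IsIrreducible] (hne : ¬ (r = 1 ∧ π.IsTrivial)) :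
    Function.Surjective (doubleDatum (gradeAct r V) (inducedRep q hq π)).varpi := by
  have h0 : ∃ x : Dvee G, doubleRep (gradeAct r V) (inducedRep q hq π) x = 0 ∧
      Coalgebra.counit (R := ℂ) x = 1 := by
    by_cases hr : r = 1
    · have hπ : ¬ π.IsTrivial := fun h => hne ⟨hr, h⟩
      refine ⟨mk (FunAlg.delta 1) (groupAverage G), ?_, ?_⟩
      · rw [doubleRep_mk, asAlgebraHom_groupAverage q hq π hπ, mul_zero]
      · rw [counit_eq_counit_projFun, projFun_mk, counit_groupAverage, one_smul,
          FunAlg.counit_delta, if_pos rfl]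
    -- For `r ≠ e` the class does not contain `e`, so `δ_e` acts by zero.
    · refine ⟨mk (FunAlg.delta 1) 1, ?_, ?_⟩
      · rw [doubleRep_mk, map_one, mul_one]
        refine LinearMap.ext fun w => Finsupp.ext fun c => ?_
        rw [gradeAct_apply, FunAlg.delta_apply, if_neg, zero_smul]
        · rfl
        · intro hc
          refine hr ?_
          have := c.2
          rw [hc] at this
          exact isConj_one_left.1 this
      · rw [counit_eq_counit_projFun, projFun_mk, Bialgebra.counit_one, one_smul,
          FunAlg.counit_delta, if_pos rfl]
  obtain ⟨x, hx, hx1⟩ := h0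
  intro T
  obtain ⟨y, rfl⟩ := doubleRep_surjective q hq π T
  refine ⟨y - Coalgebra.counit (R := ℂ) y • x, ?_⟩
  change doubleVarpi _ _ _ = _
  rw [doubleVarpi_apply, map_sub, map_sub, map_smul, map_smul, hx, hx1]
  simp

/-- On an invariant vector the group part acts through its counit, which is what `p` applies to it.
-/
theorem doubleRep_apply_of_invariant {M : FunAlg G →ₐ[ℂ] Module.End ℂ V} {ρ : Representation ℂ G V}
    {v : V} (hv : ∀ h, ρ h v = v) (x : Dvee G) : doubleRep M ρ x v = M (projFun G x) v := by
  have : (doubleRep M ρ).flip v = M.toLinearMap.flip v ∘ₗ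
      (projFun G : Dvee G →ₐ[ℂ] FunAlg G).toLinearMap := ext_el fun g h => by
    change doubleRep M ρ (el g h) v = M (projFun G (el g h)) v
    rw [doubleRep_el, Module.End.mul_apply, hv, projFun_el]
  exact LinearMap.congr_fun this x

/-- The right ideal `p(I)` for the calculus of a crossed module. -/
theorem mem_map_ideal_iff {M : FunAlg G →ₐ[ℂ] Module.End ℂ V} {ρ : Representation ℂ G V}
    (f : FunAlg G) (hf : Coalgebra.counit (R := ℂ) f = 0) :
    f ∈ (doubleDatum M ρ).calculus.ideal.map
      (projFun G : Dvee G →ₐ[ℂ] FunAlg G).toLinearMap ↔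
      ∃ x, doubleRep M ρ x = 0 ∧ projFun G x = f := by
  have h1 : ∀ x : Dvee G, Coalgebra.counit (R := ℂ) x = 0 →
      (doubleDatum M ρ).varpi x = doubleRep M ρ x := fun x hx => by
    change doubleVarpi _ _ _ = _
    rw [doubleVarpi_apply, hx, zero_smul, sub_zero]
  constructor
  · rintro ⟨x, hx, rfl⟩
    obtain ⟨hx1, hx2⟩ := ((doubleDatum M ρ).mem_ideal_iff x).1 hx
    exact ⟨x, (h1 x hx1).symm.trans hx2, rfl⟩
  · rintro ⟨x, hx, rfl⟩
    have hx1 : Coalgebra.counit (R := ℂ) x = 0 := by rw [counit_eq_counit_projFun, hf]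
    exact ⟨x, ((doubleDatum M ρ).mem_ideal_iff x).2 ⟨hx1, (h1 x hx1).trans hx⟩, rfl⟩

theorem mem_map_ideal_iff_of_trivial [π.IsIrreducible] (hπ : π.IsTrivial) (f : FunAlg G)
    (hf : Coalgebra.counit (R := ℂ) f = 0) :
    f ∈ (doubleCalculus q hq π).ideal.map (projFun G : Dvee G →ₐ[ℂ] FunAlg G).toLinearMap ↔
      (setDatum (conjugatesOf r)).varpi f = 0 := by
  rw [setDatum_varpi_eq_zero_iff _ f hf]
  refine (mem_map_ideal_iff f hf).trans ⟨?_, fun h => ⟨mk f 1, ?_, ?_⟩⟩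
  · rintro ⟨x, hx, rfl⟩ s hs
    have := Fintype.ofFinite (conjugatesOf r)
    have := Representation.IsIrreducible.nontrivial_space π
    obtain ⟨w, hw⟩ := exists_ne (0 : V)
    -- For trivial `π` this vector is invariant and has no zero component. If `x` acts by zero, so
    -- does `p x` on `v`, and therefore `p x` vanishes on the class.
    let v : conjugatesOf r →₀ V := ∑ c : conjugatesOf r, Finsupp.single c w
    have hv1 : ∀ c, v c = w := fun c => by
      rw [Finsupp.finsetSum_apply, Finset.sum_eq_single c] <;> simp +contextual
    have hv : ∀ h, inducedRep q hq π h v = v := fun h => by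
      rw [map_sum]
      simp only [inducedRep_single, hπ.out, LinearMap.id_apply]
      exact (Equiv.ofBijective _ (Finite.injective_iff_bijective.1
        (conjClassAct_injective h))).sum_comp (fun c => Finsupp.single c w)
    have h1 := doubleRep_apply_of_invariant (M := gradeAct r V) hv x
    rw [hx] at h1
    have h2 := DFunLike.congr_fun h1 ⟨s, hs⟩
    rw [gradeAct_apply, hv1] at h2
    exact (smul_eq_zero.1 h2.symm).resolve_right hw
  · rw [doubleRep_mk, map_one, mul_one]
    refine LinearMap.ext fun w => Finsupp.ext fun c => ?_
    rw [gradeAct_apply, h c c.2, zero_smul]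
    rfl
  · rw [projFun_mk, Bialgebra.counit_one, one_smul]

/-- Both sides always hold: `f ⊗ average` acts by zero and projects to `f`, so `p(I)` is all of
`H⁺`. The empty set stands for the zero calculus. -/
theorem mem_map_ideal_iff_of_not_trivial [π.IsIrreducible] (hπ : ¬ π.IsTrivial) (f : FunAlg G)
    (hf : Coalgebra.counit (R := ℂ) f = 0) :
    f ∈ (doubleCalculus q hq π).ideal.map (projFun G : Dvee G →ₐ[ℂ] FunAlg G).toLinearMap ↔
      (setDatum (∅ : Set G)).varpi f = 0 := by
  rw [setDatum_varpi_eq_zero_iff _ f hf]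
  refine (mem_map_ideal_iff f hf).trans ⟨by simp, fun _ => ⟨mk f (groupAverage G), ?_, ?_⟩⟩
  · rw [doubleRep_mk, asAlgebraHom_groupAverage q hq π hπ, mul_zero]
  · rw [projFun_mk, counit_groupAverage, one_smul]

theorem nonempty_iso_setCalculus_of_trivial [π.IsIrreducible] (hr : r ≠ 1) (hπ : π.IsTrivial) :
    Nonempty (PreCalculus.Iso AlgEquiv.refl
      (fibreCalculus (projFun G) (projFun_surjective G) (doubleCalculus q hq π))
      (setCalculus (conjugatesOf r))) :=
  MaurerCartanDatum.nonempty_iso_ofRightIdeal _ _ _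
    (setDatum_varpi_surjective fun h => hr (isConj_one_left.1 h))
    (mem_map_ideal_iff_of_trivial q hq π hπ)

theorem nonempty_iso_setCalculus_of_not_trivial [π.IsIrreducible] (hπ : ¬ π.IsTrivial) :
    Nonempty (PreCalculus.Iso AlgEquiv.refl
      (fibreCalculus (projFun G) (projFun_surjective G) (doubleCalculus q hq π))
      (setCalculus (∅ : Set G))) :=
  MaurerCartanDatum.nonempty_iso_ofRightIdeal _ _ _
    (setDatum_varpi_surjective (by simp))
    (mem_map_ideal_iff_of_not_trivial q hq π hπ)

end Double

/-! ### The theorem. -/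

theorem mainTheorem5 {G : Type*} [Group G] [Fintype G] [DecidableEq G] (r : G)
    (q : conjugatesOf r → G) (hq : ∀ c, q c * r * (q c)⁻¹ = c)
    {V : Type*} [AddCommGroup V] [Module ℂ V]
    (π : Representation ℂ (Subgroup.centralizer ({r} : Set G)) V) [π.IsIrreducible]
    (hne : ¬ (r = 1 ∧ π.IsTrivial)) :
    IsPrincipalHomogeneousBundle (Dvee.projFun G) (doubleCalculus q hq π)
      ((doubleCalculus q hq π).restrict (bundleBase (Dvee.projFun G)))
      (fibreCalculus (Dvee.projFun G) (Dvee.projFun_surjective G) (doubleCalculus q hq π)) ∧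
    (∃ e : MonoidAlgebra ℂ G ≃ₐ[ℂ] bundleBase (Dvee.projFun G),
      (∀ g : G, (e (MonoidAlgebra.single g 1) : Dvee G) = ∑ f : G, Dvee.el f (f⁻¹ * g * f)) ∧
      Nonempty (PreCalculus.Iso e (repCalculus (inducedRep q hq π))
        ((doubleCalculus q hq π).restrict (bundleBase (Dvee.projFun G))))) ∧
    (π.IsTrivial → Nonempty (PreCalculus.Iso AlgEquiv.refl
      (fibreCalculus (Dvee.projFun G) (Dvee.projFun_surjective G) (doubleCalculus q hq π))
      (setCalculus (conjugatesOf r)))) ∧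
    (¬ π.IsTrivial → Subsingleton
      (fibreCalculus (Dvee.projFun G) (Dvee.projFun_surjective G)
        (doubleCalculus q hq π)).invariantForms) := by
  have hD := doubleDatum_varpi_surjective q hq π hne
  have hbi : (doubleCalculus q hq π).IsBicovariant :=
    doubleDatum_isBicovariant (gradeAct_inducedRep_isCrossed q hq π)
  have htriv : π.IsTrivial → Nonempty (PreCalculus.Iso AlgEquiv.refl
      (fibreCalculus (Dvee.projFun G) (Dvee.projFun_surjective G) (doubleCalculus q hq π))
      (setCalculus (conjugatesOf r))) := fun hπ =>
    nonempty_iso_setCalculus_of_trivial q hq π (fun hr => hne ⟨hr, hπ⟩) hπ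
  refine ⟨?_, ⟨Dvee.baseEquiv G, fun g => Dvee.iotaHom_single g,
    nonempty_iso_repCalculus (gradeAct_inducedRep_isCrossed q hq π)⟩, htriv, fun hπ => ?_⟩
  · exact
      { surjective := Dvee.projFun_surjective G
        galois := Dvee.galoisMap_bijective
        isCalculus_total := MaurerCartanDatum.isCalculus _ hD
        isCalculus_base := PreCalculus.restrict_isCalculus _ _
        isCalculus_fibre := MaurerCartanDatum.isCalculus _
          (MaurerCartanDatum.ofRightIdeal_varpi_surjective _ _)
        bicovariant_total := hbi
        bicovariant_fibre := by
          by_cases hπ : π.IsTrivial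
          · exact (htriv hπ).some.isBicovariant (setCalculus_isBicovariant _ fun u s hs =>
              hs.trans (isConj_iff.2 ⟨u, rfl⟩))
          · exact (nonempty_iso_setCalculus_of_not_trivial q hq π hπ).some.isBicovariant
              (setCalculus_isBicovariant _ fun u s hs => hs.elim)
        covariant_total := by
          -- As `Δ_R = (id ⊗ p) Δ`, its extension is the right coaction of `P` on forms followed by
          -- `id ⊗ p`.
          rw [bundleCoaction, PreCalculus.coactFst_map]
          exact hbi.2.comp _
        homogeneous := by
          obtain ⟨lam, hlam⟩ := exists_restrict_comul (bundleBase (Dvee.projFun G))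
            Dvee.comul_mem_range_of_mem_bundleBase
          exact ⟨lam, hlam, PreCalculus.restrict_extends_coactFst _ _ lam hlam hbi,
            PreCalculus.restrict_extends_coactSnd _ _ lam hlam hbi⟩
        exact := exists_exact_ver (Dvee.projFun G) (Dvee.projFun_surjective G) _ hD
          doubleForm_mem_span }
  · obtain ⟨I⟩ := nonempty_iso_setCalculus_of_not_trivial q hq π hπ
    have : Subsingleton (setCalculus (∅ : Set G)).Form :=
      inferInstanceAs (Subsingleton (FunAlg G ⊗[ℂ] ((∅ : Set G) → ℂ)))
    have := I.toEquiv.subsingleton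
    infer_instance
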